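/- **Theorem.** There is a deterministic parallel algorithm which, given a weighted directed graph $G=(V,E,w)$ with $n\ge 2$ vertices, $m$ edges and arbitrary real edge weights (positive or negative) that contains no cycle of negative weight, a source vertex $s\in V$ and an integer $h$ with $1\le h\le n$, computes shortest paths from $s$ to all vertices: for every vertex $t$ that is reachable from $s$ it outputs the distance from $s$ to $t$ and a path from $s$ to $t$ of minimum weight (as the sequence of its vertices), and for every other vertex it reports that it is not reachable. The algorithm uses $$O\!\left(mn\log^2 n+n^3h^{-3}\log^7 n+n^2h\log^{11} n\right)\ \text{work}\qquad\text{and}\qquad O\!\left(h+\log^{11} n\right)\ \text{depth},$$ with absolute constants (independent of $G$, $w$, $s$, $h$, $n$, $m$). Here the graph has at most one edge $(u,v)$ for each ordered pair of vertices (self-loops are allowed) and is given as an array of its edges with their weights, in arbitrary order. A path has no repeated vertices. An algorithm is one fixed program of an abstract parallel machine that operates on words of $O(\log n)$ bits with the usual integer arithmetic and on real numbers, for which the only instructions are the constant zero, addition and comparison; memory is addressed by words, and each memory cell is computed once, by one basic instruction, from a bounded number of cells computed before. The work is the total number of instructions executed, and the depth is the number of parallel steps, that is, the length of a longest chain of instructions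 executed one after the other. -/

import Mathlib

/-!
Part 1: a first-order, purely functional, data-parallel language over `O(log n)`-bit words and real
numbers, with its work / depth cost semantics.

Every word of memory is computed once, by one basic instruction from a bounded number of words that
were computed before.  The *work* is the total number of instructions that are executed, the *depth*
is the length of the longest chain of instructions that depend on each other.  Concurrent reading is
allowed, and there is no concurrent writing, since nothing is overwritten.  The only instructions on
real numbers are the constant zero, addition and comparison.  A program is a finite piece of syntax;
it contains no real constants except zero.
-/

namespace Par

/-- Data types: machine words, real numbers, pairs, arrays. -/
inductive Ty : Type
  | word : Ty
  | real : Ty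
  | prod : Ty → Ty → Ty
  | arr : Ty → Ty

/-- The values of a type. -/
@[reducible] def Ty.Val : Ty → Type
  | .word => ℕ
  | .real => ℝ
  | .prod a b => a.Val × b.Val
  | .arr a => List a.Val

/-- The default value of a type, returned by a read outside the bounds of an array. -/
noncomputable def Ty.dflt : (a : Ty) → a.Val
  | .word => (0 : ℕ)
  | .real => (0 : ℝ)
  | .prod a b => (a.dflt, b.dflt)
  | .arr _ => []

/-- `Var Γ a` are the variables of type `a` in the context `Γ` (de Bruijn indices). -/
inductive Var : List Ty → Ty → Type
  | zero {Γ : List Ty} {a : Ty} : Var (a :: Γ) a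
  | succ {Γ : List Ty} {a b : Ty} : Var Γ a → Var (b :: Γ) a

/-- Assignments of values to the variables of a context. -/
@[reducible] def Env : List Ty → Type
  | [] => Unit
  | a :: Γ => a.Val × Env Γ

/-- The value of a variable. -/
def Var.get : {Γ : List Ty} → {a : Ty} → Var Γ a → Env Γ → a.Val
  | _, _, .zero, ρ => ρ.1
  | _, _, .succ x, ρ => x.get ρ.2

/-- The basic instructions on words. -/
inductive WordOp : Type
  | add | sub | mul | div | mod | lt | eq

/-- Arithmetic on words of `w` bits: results are reduced modulo `2 ^ w`; subtraction is truncated at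
zero, division rounds down (with `a / 0 = 0` and `a % 0 = a`), and tests return `1` or `0`. -/
def WordOp.apply (w : ℕ) : WordOp → ℕ → ℕ → ℕ
  | .add, a, b => (a + b) % 2 ^ w
  | .sub, a, b => (a - b) % 2 ^ w
  | .mul, a, b => (a * b) % 2 ^ w
  | .div, a, b => (a / b) % 2 ^ w
  | .mod, a, b => (a % b) % 2 ^ w
  | .lt, a, b => (if a < b then 1 else 0) % 2 ^ w
  | .eq, a, b => (if a = b then 1 else 0) % 2 ^ w

/-- `Prog Γ a`: programs with input variables `Γ` and a result of type `a`. -/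
inductive Prog : List Ty → Ty → Type
  /-- read a variable -/
  | var {Γ : List Ty} {a : Ty} : Var Γ a → Prog Γ a
  /-- a word constant -/
  | lit {Γ : List Ty} : ℕ → Prog Γ .word
  /-- a basic instruction on words -/
  | op {Γ : List Ty} : WordOp → Prog Γ .word → Prog Γ .word → Prog Γ .word
  /-- the real number zero -/
  | rzero {Γ : List Ty} : Prog Γ .real
  /-- addition of real numbers -/
  | radd {Γ : List Ty} : Prog Γ .real → Prog Γ .real → Prog Γ .real
  /-- comparison of real numbers: `1` if the first is at most the second, else `0` -/
  | rle {Γ : List Ty} : Prog Γ .real → Prog Γ .real → Prog Γ .word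
  | pair {Γ : List Ty} {a b : Ty} : Prog Γ a → Prog Γ b → Prog Γ (.prod a b)
  | fst {Γ : List Ty} {a b : Ty} : Prog Γ (.prod a b) → Prog Γ a
  | snd {Γ : List Ty} {a b : Ty} : Prog Γ (.prod a b) → Prog Γ b
  /-- `if c ≠ 0 then e₁ else e₂`; only the branch that is taken is executed -/
  | ite {Γ : List Ty} {a : Ty} : Prog Γ .word → Prog Γ a → Prog Γ a → Prog Γ a
  /-- `let x := e₁; e₂`; in `e₂`, variable `0` is `x` -/
  | letIn {Γ : List Ty} {a b : Ty} : Prog Γ a → Prog (a :: Γ) b → Prog Γ b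
  /-- the length of an array -/
  | len {Γ : List Ty} {a : Ty} : Prog Γ (.arr a) → Prog Γ .word
  /-- read an entry of an array -/
  | get {Γ : List Ty} {a : Ty} : Prog Γ (.arr a) → Prog Γ .word → Prog Γ a
  /-- `tab k e`: the array `[e 0, …, e (k - 1)]`, with all entries computed in parallel; in `e`,
  variable `0` is the index -/
  | tab {Γ : List Ty} {a : Ty} : Prog Γ .word → Prog (.word :: Γ) a → Prog Γ (.arr a)
  /-- `loop k e₀ e`: `x := e₀; for i = 0, …, k - 1 do x := e i x`, sequentially; in `e`, variable `0`
  is the counter `i` and variable `1` is the current state `x` -/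
  | loop {Γ : List Ty} {a : Ty} :
      Prog Γ .word → Prog Γ a → Prog (.word :: a :: Γ) a → Prog Γ a
  /-- `loopWhile k e₀ c e`: `x := e₀; while c x ≠ 0 do x := e x`, stopped after `k` rounds at the
  latest; in `c` and `e`, variable `0` is the current state `x` -/
  | loopWhile {Γ : List Ty} {a : Ty} :
      Prog Γ .word → Prog Γ a → Prog (a :: Γ) .word → Prog (a :: Γ) a → Prog Γ a

/-- The outcome of a run: the value computed, the work and the depth. -/
structure Res (α : Type) : Type where
  val : α
  work : ℕ
  depth : ℕ

/-- `k` sequential rounds, starting from the state `x`. -/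
def Res.rounds {α : Type} (f : ℕ → α → Res α) (x : α) : ℕ → Res α
  | 0 => ⟨x, 0, 0⟩
  | k + 1 =>
    let r := Res.rounds f x k
    let q := f k r.val
    ⟨q.val, r.work + q.work + 1, r.depth + q.depth + 1⟩

/-- Sequential rounds while the test `c` holds, at most `k` of them, starting from the state `x`. -/
def Res.roundsWhile {α : Type} (c : α → Res ℕ) (f : α → Res α) : ℕ → α → Res α
  | 0, x => ⟨x, 0, 0⟩
  | k + 1, x =>
    let b := c x
    if b.val ≠ 0 then
      let q := f x
      let r := Res.roundsWhile c f k q.val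
      ⟨r.val, b.work + q.work + r.work + 1, b.depth + q.depth + r.depth + 1⟩
    else ⟨x, b.work + 1, b.depth + 1⟩

/-- The run of a program on words of `w` bits.  Each instruction costs one unit of work and one unit
of depth.  Both the work and the depth of parts that are executed one after the other add up; for the
entries of `tab`, which are computed in parallel, the work adds up and the depth is the maximum. -/
noncomputable def Prog.run (w : ℕ) : {Γ : List Ty} → {a : Ty} → Prog Γ a → Env Γ → Res a.Val
  | _, _, .var x, ρ => ⟨x.get ρ, 1, 1⟩
  | _, _, .lit k, _ => ⟨k % 2 ^ w, 1, 1⟩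
  | _, _, .op o e₁ e₂, ρ =>
    let r₁ := e₁.run w ρ
    let r₂ := e₂.run w ρ
    ⟨o.apply w r₁.val r₂.val, r₁.work + r₂.work + 1, r₁.depth + r₂.depth + 1⟩
  | _, _, .rzero, _ => ⟨(0 : ℝ), 1, 1⟩
  | _, _, .radd e₁ e₂, ρ =>
    let r₁ := e₁.run w ρ
    let r₂ := e₂.run w ρ
    ⟨((r₁.val : ℝ) + (r₂.val : ℝ) : ℝ), r₁.work + r₂.work + 1, r₁.depth + r₂.depth + 1⟩
  | _, _, .rle e₁ e₂, ρ =>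
    let r₁ := e₁.run w ρ
    let r₂ := e₂.run w ρ
    ⟨(if (r₁.val : ℝ) ≤ (r₂.val : ℝ) then 1 else 0 : ℕ) % 2 ^ w,
      r₁.work + r₂.work + 1, r₁.depth + r₂.depth + 1⟩
  | _, _, .pair e₁ e₂, ρ =>
    let r₁ := e₁.run w ρ
    let r₂ := e₂.run w ρ
    ⟨(r₁.val, r₂.val), r₁.work + r₂.work + 1, r₁.depth + r₂.depth + 1⟩
  | _, _, .fst e, ρ =>
    let r := e.run w ρ
    ⟨r.val.1, r.work + 1, r.depth + 1⟩
  | _, _, .snd e, ρ =>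
    let r := e.run w ρ
    ⟨r.val.2, r.work + 1, r.depth + 1⟩
  | _, _, .ite c e₁ e₂, ρ =>
    let r := c.run w ρ
    let q := if (r.val : ℕ) ≠ 0 then e₁.run w ρ else e₂.run w ρ
    ⟨q.val, r.work + q.work + 1, r.depth + q.depth + 1⟩
  | _, _, .letIn e₁ e₂, ρ =>
    let r := e₁.run w ρ
    let q := e₂.run w (r.val, ρ)
    ⟨q.val, r.work + q.work + 1, r.depth + q.depth + 1⟩
  | _, _, .len e, ρ =>
    let r := e.run w ρ
    ⟨r.val.length % 2 ^ w, r.work + 1, r.depth + 1⟩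
  | _, a, .get e₁ e₂, ρ =>
    let r₁ := e₁.run w ρ
    let r₂ := e₂.run w ρ
    ⟨r₁.val.getD r₂.val a.dflt, r₁.work + r₂.work + 1, r₁.depth + r₂.depth + 1⟩
  | _, _, .tab k e, ρ =>
    let r := k.run w ρ
    ⟨(List.range r.val).map fun i => (e.run w (i, ρ)).val,
      r.work + (∑ i ∈ Finset.range r.val, (e.run w (i, ρ)).work) + 1,
      r.depth + ((Finset.range r.val).sup fun i => (e.run w (i, ρ)).depth) + 1⟩
  | _, _, .loop k e₀ e, ρ =>
    let r := k.run w ρ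
    let r₀ := e₀.run w ρ
    let q := Res.rounds (fun i x => e.run w (i, x, ρ)) r₀.val r.val
    ⟨q.val, r.work + r₀.work + q.work + 1, r.depth + r₀.depth + q.depth + 1⟩
  | _, _, .loopWhile k e₀ c e, ρ =>
    let r := k.run w ρ
    let r₀ := e₀.run w ρ
    let q := Res.roundsWhile (fun x => c.run w (x, ρ)) (fun x => e.run w (x, ρ)) r.val r₀.val
    ⟨q.val, r.work + r₀.work + q.work + 1, r.depth + r₀.depth + q.depth + 1⟩

end Par

/-! Part 2: weighted directed graphs and the single-source shortest paths problem. -/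

namespace SSSP

variable {V : Type}

/-- The weight of a walk, given by the sequence of its vertices. -/
def weight (w : V → V → ℝ) : List V → ℝ
  | [] => 0
  | [_] => 0
  | u :: v :: p => w u v + weight w (v :: p)

/-- `p` is (the vertex sequence of) a path from `s` to `t`. -/
def IsPath (G : Digraph V) (s t : V) (p : List V) : Prop :=
  p.IsChain G.Adj ∧ p.head? = some s ∧ p.getLast? = some t ∧ p.Nodup

/-- `p` is a path from `s` to `t` of minimum weight. -/
def IsShortestPath (G : Digraph V) (w : V → V → ℝ) (s t : V) (p : List V) : Prop :=
  IsPath G s t p ∧ ∀ q, IsPath G s t q → weight w p ≤ weight w q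

/-- `c = [v₀, v₁, …, v_k]` with `k ≥ 1` and `v₀ = v_k` is (the vertex sequence of) a directed cycle;
self-loops are cycles. -/
def IsCycle (G : Digraph V) (c : List V) : Prop :=
  c.IsChain G.Adj ∧ 2 ≤ c.length ∧ c.head? = c.getLast? ∧ c.tail.Nodup

/-- There is no cycle of negative weight. -/
def NoNegativeCycle (G : Digraph V) (w : V → V → ℝ) : Prop :=
  ∀ c, IsCycle G c → 0 ≤ weight w c

open Par

/-- The input of an algorithm for the problem: the words `n` (number of vertices), `m` (number of
edges), `s` (source) and `h` (parameter), and the array of the edges, each with tail, head, weight. -/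
@[reducible] def inputTy : List Ty :=
  [.word, .word, .word, .word, .arr (.prod .word (.prod .word .real))]

/-- The output: for each vertex, a word that tells whether it is reachable, its distance, and the
vertex sequence of a path. -/
@[reducible] def outputTy : Ty := .arr (.prod .word (.prod .real (.arr .word)))

/-- The encoding of an instance, with the edges listed in the order given by `e`. -/
def encode {n m : ℕ} (G : Digraph (Fin n)) (w : Fin n → Fin n → ℝ)
    (e : Fin m ≃ {a : Fin n × Fin n // G.Adj a.1 a.2}) (s : Fin n) (h : ℕ) : Env inputTy :=
  (n, m, (s : ℕ), h,
    List.ofFn fun i => (((e i).1.1 : ℕ), ((e i).1.2 : ℕ), w (e i).1.1 (e i).1.2), ())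

/-- `out` lists, for each vertex `t`, the word `1`, the distance from `s` to `t` and a shortest path
from `s` to `t` if `t` is reachable from `s`, and the word `0` (followed by anything) otherwise. -/
def IsSolution {n : ℕ} (G : Digraph (Fin n)) (w : Fin n → Fin n → ℝ) (s : Fin n)
    (out : outputTy.Val) : Prop :=
  out.length = n ∧ ∀ t : Fin n, ∃ r d l, out[(t : ℕ)]? = some (r, d, l) ∧
    ((∃ p, IsPath G s t p) →
      r = 1 ∧ ∃ p, IsShortestPath G w s t p ∧ d = weight w p ∧ l = p.map (fun v => (v : ℕ))) ∧
    ((¬ ∃ p, IsPath G s t p) → r = 0)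

end SSSP

/-!
Lengths of walks are pairs of a weight and a number of edges, in lexicographic order. Without
cycles of negative weight every vertex that can be reached has a shortest walk in this order, this
walk is a path (`IsInLists.exists_isDist`), and going back along it every vertex has fewer edges
than the one before. So predecessors along edges that attain the computed lengths never run into a
cycle of weight zero, and paths can be read off from them (`IsDistArray.walk_back`,
`IsInLists.isShortestPath`).

Let `L` be the logarithm of `n`. Suppose that `Z` contains the source and a vertex of some
shortest walk for every length that is attained with `H` edges (`Meets`). Then a shortest walk
splits into pieces of at most `2 * H` edges between vertices of `Z`, and one last piece
(`exists_zEdge_walk`). The pieces are found by `2 * H` rounds of the Bellman–Ford algorithm from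
each vertex of `Z`, which takes work `|Z| * H * m` and depth `H * L`, and they are put together by
repeated squaring of a matrix of size `|Z|` in the semiring of lengths, with work `|Z| ^ 3 * L`
and depth `L ^ 2` (`finalP_runs`). With `H` about `h / L` and `|Z| * H = O(n * L)`, these are the
first two terms of the bound on the work.

The sets `Z` are built for `H = 1, 2, 4, …`, starting with the set of all vertices. Given `Z` for
`H`, shortest walks with `H` edges from the vertices of `Z` are computed by the Bellman–Ford
algorithm. Every shortest walk with `2 * H` edges can be replaced by one that meets `Z` in its
first `H` edges, so the next `H` edges are one of these `|Z| * n` walks; hence a set that hits the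
vertex sets of all these walks is good for `2 * H` (`IsFamily.meets`). As `|Z|` is about `n * L /
H`, the total number of elements of the sets is only `O(n ^ 2 * L)` for each `H`.

A small hitting set is found greedily (`hitP_runs`): in each of `6 * L` rounds, a set of at most
`3 * n / H` vertices that hits a quarter of the remaining sets is added. A random sample of the
vertices with probability `1 / H` does this on average, by the first two terms of the inclusion
and exclusion formula (`hit_of_pot`). It suffices that the choices of pairs of elements are not
positively correlated. So the sample is made by halving the set of all vertices `log H` times,
each time by a partition with at most half of the pairs of elements on the same side, and with the
half for which the estimate is better (`pot_half`, `sampleP_runs`). Such a partition is obtained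
by merging blocks of vertices of lengths `1, 2, 4, …`: in all merged blocks at once, the two sides
of the second half are exchanged if this gives fewer pairs on the same side (`agree_step`,
`sideP_runs`). This needs one pass over all pairs of elements for each length.

The work and the depth of programs are bounded by `Runs`, a kind of Hoare triple in which the size
of a program takes the place of the constants, so that only the orders of magnitude have to be
tracked.
-/

namespace Par

/-! ### Renaming of variables and calls -/

/-- Renamings of the variables of `Γ` by variables of `Δ`. -/
abbrev Ren (Γ Δ : List Ty) : Type := ∀ a, Var Γ a → Var Δ a

/-- A renaming below a binder. -/
def Ren.lift {Γ Δ : List Ty} (σ : Ren Γ Δ) (b : Ty) : Ren (b :: Γ) (b :: Δ)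
  | _, .zero => .zero
  | _, .succ x => .succ (σ _ x)

/-- Renaming the variables of a program. -/
def Prog.rename : {Γ : List Ty} → {a : Ty} → Prog Γ a → {Δ : List Ty} → Ren Γ Δ → Prog Δ a
  | _, _, .var x, _, σ => .var (σ _ x)
  | _, _, .lit k, _, _ => .lit k
  | _, _, .op o e₁ e₂, _, σ => .op o (e₁.rename σ) (e₂.rename σ)
  | _, _, .rzero, _, _ => .rzero
  | _, _, .radd e₁ e₂, _, σ => .radd (e₁.rename σ) (e₂.rename σ)
  | _, _, .rle e₁ e₂, _, σ => .rle (e₁.rename σ) (e₂.rename σ)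
  | _, _, .pair e₁ e₂, _, σ => .pair (e₁.rename σ) (e₂.rename σ)
  | _, _, .fst e, _, σ => .fst (e.rename σ)
  | _, _, .snd e, _, σ => .snd (e.rename σ)
  | _, _, .ite c e₁ e₂, _, σ => .ite (c.rename σ) (e₁.rename σ) (e₂.rename σ)
  | _, _, .letIn e₁ e₂, _, σ => .letIn (e₁.rename σ) (e₂.rename (σ.lift _))
  | _, _, .len e, _, σ => .len (e.rename σ)
  | _, _, .get e₁ e₂, _, σ => .get (e₁.rename σ) (e₂.rename σ)
  | _, _, .tab k e, _, σ => .tab (k.rename σ) (e.rename (σ.lift _))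
  | _, _, .loop k e₀ e, _, σ =>
    .loop (k.rename σ) (e₀.rename σ) (e.rename ((σ.lift _).lift _))
  | _, _, .loopWhile k e₀ c e, _, σ =>
    .loopWhile (k.rename σ) (e₀.rename σ) (c.rename (σ.lift _)) (e.rename (σ.lift _))

/-- The number of constructors of a program, with one more for each loop: the constant in the bounds
on work and depth given by `Runs`. -/
def Prog.size : {Γ : List Ty} → {a : Ty} → Prog Γ a → ℕ
  | _, _, .var _ => 1
  | _, _, .lit _ => 1
  | _, _, .op _ e₁ e₂ => e₁.size + e₂.size + 1
  | _, _, .rzero => 1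
  | _, _, .radd e₁ e₂ => e₁.size + e₂.size + 1
  | _, _, .rle e₁ e₂ => e₁.size + e₂.size + 1
  | _, _, .pair e₁ e₂ => e₁.size + e₂.size + 1
  | _, _, .fst e => e.size + 1
  | _, _, .snd e => e.size + 1
  | _, _, .ite c e₁ e₂ => c.size + e₁.size + e₂.size + 1
  | _, _, .letIn e₁ e₂ => e₁.size + e₂.size + 1
  | _, _, .len e => e.size + 1
  | _, _, .get e₁ e₂ => e₁.size + e₂.size + 1
  | _, _, .tab k e => k.size + e.size + 1
  | _, _, .loop k e₀ e => k.size + e₀.size + e.size + 2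
  | _, _, .loopWhile k e₀ c e => k.size + e₀.size + c.size + e.size + 2

theorem Prog.size_rename {Γ : List Ty} {a : Ty} (e : Prog Γ a) :
    ∀ {Δ : List Ty} (σ : Ren Γ Δ), (e.rename σ).size = e.size := by
  induction e with
  | var x | lit k | rzero => intro Δ σ; rfl
  | op o e₁ e₂ h₁ h₂ => intro Δ σ; simp only [Prog.rename, Prog.size, h₁, h₂]
  | fst e h | snd e h | len e h => intro Δ σ; simp only [Prog.rename, Prog.size, h]
  | ite c e₁ e₂ h h₁ h₂ => intro Δ σ; simp only [Prog.rename, Prog.size, h, h₁, h₂]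
  | loop k e₀ e h h₁ h₂ => intro Δ σ; simp only [Prog.rename, Prog.size, h, h₁, h₂]
  | loopWhile k e₀ c e h h₁ h₂ h₃ =>
    intro Δ σ; simp only [Prog.rename, Prog.size, h, h₁, h₂, h₃]
  | radd e₁ e₂ h₁ h₂ | rle e₁ e₂ h₁ h₂ | pair e₁ e₂ h₁ h₂ | get e₁ e₂ h₁ h₂
  | letIn e₁ e₂ h₁ h₂ | tab e₁ e₂ h₁ h₂ =>
    intro Δ σ; simp only [Prog.rename, Prog.size, h₁, h₂]

theorem Ren.lift_get {Γ Δ : List Ty} {σ : Ren Γ Δ} {ρ : Env Γ} {ρ' : Env Δ}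
    (h : ∀ a (x : Var Γ a), (σ a x).get ρ' = x.get ρ) {b : Ty} (v : b.Val) :
    ∀ a (x : Var (b :: Γ) a), (σ.lift b a x).get (Γ := b :: Δ) (v, ρ') =
      x.get (Γ := b :: Γ) (v, ρ) := by
  intro a x
  cases x with
  | zero => rfl
  | succ x => exact h _ x

theorem Prog.run_rename {w : ℕ} {Γ : List Ty} {a : Ty} (e : Prog Γ a) :
    ∀ {Δ : List Ty} {σ : Ren Γ Δ} {ρ : Env Γ} {ρ' : Env Δ},
      (∀ a (x : Var Γ a), (σ a x).get ρ' = x.get ρ) → (e.rename σ).run w ρ' = e.run w ρ := by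
  induction e with
  | var x => intro Δ σ ρ ρ' h; simp [Prog.rename, Prog.run, h]
  | letIn e₁ e₂ h₁ h₂ =>
    intro Δ σ ρ ρ' h
    simp only [Prog.rename, Prog.run, h₁ h, h₂ (Ren.lift_get h _)]
  | tab k e h₁ h₂ =>
    intro Δ σ ρ ρ' h
    simp only [Prog.rename, Prog.run, h₁ h, fun v => h₂ (Ren.lift_get h v)]
  | loop k e₀ e h₁ h₂ h₃ =>
    intro Δ σ ρ ρ' h
    simp only [Prog.rename, Prog.run, h₁ h, h₂ h,
      fun v v' => h₃ (Ren.lift_get (Ren.lift_get h v) v')]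
  | loopWhile k e₀ c e h₁ h₂ h₃ h₄ =>
    intro Δ σ ρ ρ' h
    simp only [Prog.rename, Prog.run, h₁ h, h₂ h, fun v => h₃ (Ren.lift_get h v),
      fun v => h₄ (Ren.lift_get h v)]
  | lit k | rzero => intro Δ σ ρ ρ' h; rfl
  | op o e₁ e₂ h₁ h₂ => intro Δ σ ρ ρ' h; simp only [Prog.rename, Prog.run, h₁ h, h₂ h]
  | fst e h₁ | snd e h₁ | len e h₁ => intro Δ σ ρ ρ' h; simp only [Prog.rename, Prog.run, h₁ h]
  | ite c e₁ e₂ h₁ h₂ h₃ => intro Δ σ ρ ρ' h; simp only [Prog.rename, Prog.run, h₁ h, h₂ h, h₃ h]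
  | radd e₁ e₂ h₁ h₂ | rle e₁ e₂ h₁ h₂ | pair e₁ e₂ h₁ h₂ | get e₁ e₂ h₁ h₂ =>
    intro Δ σ ρ ρ' h; simp only [Prog.rename, Prog.run, h₁ h, h₂ h]

/-! ### Bounds on work and depth -/

/-- The run of `e` on `ρ` ends with a value that satisfies `Q`, with work at most `e.size * U` and
depth at most `e.size * D`.  Since every composite program has the size of its parts and some more,
the constants of all the bounds are taken care of by `size`. -/
structure Runs (w : ℕ) {Γ : List Ty} {a : Ty} (e : Prog Γ a) (ρ : Env Γ) (Q : a.Val → Prop)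
    (U D : ℕ) : Prop where
  val : Q (e.run w ρ).val
  work : (e.run w ρ).work ≤ e.size * U
  depth : (e.run w ρ).depth ≤ e.size * D

section Rules

variable {w : ℕ} {Γ : List Ty} {a b : Ty} {ρ : Env Γ}

theorem Prog.one_le_work (e : Prog Γ a) (ρ : Env Γ) :
    1 ≤ (e.run w ρ).work ∧ 1 ≤ (e.run w ρ).depth := by
  cases e <;> simp [Prog.run]

theorem Runs.one_le {e : Prog Γ a} {Q : a.Val → Prop} {U D : ℕ} (h : Runs w e ρ Q U D) :
    1 ≤ U ∧ 1 ≤ D := by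
  have := e.one_le_work (w := w) ρ
  constructor
  · rcases Nat.eq_zero_or_pos U with rfl | h'
    · have := h.work; omega
    · exact h'
  · rcases Nat.eq_zero_or_pos D with rfl | h'
    · have := h.depth; omega
    · exact h'

theorem Runs.mono {e : Prog Γ a} {Q Q' : a.Val → Prop} {U D U' D' : ℕ} (h : Runs w e ρ Q U D)
    (hQ : ∀ v, Q v → Q' v) (hU : U ≤ U') (hD : D ≤ D') : Runs w e ρ Q' U' D' :=
  ⟨hQ _ h.val, h.work.trans (Nat.mul_le_mul_left _ hU), h.depth.trans (Nat.mul_le_mul_left _ hD)⟩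

theorem Runs.imp {e : Prog Γ a} {Q Q' : a.Val → Prop} {U D : ℕ} (h : Runs w e ρ Q U D)
    (hQ : ∀ v, Q v → Q' v) : Runs w e ρ Q' U D := h.mono hQ le_rfl le_rfl

/-- Programs without `tab` and loops. -/
def Prog.flat : {Γ : List Ty} → {a : Ty} → Prog Γ a → Bool
  | _, _, .var _ => true
  | _, _, .lit _ => true
  | _, _, .op _ e₁ e₂ => e₁.flat && e₂.flat
  | _, _, .rzero => true
  | _, _, .radd e₁ e₂ => e₁.flat && e₂.flat
  | _, _, .rle e₁ e₂ => e₁.flat && e₂.flat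
  | _, _, .pair e₁ e₂ => e₁.flat && e₂.flat
  | _, _, .fst e => e.flat
  | _, _, .snd e => e.flat
  | _, _, .ite c e₁ e₂ => c.flat && e₁.flat && e₂.flat
  | _, _, .letIn e₁ e₂ => e₁.flat && e₂.flat
  | _, _, .len e => e.flat
  | _, _, .get e₁ e₂ => e₁.flat && e₂.flat
  | _, _, .tab _ _ => false
  | _, _, .loop _ _ _ => false
  | _, _, .loopWhile _ _ _ _ => false

theorem Prog.flat_le (e : Prog Γ a) (he : e.flat = true) (ρ : Env Γ) :
    (e.run w ρ).work ≤ e.size ∧ (e.run w ρ).depth ≤ e.size := by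
  induction e with
  | ite c e₁ e₂ h h₁ h₂ =>
    simp only [Prog.flat, Bool.and_eq_true] at he
    have := h he.1.1 ρ
    have := h₁ he.1.2 ρ
    have := h₂ he.2 ρ
    simp only [Prog.run, Prog.size]
    split_ifs <;> omega
  | letIn e₁ e₂ h₁ h₂ =>
    simp only [Prog.flat, Bool.and_eq_true] at he
    have := h₁ he.1 ρ
    have := h₂ he.2 ((e₁.run w ρ).val, ρ)
    simp only [Prog.run, Prog.size]
    omega
  | tab k e h₁ h₂ => simp [Prog.flat] at he
  | loop k e₀ e h₁ h₂ => simp [Prog.flat] at he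
  | loopWhile k e₀ c e h₁ h₂ => simp [Prog.flat] at he
  | var x => simp [Prog.run, Prog.size]
  | lit k => simp [Prog.run, Prog.size]
  | rzero => simp [Prog.run, Prog.size]
  | fst e h =>
    have := h he ρ
    simp only [Prog.run, Prog.size]; omega
  | snd e h =>
    have := h he ρ
    simp only [Prog.run, Prog.size]; omega
  | len e h =>
    have := h he ρ
    simp only [Prog.run, Prog.size]; omega
  | _ =>
    rename_i e₁ e₂ h₁ h₂
    simp only [Prog.flat, Bool.and_eq_true] at he
    have := h₁ he.1 ρ
    have := h₂ he.2 ρ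
    simp only [Prog.run, Prog.size]
    omega

/-- A program without `tab` and loops takes constant time. -/
theorem Runs.of_flat {e : Prog Γ a} (he : e.flat = true) {Q : a.Val → Prop} {U D : ℕ}
    (hU : 1 ≤ U) (hD : 1 ≤ D) (h : Q (e.run w ρ).val) : Runs w e ρ Q U D := by
  have := e.flat_le (w := w) he ρ
  exact ⟨h, this.1.trans (Nat.le_mul_of_pos_right _ hU),
    this.2.trans (Nat.le_mul_of_pos_right _ hD)⟩

theorem Runs.letIn {e₁ : Prog Γ a} {e₂ : Prog (a :: Γ) b} {Q : a.Val → Prop} {Q' : b.Val → Prop}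
    {U D : ℕ} (h₁ : Runs w e₁ ρ Q U D) (h₂ : ∀ v, Q v → Runs w e₂ (v, ρ) Q' U D) :
    Runs w (.letIn e₁ e₂) ρ Q' U D := by
  have h := h₂ _ h₁.val
  have := h₁.one_le
  refine ⟨h.val, ?_, ?_⟩
  · have := h₁.work; have := h.work
    simp only [Prog.run, Prog.size, add_mul]; omega
  · have := h₁.depth; have := h.depth
    simp only [Prog.run, Prog.size, add_mul]; omega

theorem Runs.pair {e₁ : Prog Γ a} {e₂ : Prog Γ b} {Q₁ : a.Val → Prop} {Q₂ : b.Val → Prop}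
    {Q : (Ty.prod a b).Val → Prop}
    {U D : ℕ} (h₁ : Runs w e₁ ρ Q₁ U D) (h₂ : Runs w e₂ ρ Q₂ U D)
    (h : ∀ v₁ v₂, Q₁ v₁ → Q₂ v₂ → Q (v₁, v₂)) :
    Runs w (.pair e₁ e₂) ρ Q U D := by
  have := h₁.one_le
  refine ⟨h _ _ h₁.val h₂.val, ?_, ?_⟩
  · have := h₁.work; have := h₂.work
    simp only [Prog.run, Prog.size, add_mul]; omega
  · have := h₁.depth; have := h₂.depth
    simp only [Prog.run, Prog.size, add_mul]; omega

theorem Runs.get {e₁ : Prog Γ (.arr a)} {e₂ : Prog Γ .word} {Q₁ : List a.Val → Prop}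
    {Q₂ : ℕ → Prop} {Q : a.Val → Prop} {U D : ℕ} (h₁ : Runs w e₁ ρ Q₁ U D)
    (h₂ : Runs w e₂ ρ Q₂ U D) (h : ∀ v₁ v₂, Q₁ v₁ → Q₂ v₂ → Q (v₁.getD v₂ a.dflt)) :
    Runs w (.get e₁ e₂) ρ Q U D := by
  have := h₁.one_le
  refine ⟨h _ _ h₁.val h₂.val, ?_, ?_⟩
  · have := h₁.work; have := h₂.work
    simp only [Prog.run, Prog.size, add_mul]; omega
  · have := h₁.depth; have := h₂.depth
    simp only [Prog.run, Prog.size, add_mul]; omega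

theorem Runs.fst {e : Prog Γ (.prod a b)} {Q : a.Val → Prop}
    {U D : ℕ} (h : Runs w e ρ (fun v => Q v.1) U D) : Runs w (.fst e) ρ Q U D := by
  have := h.one_le
  refine ⟨h.val, ?_, ?_⟩
  · have := h.work
    simp only [Prog.run, Prog.size, add_mul]; omega
  · have := h.depth
    simp only [Prog.run, Prog.size, add_mul]; omega

theorem Runs.snd {e : Prog Γ (.prod a b)} {Q : b.Val → Prop}
    {U D : ℕ} (h : Runs w e ρ (fun v => Q v.2) U D) : Runs w (.snd e) ρ Q U D := by
  have := h.one_le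
  refine ⟨h.val, ?_, ?_⟩
  · have := h.work
    simp only [Prog.run, Prog.size, add_mul]; omega
  · have := h.depth
    simp only [Prog.run, Prog.size, add_mul]; omega

theorem Runs.ite {c : Prog Γ .word} {e₁ e₂ : Prog Γ a} {C : ℕ → Prop} {Q : a.Val → Prop}
    {U D : ℕ} (h : Runs w c ρ C U D) (h₁ : ∀ v, C v → v ≠ 0 → Runs w e₁ ρ Q U D)
    (h₂ : C 0 → Runs w e₂ ρ Q U D) : Runs w (.ite c e₁ e₂) ρ Q U D := by
  have := h.one_le
  have h3 := h.work
  have h4 := h.depth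
  by_cases hc : (c.run w ρ).val = (0 : ℕ)
  · have h' := h₂ (hc ▸ h.val)
    have := h'.work; have := h'.depth
    refine ⟨?_, ?_, ?_⟩
    · simp only [Prog.run, hc]; exact h'.val
    · simp only [Prog.run, Prog.size, add_mul, hc, ne_eq, not_true_eq_false, if_false]
      have := Nat.zero_le (e₁.size * U)
      omega
    · simp only [Prog.run, Prog.size, add_mul, hc, ne_eq, not_true_eq_false, if_false]
      have := Nat.zero_le (e₁.size * D)
      omega
  · have h' := h₁ _ h.val hc
    have := h'.work; have := h'.depth
    refine ⟨?_, ?_, ?_⟩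
    · simp only [Prog.run, hc, ne_eq, not_false_eq_true, if_true]; exact h'.val
    · simp only [Prog.run, Prog.size, add_mul, hc, ne_eq, not_false_eq_true, if_true]
      have := Nat.zero_le (e₂.size * U)
      omega
    · simp only [Prog.run, Prog.size, add_mul, hc, ne_eq, not_false_eq_true, if_true]
      have := Nat.zero_le (e₂.size * D)
      omega

/-- The cost of `tab`: the work of the entries adds up. -/
theorem Runs.tab {k : Prog Γ .word} {e : Prog (.word :: Γ) a} {ℓ : ℕ} {Q : ℕ → a.Val → Prop}
    {u : ℕ → ℕ} {U D : ℕ} (hk : Runs w k ρ (· = ℓ) U D)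
    (he : ∀ i < ℓ, Runs w e (i, ρ) (Q i) (u i) D) (hU : ∑ i ∈ Finset.range ℓ, u i ≤ U) :
    Runs w (.tab k e) ρ (fun l => l.length = ℓ ∧ ∀ i < ℓ, Q i (l.getD i a.dflt)) U D := by
  have h1 := hk.one_le
  have hv : (k.run w ρ).val = ℓ := hk.val
  refine ⟨?_, ?_, ?_⟩
  · simp only [Prog.run, hv, List.length_map, List.length_range, true_and]
    intro i hi
    rw [List.getD_eq_getElem _ _ (by simpa using hi)]
    simpa using (he i hi).val
  · have h2 := hk.work
    have h3 : ∑ i ∈ Finset.range ℓ, (e.run w (i, ρ)).work ≤ e.size * U :=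
      calc _ ≤ ∑ i ∈ Finset.range ℓ, e.size * u i :=
            Finset.sum_le_sum fun i hi => (he i (Finset.mem_range.1 hi)).work
        _ = e.size * ∑ i ∈ Finset.range ℓ, u i := by rw [Finset.mul_sum]
        _ ≤ _ := Nat.mul_le_mul_left _ hU
    simp only [Prog.run, Prog.size, add_mul, hv]; omega
  · have h2 := hk.depth
    have h3 : ((Finset.range ℓ).sup fun i => (e.run w (i, ρ)).depth) ≤ e.size * D :=
      Finset.sup_le fun i hi => (he i (Finset.mem_range.1 hi)).depth
    simp only [Prog.run, Prog.size, add_mul, hv]; omega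

/-- The rule for `loop`, with an invariant `I`. -/
theorem Runs.loop {k : Prog Γ .word} {e₀ : Prog Γ a} {e : Prog (.word :: a :: Γ) a} {ℓ : ℕ}
    {I : ℕ → a.Val → Prop} {u d : ℕ → ℕ} {U D : ℕ} (hk : Runs w k ρ (· = ℓ) U D)
    (h₀ : Runs w e₀ ρ (I 0) U D)
    (he : ∀ i < ℓ, ∀ x, I i x → Runs w e (i, x, ρ) (I (i + 1)) (u i) (d i))
    (hU : ∑ i ∈ Finset.range ℓ, u i ≤ U) (hD : ∑ i ∈ Finset.range ℓ, d i ≤ D) :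
    Runs w (.loop k e₀ e) ρ (I ℓ) U D := by
  have h1 := hk.one_le
  have hv : (k.run w ρ).val = ℓ := hk.val
  have key : ∀ j ≤ ℓ,
      let r := Res.rounds (fun i x => e.run w (i, x, ρ)) (e₀.run w ρ).val j
      I j r.val ∧ r.work ≤ (e.size + 1) * ∑ i ∈ Finset.range j, u i ∧
        r.depth ≤ (e.size + 1) * ∑ i ∈ Finset.range j, d i := by
    intro j
    induction j with
    | zero => intro _; simpa [Res.rounds] using h₀.val
    | succ j ih =>
      intro hj
      obtain ⟨i1, i2, i3⟩ := ih (by omega)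
      have h := he j (by omega) _ i1
      have h4 := h.work
      have h5 := h.depth
      have h6 := h.one_le
      refine ⟨h.val, ?_, ?_⟩
      · rw [Finset.sum_range_succ, mul_add, add_mul _ _ (u j)]
        simp only [Res.rounds]; omega
      · rw [Finset.sum_range_succ, mul_add, add_mul _ _ (d j)]
        simp only [Res.rounds]; omega
  obtain ⟨k1, k2, k3⟩ := key ℓ le_rfl
  have h2 := hk.work
  have h3 := hk.depth
  have h4 := h₀.work
  have h5 := h₀.depth
  have h6 := k2.trans (Nat.mul_le_mul_left _ hU)
  have h7 := k3.trans (Nat.mul_le_mul_left _ hD)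
  refine ⟨?_, ?_, ?_⟩
  · simp only [Prog.run, hv]; exact k1
  · simp only [Prog.run, Prog.size, hv]
    linarith [add_mul e.size 1 U]
  · simp only [Prog.run, Prog.size, hv]
    linarith [add_mul e.size 1 D]

/-- The rule for `loopWhile`: `I` is an invariant, `μ` decreases in each round, and `ΨU`, `ΨD` are
potentials that pay for the work and the depth of each round. -/
theorem Runs.loopWhile {k : Prog Γ .word} {e₀ : Prog Γ a} {c : Prog (a :: Γ) .word}
    {e : Prog (a :: Γ) a} {ℓ : ℕ} {I Q : a.Val → Prop} {C : a.Val → ℕ → Prop}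
    {μ u d ΨU ΨD : a.Val → ℕ} {U D : ℕ}
    (hk : Runs w k ρ (· = ℓ) U D)
    (h₀ : Runs w e₀ ρ (fun x => I x ∧ μ x ≤ ℓ ∧ ΨU x ≤ U ∧ ΨD x ≤ D) U D)
    (hc : ∀ x, I x → Runs w c (x, ρ) (C x) (u x) (d x))
    (he : ∀ x v, I x → C x v → v ≠ 0 → Runs w e (x, ρ)
      (fun y => I y ∧ μ y < μ x ∧ u x + ΨU y ≤ ΨU x ∧ d x + ΨD y ≤ ΨD x) (u x) (d x))
    (hq : ∀ x, I x → C x 0 → Q x ∧ u x ≤ ΨU x ∧ d x ≤ ΨD x)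
    (hμ : ∀ x, I x → μ x = 0 → Q x) :
    Runs w (.loopWhile k e₀ c e) ρ Q U D := by
  have h1 := hk.one_le
  have hv : (k.run w ρ).val = ℓ := hk.val
  have key : ∀ j x, I x → μ x ≤ j →
      let r := Res.roundsWhile (fun x => c.run w (x, ρ)) (fun x => e.run w (x, ρ)) j x
      Q r.val ∧ r.work ≤ (c.size + e.size + 1) * ΨU x ∧
        r.depth ≤ (c.size + e.size + 1) * ΨD x := by
    intro j
    induction j with
    | zero => intro x hx hj; simpa [Res.roundsWhile] using hμ x hx (by omega)
    | succ j ih =>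
      intro x hx hj
      have h := hc x hx
      have g1 := h.work
      have g2 := h.depth
      have g3 := h.one_le
      by_cases hb : (c.run w (x, ρ)).val = (0 : ℕ)
      · obtain ⟨q1, q2, q3⟩ := hq x hx (hb ▸ h.val)
        simp only [Res.roundsWhile, hb, ne_eq, not_true_eq_false, if_false]
        refine ⟨q1, ?_, ?_⟩
        · have := Nat.mul_le_mul_left (c.size + e.size + 1) q2
          simp only [add_mul] at this ⊢
          have := Nat.zero_le (e.size * u x)
          omega
        · have := Nat.mul_le_mul_left (c.size + e.size + 1) q3
          simp only [add_mul] at this ⊢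
          have := Nat.zero_le (e.size * d x)
          omega
      · have g := he x _ hx h.val hb
        obtain ⟨y1, y2, y3, y4⟩ := g.val
        obtain ⟨r1, r2, r3⟩ := ih _ y1 (by omega)
        have g4 := g.work
        have g5 := g.depth
        simp only [Res.roundsWhile, hb, ne_eq, not_false_eq_true, if_true]
        refine ⟨r1, ?_, ?_⟩
        · have := Nat.mul_le_mul_left (c.size + e.size + 1) y3
          simp only [add_mul, mul_add] at this r2 ⊢
          omega
        · have := Nat.mul_le_mul_left (c.size + e.size + 1) y4
          simp only [add_mul, mul_add] at this r3 ⊢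
          omega
  obtain ⟨x1, x2, x3, x4⟩ := h₀.val
  obtain ⟨k1, k2, k3⟩ := key ℓ _ x1 x2
  have h2 := hk.work
  have h3 := hk.depth
  have h4 := h₀.work
  have h5 := h₀.depth
  have h6 := k2.trans (Nat.mul_le_mul_left _ x3)
  have h7 := k3.trans (Nat.mul_le_mul_left _ x4)
  refine ⟨?_, ?_, ?_⟩
  · simp only [Prog.run, hv]; exact k1
  · simp only [Prog.run, Prog.size, hv]
    linarith [add_mul (c.size + e.size) 1 U]
  · simp only [Prog.run, Prog.size, hv]
    linarith [add_mul (c.size + e.size) 1 D]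

/-- Weakening by one variable. -/
def Prog.wk {c : Ty} (e : Prog Γ a) : Prog (c :: Γ) a := e.rename fun _ x => .succ x

theorem Prog.run_wk {c : Ty} (e : Prog Γ a) (v : c.Val) : (e.wk).run w (v, ρ) = e.run w ρ :=
  e.run_rename fun _ _ => rfl

theorem Runs.wk {c : Ty} {e : Prog Γ a} {Q : a.Val → Prop} {U D : ℕ} {v : c.Val}
    (h : Runs w e ρ Q U D) : Runs w (e.wk (c := c)) (v, ρ) Q U D := by
  refine ⟨?_, ?_, ?_⟩
  · rw [Prog.run_wk]; exact h.val
  · rw [Prog.run_wk, Prog.wk, Prog.size_rename]; exact h.work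
  · rw [Prog.run_wk, Prog.wk, Prog.size_rename]; exact h.depth

theorem Runs.rename {Δ : List Ty} {e : Prog Γ a} {Q : a.Val → Prop} {U D : ℕ} {σ : Ren Γ Δ}
    {ρ' : Env Δ} (h : Runs w e ρ Q U D) (hσ : ∀ a (x : Var Γ a), (σ a x).get ρ' = x.get ρ) :
    Runs w (e.rename σ) ρ' Q U D := by
  have hr := e.run_rename (w := w) hσ
  refine ⟨?_, ?_, ?_⟩
  · rw [hr]; exact h.val
  · rw [hr, Prog.size_rename]; exact h.work
  · rw [hr, Prog.size_rename]; exact h.depth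

variable {a₁ a₂ a₃ a₄ a₅ : Ty}

/-- The renaming for a call with one argument. -/
def ren1 : Ren [a₁] (a₁ :: Γ)
  | _, .zero => .zero

/-- The renaming for a call with two arguments. -/
def ren2 : Ren [a₁, a₂] (a₂ :: a₁ :: Γ)
  | _, .zero => .succ .zero
  | _, .succ .zero => .zero

/-- The renaming for a call with three arguments. -/
def ren3 : Ren [a₁, a₂, a₃] (a₃ :: a₂ :: a₁ :: Γ)
  | _, .zero => .succ (.succ .zero)
  | _, .succ .zero => .succ .zero
  | _, .succ (.succ .zero) => .zero

/-- The renaming for a call with four arguments. -/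
def ren4 : Ren [a₁, a₂, a₃, a₄] (a₄ :: a₃ :: a₂ :: a₁ :: Γ)
  | _, .zero => .succ (.succ (.succ .zero))
  | _, .succ .zero => .succ (.succ .zero)
  | _, .succ (.succ .zero) => .succ .zero
  | _, .succ (.succ (.succ .zero)) => .zero

/-- The renaming for a call with five arguments. -/
def ren5 : Ren [a₁, a₂, a₃, a₄, a₅] (a₅ :: a₄ :: a₃ :: a₂ :: a₁ :: Γ)
  | _, .zero => .succ (.succ (.succ (.succ .zero)))
  | _, .succ .zero => .succ (.succ (.succ .zero))
  | _, .succ (.succ .zero) => .succ (.succ .zero)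
  | _, .succ (.succ (.succ .zero)) => .succ .zero
  | _, .succ (.succ (.succ (.succ .zero))) => .zero

/-- The call of a function with one argument. -/
def call1 (f : Prog [a₁] b) (e₁ : Prog Γ a₁) : Prog Γ b := .letIn e₁ (f.rename ren1)

/-- The call of a function with two arguments. -/
def call2 (f : Prog [a₁, a₂] b) (e₁ : Prog Γ a₁) (e₂ : Prog Γ a₂) : Prog Γ b :=
  .letIn e₁ (.letIn e₂.wk (f.rename ren2))

/-- The call of a function with three arguments. -/
def call3 (f : Prog [a₁, a₂, a₃] b) (e₁ : Prog Γ a₁) (e₂ : Prog Γ a₂) (e₃ : Prog Γ a₃) :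
    Prog Γ b :=
  .letIn e₁ (.letIn e₂.wk (.letIn e₃.wk.wk (f.rename ren3)))

/-- The call of a function with four arguments. -/
def call4 (f : Prog [a₁, a₂, a₃, a₄] b) (e₁ : Prog Γ a₁) (e₂ : Prog Γ a₂) (e₃ : Prog Γ a₃)
    (e₄ : Prog Γ a₄) : Prog Γ b :=
  .letIn e₁ (.letIn e₂.wk (.letIn e₃.wk.wk (.letIn e₄.wk.wk.wk (f.rename ren4))))

/-- The call of a function with five arguments. -/
def call5 (f : Prog [a₁, a₂, a₃, a₄, a₅] b) (e₁ : Prog Γ a₁) (e₂ : Prog Γ a₂) (e₃ : Prog Γ a₃)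
    (e₄ : Prog Γ a₄) (e₅ : Prog Γ a₅) : Prog Γ b :=
  .letIn e₁ (.letIn e₂.wk (.letIn e₃.wk.wk (.letIn e₄.wk.wk.wk (.letIn e₅.wk.wk.wk.wk
    (f.rename ren5)))))

variable {Q₁ : a₁.Val → Prop} {Q₂ : a₂.Val → Prop} {Q₃ : a₃.Val → Prop} {Q₄ : a₄.Val → Prop}
  {Q₅ : a₅.Val → Prop} {Q : b.Val → Prop} {U D : ℕ}

theorem Runs.call1 {f : Prog [a₁] b} {e₁ : Prog Γ a₁} (h₁ : Runs w e₁ ρ Q₁ U D)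
    (h : ∀ v₁, Q₁ v₁ → Runs w f (v₁, ()) Q U D) : Runs w (call1 f e₁) ρ Q U D :=
  h₁.letIn fun v₁ q₁ => (h v₁ q₁).rename (by
    intro a x
    match x with
    | .zero => rfl)

theorem Runs.call2 {f : Prog [a₁, a₂] b} {e₁ : Prog Γ a₁} {e₂ : Prog Γ a₂}
    (h₁ : Runs w e₁ ρ Q₁ U D) (h₂ : Runs w e₂ ρ Q₂ U D)
    (h : ∀ v₁ v₂, Q₁ v₁ → Q₂ v₂ → Runs w f (v₁, v₂, ()) Q U D) : Runs w (call2 f e₁ e₂) ρ Q U D :=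
  h₁.letIn fun v₁ q₁ => h₂.wk.letIn fun v₂ q₂ => (h v₁ v₂ q₁ q₂).rename (by
    intro a x
    match x with
    | .zero => rfl
    | .succ .zero => rfl)

theorem Runs.call3 {f : Prog [a₁, a₂, a₃] b} {e₁ : Prog Γ a₁} {e₂ : Prog Γ a₂} {e₃ : Prog Γ a₃}
    (h₁ : Runs w e₁ ρ Q₁ U D) (h₂ : Runs w e₂ ρ Q₂ U D) (h₃ : Runs w e₃ ρ Q₃ U D)
    (h : ∀ v₁ v₂ v₃, Q₁ v₁ → Q₂ v₂ → Q₃ v₃ → Runs w f (v₁, v₂, v₃, ()) Q U D) :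
    Runs w (call3 f e₁ e₂ e₃) ρ Q U D :=
  h₁.letIn fun v₁ q₁ => h₂.wk.letIn fun v₂ q₂ => h₃.wk.wk.letIn fun v₃ q₃ =>
    (h v₁ v₂ v₃ q₁ q₂ q₃).rename (by
      intro a x
      match x with
      | .zero => rfl
      | .succ .zero => rfl
      | .succ (.succ .zero) => rfl)

theorem Runs.call4 {f : Prog [a₁, a₂, a₃, a₄] b} {e₁ : Prog Γ a₁} {e₂ : Prog Γ a₂}
    {e₃ : Prog Γ a₃} {e₄ : Prog Γ a₄}
    (h₁ : Runs w e₁ ρ Q₁ U D) (h₂ : Runs w e₂ ρ Q₂ U D) (h₃ : Runs w e₃ ρ Q₃ U D)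
    (h₄ : Runs w e₄ ρ Q₄ U D)
    (h : ∀ v₁ v₂ v₃ v₄, Q₁ v₁ → Q₂ v₂ → Q₃ v₃ → Q₄ v₄ → Runs w f (v₁, v₂, v₃, v₄, ()) Q U D) :
    Runs w (call4 f e₁ e₂ e₃ e₄) ρ Q U D :=
  h₁.letIn fun v₁ q₁ => h₂.wk.letIn fun v₂ q₂ => h₃.wk.wk.letIn fun v₃ q₃ =>
    h₄.wk.wk.wk.letIn fun v₄ q₄ => (h v₁ v₂ v₃ v₄ q₁ q₂ q₃ q₄).rename (by
      intro a x
      match x with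
      | .zero => rfl
      | .succ .zero => rfl
      | .succ (.succ .zero) => rfl
      | .succ (.succ (.succ .zero)) => rfl)

theorem Runs.call5 {f : Prog [a₁, a₂, a₃, a₄, a₅] b} {e₁ : Prog Γ a₁} {e₂ : Prog Γ a₂}
    {e₃ : Prog Γ a₃} {e₄ : Prog Γ a₄} {e₅ : Prog Γ a₅}
    (h₁ : Runs w e₁ ρ Q₁ U D) (h₂ : Runs w e₂ ρ Q₂ U D) (h₃ : Runs w e₃ ρ Q₃ U D)
    (h₄ : Runs w e₄ ρ Q₄ U D) (h₅ : Runs w e₅ ρ Q₅ U D)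
    (h : ∀ v₁ v₂ v₃ v₄ v₅, Q₁ v₁ → Q₂ v₂ → Q₃ v₃ → Q₄ v₄ → Q₅ v₅ →
      Runs w f (v₁, v₂, v₃, v₄, v₅, ()) Q U D) :
    Runs w (call5 f e₁ e₂ e₃ e₄ e₅) ρ Q U D :=
  h₁.letIn fun v₁ q₁ => h₂.wk.letIn fun v₂ q₂ => h₃.wk.wk.letIn fun v₃ q₃ =>
    h₄.wk.wk.wk.letIn fun v₄ q₄ => h₅.wk.wk.wk.wk.letIn fun v₅ q₅ =>
    (h v₁ v₂ v₃ v₄ v₅ q₁ q₂ q₃ q₄ q₅).rename (by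
      intro a x
      match x with
      | .zero => rfl
      | .succ .zero => rfl
      | .succ (.succ .zero) => rfl
      | .succ (.succ (.succ .zero)) => rfl
      | .succ (.succ (.succ (.succ .zero))) => rfl)

end Rules

/-! ### Evaluation of programs without loops -/

section Values

variable {w : ℕ} {Γ : List Ty} {a b c d : Ty} {ρ : Env Γ}

instance : Add (Prog Γ .word) := ⟨.op .add⟩
instance : Sub (Prog Γ .word) := ⟨.op .sub⟩
instance : Mul (Prog Γ .word) := ⟨.op .mul⟩
instance : Div (Prog Γ .word) := ⟨.op .div⟩
instance : Mod (Prog Γ .word) := ⟨.op .mod⟩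

/-- The test `e₁ < e₂`. -/
abbrev Prog.lt (e₁ e₂ : Prog Γ .word) : Prog Γ .word := .op .lt e₁ e₂

/-- The test `e₁ = e₂`. -/
abbrev Prog.eq (e₁ e₂ : Prog Γ .word) : Prog Γ .word := .op .eq e₁ e₂

/-- The variable with the de Bruijn index `0`; `v1` to `v8` are those with the indices `1` to `8`. -/
abbrev v0 : Prog (a :: Γ) a := .var .zero
abbrev v1 {a₀ : Ty} : Prog (a₀ :: a :: Γ) a := .var (.succ .zero)
abbrev v2 {a₀ a₁ : Ty} : Prog (a₀ :: a₁ :: a :: Γ) a := .var (.succ (.succ .zero))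
abbrev v3 {a₀ a₁ a₂ : Ty} : Prog (a₀ :: a₁ :: a₂ :: a :: Γ) a :=
  .var (.succ (.succ (.succ .zero)))
abbrev v4 {a₀ a₁ a₂ a₃ : Ty} : Prog (a₀ :: a₁ :: a₂ :: a₃ :: a :: Γ) a :=
  .var (.succ (.succ (.succ (.succ .zero))))
abbrev v5 {a₀ a₁ a₂ a₃ a₄ : Ty} : Prog (a₀ :: a₁ :: a₂ :: a₃ :: a₄ :: a :: Γ) a :=
  .var (.succ (.succ (.succ (.succ (.succ .zero)))))
abbrev v6 {a₀ a₁ a₂ a₃ a₄ a₅ : Ty} : Prog (a₀ :: a₁ :: a₂ :: a₃ :: a₄ :: a₅ :: a :: Γ) a :=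
  .var (.succ (.succ (.succ (.succ (.succ (.succ .zero))))))
abbrev v7 {a₀ a₁ a₂ a₃ a₄ a₅ a₆ : Ty} :
    Prog (a₀ :: a₁ :: a₂ :: a₃ :: a₄ :: a₅ :: a₆ :: a :: Γ) a :=
  .var (.succ (.succ (.succ (.succ (.succ (.succ (.succ .zero)))))))
abbrev v8 {a₀ a₁ a₂ a₃ a₄ a₅ a₆ a₇ : Ty} :
    Prog (a₀ :: a₁ :: a₂ :: a₃ :: a₄ :: a₅ :: a₆ :: a₇ :: a :: Γ) a :=
  .var (.succ (.succ (.succ (.succ (.succ (.succ (.succ (.succ .zero))))))))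

@[simp] theorem val_var (x : Var Γ a) : ((Prog.var x).run w ρ).val = x.get ρ := rfl
@[simp] theorem get_zero {ρ : Env (a :: Γ)} : Var.get .zero ρ = ρ.1 := rfl
@[simp] theorem get_succ {ρ : Env (a :: Γ)} (x : Var Γ b) :
    Var.get (.succ x) ρ = x.get ρ.2 := rfl
@[simp] theorem val_lit (k : ℕ) : ((Prog.lit k : Prog Γ .word).run w ρ).val = k % 2 ^ w := rfl
@[simp] theorem val_rzero : ((Prog.rzero : Prog Γ .real).run w ρ).val = (0 : ℝ) := rfl
@[simp] theorem val_add (e₁ e₂ : Prog Γ .word) :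
    ((e₁ + e₂).run w ρ).val = ((e₁.run w ρ).val + (e₂.run w ρ).val : ℕ) % 2 ^ w := rfl
@[simp] theorem val_sub (e₁ e₂ : Prog Γ .word) :
    ((e₁ - e₂).run w ρ).val = ((e₁.run w ρ).val - (e₂.run w ρ).val : ℕ) % 2 ^ w := rfl
@[simp] theorem val_mul (e₁ e₂ : Prog Γ .word) :
    ((e₁ * e₂).run w ρ).val = ((e₁.run w ρ).val * (e₂.run w ρ).val : ℕ) % 2 ^ w := rfl
@[simp] theorem val_div (e₁ e₂ : Prog Γ .word) :
    ((e₁ / e₂).run w ρ).val = ((e₁.run w ρ).val / (e₂.run w ρ).val : ℕ) % 2 ^ w := rfl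
@[simp] theorem val_mod (e₁ e₂ : Prog Γ .word) :
    ((e₁ % e₂).run w ρ).val = ((e₁.run w ρ).val % (e₂.run w ρ).val : ℕ) % 2 ^ w := rfl
@[simp] theorem val_lt (e₁ e₂ : Prog Γ .word) : ((e₁.lt e₂).run w ρ).val =
    (if ((e₁.run w ρ).val : ℕ) < (e₂.run w ρ).val then 1 else 0) % 2 ^ w := rfl
@[simp] theorem val_eq (e₁ e₂ : Prog Γ .word) : ((e₁.eq e₂).run w ρ).val =
    (if ((e₁.run w ρ).val : ℕ) = (e₂.run w ρ).val then 1 else 0) % 2 ^ w := rfl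
@[simp] theorem val_radd (e₁ e₂ : Prog Γ .real) :
    ((e₁.radd e₂).run w ρ).val = ((e₁.run w ρ).val + (e₂.run w ρ).val : ℝ) := rfl
@[simp] theorem val_rle (e₁ e₂ : Prog Γ .real) : ((e₁.rle e₂).run w ρ).val =
    (if ((e₁.run w ρ).val : ℝ) ≤ (e₂.run w ρ).val then 1 else 0) % 2 ^ w := rfl
@[simp] theorem val_pair (e₁ : Prog Γ a) (e₂ : Prog Γ b) :
    ((e₁.pair e₂).run w ρ).val = ((e₁.run w ρ).val, (e₂.run w ρ).val) := rfl
@[simp] theorem val_fst (e : Prog Γ (.prod a b)) :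
    (e.fst.run w ρ).val = (e.run w ρ).val.1 := rfl
@[simp] theorem val_snd (e : Prog Γ (.prod a b)) :
    (e.snd.run w ρ).val = (e.run w ρ).val.2 := rfl
@[simp] theorem val_ite (c : Prog Γ .word) (e₁ e₂ : Prog Γ a) : ((c.ite e₁ e₂).run w ρ).val =
    if ((c.run w ρ).val : ℕ) = 0 then (e₂.run w ρ).val else (e₁.run w ρ).val := by
  simp only [Prog.run]; split_ifs <;> simp_all
@[simp] theorem val_letIn (e₁ : Prog Γ a) (e₂ : Prog (a :: Γ) b) :
    ((e₁.letIn e₂).run w ρ).val = (e₂.run w ((e₁.run w ρ).val, ρ)).val := rfl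
@[simp] theorem val_len (e : Prog Γ (.arr a)) :
    (e.len.run w ρ).val = (e.run w ρ).val.length % 2 ^ w := rfl
@[simp] theorem val_get (e₁ : Prog Γ (.arr a)) (e₂ : Prog Γ .word) :
    ((e₁.get e₂).run w ρ).val = (e₁.run w ρ).val.getD (e₂.run w ρ).val a.dflt := rfl

@[simp] theorem val_call2 (f : Prog [a, b] c) (e₁ : Prog Γ a) (e₂ : Prog Γ b) :
    ((call2 f e₁ e₂).run w ρ).val = (f.run w ((e₁.run w ρ).val, (e₂.run w ρ).val, ())).val := by
  simp only [call2, val_letIn, Prog.run_wk]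
  rw [Prog.run_rename]
  intro a x
  match x with
  | .zero => rfl
  | .succ .zero => rfl

/-- Words without bits cannot hold the constant `1`; the bounds on the numbers that occur exclude
them. -/
theorem pos_of_lt_two_pow {w k : ℕ} (h : k < 2 ^ w) (hk : 0 < k) : 0 < w := by
  rcases Nat.eq_zero_or_pos w with rfl | h'
  · omega
  · exact h'

theorem one_mod (hw : 0 < w) : 1 % 2 ^ w = 1 :=
  Nat.mod_eq_of_lt (Nat.one_lt_two_pow hw.ne')

theorem flag_mod (hw : 0 < w) (p : Prop) [Decidable p] :
    (if p then 1 else 0) % 2 ^ w = if p then 1 else 0 := by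
  split_ifs
  · exact one_mod hw
  · exact Nat.zero_mod _

theorem flag_eq_zero (p : Prop) [Decidable p] : ((if p then 1 else 0) = 0) ↔ ¬ p := by
  split_ifs <;> simp_all

end Values

/-! ### Binary logarithms -/

/-- The binary logarithm, rounded up. -/
def clogP : Prog [.word] .word :=
  .fst (.loopWhile v0 (.pair (.lit 0) (.lit 1)) (.lt (.snd v0) v1)
    (.pair (.fst v0 + .lit 1) (.snd v0 * .lit 2)))

theorem clogP_runs {w n : ℕ} (hw : 2 * n + 2 < 2 ^ w) :
    Runs w clogP (n, ()) (· = Nat.clog 2 n) (Nat.clog 2 n + 1) (Nat.clog 2 n + 1) := by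
  have hw0 : 0 < w := pos_of_lt_two_pow hw (by omega)
  have hlt (j : ℕ) : 2 ^ j < n ↔ j < Nat.clog 2 n := (Nat.lt_clog_iff_pow_lt one_lt_two).symm
  have hlog : Nat.clog 2 n ≤ n := Nat.clog_le_of_le_pow n.lt_two_pow_self.le
  apply Runs.fst
  refine Runs.loopWhile (ℓ := n) (I := fun x : ℕ × ℕ => x.2 = 2 ^ x.1 ∧ x.1 ≤ Nat.clog 2 n)
    (C := fun (x : ℕ × ℕ) v => v = if x.2 < n then 1 else 0)
    (μ := fun x : ℕ × ℕ => Nat.clog 2 n - x.1)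
    (u := fun _ => 1) (d := fun _ => 1) (ΨU := fun x : ℕ × ℕ => Nat.clog 2 n - x.1 + 1)
    (ΨD := fun x : ℕ × ℕ => Nat.clog 2 n - x.1 + 1) ?_ ?_ ?_ ?_ ?_ ?_
  · exact Runs.of_flat rfl (by omega) (by omega) (by simp)
  · refine Runs.of_flat rfl (by omega) (by omega) ?_
    simp [one_mod hw0, hlog]
  · intro x hx
    refine Runs.of_flat rfl le_rfl le_rfl ?_
    simp only [val_lt, val_snd, val_var, get_zero, get_succ]
    exact flag_mod hw0 _
  · rintro (⟨i, p⟩ : ℕ × ℕ) v ⟨hx, hi⟩ rfl hv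
    simp only at hx hi
    subst hx
    refine Runs.of_flat rfl le_rfl le_rfl ?_
    simp only [ne_eq, flag_eq_zero, not_not] at hv
    have h1 := (hlt i).1 hv
    have h2 : 2 % 2 ^ w = 2 := Nat.mod_eq_of_lt (by omega)
    have h3 : (i + 1) % 2 ^ w = i + 1 := Nat.mod_eq_of_lt (by omega)
    have h4 : (2 ^ i * 2) % 2 ^ w = 2 ^ i * 2 := Nat.mod_eq_of_lt (by omega)
    simp only [val_pair, val_add, val_mul, val_fst, val_snd, val_var, get_zero, val_lit,
      one_mod hw0, h2, h3, h4]
    refine ⟨⟨(pow_succ 2 i).symm, h1⟩, ?_, ?_, ?_⟩ <;> omega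
  · rintro (⟨i, p⟩ : ℕ × ℕ) ⟨hx, hi⟩ hv
    simp only at hx hi
    subst hx
    have h1 : ¬ 2 ^ i < n := (flag_eq_zero _).1 hv.symm
    rw [hlt] at h1
    refine ⟨?_, ?_, ?_⟩
    · change i = _; omega
    · change 1 ≤ Nat.clog 2 n - i + 1; omega
    · change 1 ≤ Nat.clog 2 n - i + 1; omega
  · rintro (⟨i, p⟩ : ℕ × ℕ) ⟨hx, hi⟩ hv
    change i = _
    change Nat.clog 2 n - i = 0 at hv
    change i ≤ _ at hi
    omega

/-! ### Reduction of an array along a binary tree -/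

/-- One level of a reduction: neighbouring entries are combined. -/
def halve {α : Type} (φ : α → α → α) (d : α) : List α → List α
  | [] => []
  | [x] => [φ x d]
  | x :: y :: l => φ x y :: halve φ d l

theorem length_halve {α : Type} (φ : α → α → α) (d : α) :
    ∀ l : List α, (halve φ d l).length = (l.length + 1) / 2
  | [] => by simp [halve]
  | [_] => by simp [halve]
  | x :: y :: l => by
    simp only [halve, List.length_cons, length_halve φ d l]; omega

theorem getD_halve {α : Type} (φ : α → α → α) (d : α) : ∀ (l : List α) (i : ℕ),
    i < (l.length + 1) / 2 → (halve φ d l).getD i d = φ (l.getD (2 * i) d) (l.getD (2 * i + 1) d)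
  | [], i, h => by simp at h
  | [x], i, h => by
    obtain rfl : i = 0 := by simpa using h
    rfl
  | x :: y :: l, 0, h => rfl
  | x :: y :: l, i + 1, h => by
    have h' : i < (l.length + 1) / 2 := by simp only [List.length_cons] at h; omega
    simpa [halve, Nat.mul_add] using getD_halve φ d l i h'

theorem ext_getD {α : Type} {d : α} {l l' : List α} (h : l.length = l'.length)
    (h' : ∀ i < l.length, l.getD i d = l'.getD i d) : l = l' := by
  refine List.ext_getElem h fun i h1 h2 => ?_
  have := h' i h1
  rwa [List.getD_eq_getElem _ _ h1, List.getD_eq_getElem _ _ h2] at this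

theorem mem_halve {α : Type} {φ : α → α → α} {d z : α} : ∀ {l : List α}, z ∈ halve φ d l →
    ∃ x ∈ l, ∃ y, (y ∈ l ∨ y = d) ∧ z = φ x y
  | [], h => by simp [halve] at h
  | [x], h => by
    refine ⟨x, by simp, d, .inr rfl, by simpa [halve] using h⟩
  | x :: y :: l, h => by
    rcases List.mem_cons.1 h with rfl | h
    · exact ⟨x, by simp, y, by simp, rfl⟩
    · obtain ⟨x', hx, y', hy, rfl⟩ := mem_halve h
      refine ⟨x', by simp [hx], y', ?_, rfl⟩
      rcases hy with hy | hy <;> simp [hy]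

theorem exists_mem_halve {α : Type} {φ : α → α → α} {d x : α} : ∀ {l : List α}, x ∈ l →
    ∃ y, φ x y ∈ halve φ d l ∨ φ y x ∈ halve φ d l
  | [], h => by simp at h
  | [z], h => by
    obtain rfl := List.mem_singleton.1 h
    exact ⟨d, by simp [halve]⟩
  | y :: z :: l, h => by
    simp only [List.mem_cons] at h
    rcases h with rfl | rfl | h
    · exact ⟨z, by simp [halve]⟩
    · exact ⟨y, by simp [halve]⟩
    · obtain ⟨y', h'⟩ := exists_mem_halve (φ := φ) (d := d) h
      refine ⟨y', ?_⟩
      simp only [halve, List.mem_cons]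
      tauto

theorem clog_halve {k : ℕ} (hk : 2 ≤ k) : Nat.clog 2 ((k + 1) / 2) + 1 = Nat.clog 2 k := by
  rw [Nat.clog_of_two_le one_lt_two hk]; rfl

section Reduce

variable {a : Ty}

/-- The reduction of an array along a binary tree with the operation `f`, for which the default
value has to be neutral on the right. -/
def reduceP (f : Prog [a, a] a) : Prog [.arr a] a :=
  .get (.loopWhile (.len v0) v0 (.lt (.lit 1) (.len v0))
    (.tab ((.len v0 + .lit 1) / .lit 2)
      (call2 f (.get v1 (.lit 2 * v0)) (.get v1 (.lit 2 * v0 + .lit 1))))) (.lit 0)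

/-- The rule for `reduceP`: `I` is an invariant of the lists on the levels of the tree, `Ψ` is a
potential that pays for the work, and `c` bounds the work of one operation. -/
theorem Runs.reduce {w : ℕ} {f : Prog [a, a] a} {φ : a.Val → a.Val → a.Val}
    {I : List a.Val → Prop} {c : a.Val → a.Val → ℕ} {δ : ℕ} {Ψ : List a.Val → ℕ} {l : List a.Val}
    (hI : I l) (hl : l.length + 2 < 2 ^ w) (hδ : 1 ≤ δ) (hΨ : ∀ l, 1 ≤ Ψ l)
    (hf : ∀ l, I l → 2 ≤ l.length → ∀ i < (l.length + 1) / 2,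
      Runs w f (l.getD (2 * i) a.dflt, l.getD (2 * i + 1) a.dflt, ())
        (· = φ (l.getD (2 * i) a.dflt) (l.getD (2 * i + 1) a.dflt))
        (c (l.getD (2 * i) a.dflt) (l.getD (2 * i + 1) a.dflt)) δ)
    (hs : ∀ l, I l → 2 ≤ l.length → I (halve φ a.dflt l) ∧
      ∑ i ∈ Finset.range ((l.length + 1) / 2),
        c (l.getD (2 * i) a.dflt) (l.getD (2 * i + 1) a.dflt) + 1 + Ψ (halve φ a.dflt l) ≤ Ψ l) :
    Runs w (reduceP f) (l, ()) (fun v => ∃ l', I l' ∧ l'.length ≤ 1 ∧ v = l'.getD 0 a.dflt)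
      (Ψ l) ((Nat.clog 2 l.length + 1) * δ) := by
  have hw0 : 0 < w := pos_of_lt_two_pow hl (by omega)
  have h2 : 2 % 2 ^ w = 2 := Nat.mod_eq_of_lt (by omega)
  have hD : 1 ≤ (Nat.clog 2 l.length + 1) * δ := Nat.mul_pos (by omega) hδ
  refine Runs.get (Q₁ := fun l' => I l' ∧ l'.length ≤ 1) (Q₂ := (· = 0)) ?_
    (Runs.of_flat rfl (hΨ l) hD (by simp)) (fun l' i h hi => ⟨l', h.1, h.2, by rw [hi]⟩)
  refine Runs.loopWhile (ℓ := l.length) (I := fun l' : List a.Val => I l' ∧ l'.length ≤ l.length)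
    (C := fun (l' : List a.Val) v => v = if 1 < l'.length then 1 else 0) (μ := List.length)
    (u := fun l : List a.Val => if 2 ≤ l.length then ∑ i ∈ Finset.range ((l.length + 1) / 2),
        c (l.getD (2 * i) a.dflt) (l.getD (2 * i + 1) a.dflt) + 1 else 1) (d := fun _ => δ)
    (ΨU := Ψ) (ΨD := fun l : List a.Val => (Nat.clog 2 l.length + 1) * δ) ?_ ?_ ?_ ?_ ?_ ?_
  · exact Runs.of_flat rfl (hΨ l) hD (by simpa using Nat.mod_eq_of_lt (by omega))
  · exact Runs.of_flat rfl (hΨ l) hD (by simpa using hI)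
  · rintro l' ⟨-, hl'⟩
    refine Runs.of_flat rfl (by split_ifs <;> omega) hδ ?_
    have h3 : l'.length % 2 ^ w = l'.length := Nat.mod_eq_of_lt (by omega)
    simp [flag_mod hw0, one_mod hw0, h3]
  · rintro l' v ⟨hI', hl'⟩ rfl hv
    have hv' : 2 ≤ l'.length := by
      simp only [ne_eq, flag_eq_zero, not_not] at hv
      exact hv
    have h3 : l'.length % 2 ^ w = l'.length := Nat.mod_eq_of_lt (by omega)
    have h4 : (l'.length + 1) % 2 ^ w = l'.length + 1 := Nat.mod_eq_of_lt (by omega)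
    have h5 : (l'.length + 1) / 2 % 2 ^ w = (l'.length + 1) / 2 := Nat.mod_eq_of_lt (by omega)
    obtain ⟨s1, s2⟩ := hs l' hI' hv'
    refine (Runs.tab (ℓ := (l'.length + 1) / 2) (U := if 2 ≤ l'.length then _ else _)
      (Q := fun i v => v = φ (l'.getD (2 * i) a.dflt) (l'.getD (2 * i + 1) a.dflt))
      (u := fun i => c (l'.getD (2 * i) a.dflt) (l'.getD (2 * i + 1) a.dflt))
      (Runs.of_flat rfl ?_ hδ ?_) ?_ ?_).imp ?_
    · rw [if_pos hv']; omega
    · simp [one_mod hw0, h2, h3, h4, h5]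
    · intro i hi
      have h := hf l' hI' hv' i hi
      have h6 : 2 * i % 2 ^ w = 2 * i := Nat.mod_eq_of_lt (by omega)
      have h7 : (2 * i + 1) % 2 ^ w = 2 * i + 1 := Nat.mod_eq_of_lt (by omega)
      refine Runs.call2 (Q₁ := (· = l'.getD (2 * i) a.dflt))
        (Q₂ := (· = l'.getD (2 * i + 1) a.dflt))
        (Runs.of_flat rfl h.one_le.1 hδ ?_) (Runs.of_flat rfl h.one_le.1 hδ ?_) ?_
      · simp [h2, h6]
      · simp [h2, h6, h7, one_mod hw0]
      · rintro _ _ rfl rfl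
        exact h
    · rw [if_pos hv']; omega
    · rintro l'' ⟨g1, g2⟩
      have : l'' = halve φ a.dflt l' := by
        refine ext_getD (d := a.dflt) (by rw [g1, length_halve]) fun i hi => ?_
        rw [g2 i (g1 ▸ hi), getD_halve _ _ _ _ (g1 ▸ hi)]
      subst this
      refine ⟨⟨s1, by omega⟩, by omega, ?_, ?_⟩
      · rw [if_pos hv']; exact s2
      · rw [length_halve, ← clog_halve hv']
        simp only [add_mul]; omega
  · rintro l' ⟨hI', hl'⟩ hv
    have hv' : ¬ 1 < l'.length := (flag_eq_zero _).1 hv.symm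
    refine ⟨⟨hI', by omega⟩, ?_, ?_⟩
    · rw [if_neg (by omega)]; exact hΨ _
    · exact Nat.le_mul_of_pos_left _ (by omega)
  · rintro l' ⟨hI', hl'⟩ h
    exact ⟨hI', by omega⟩

/-- An operation of constant cost gives linear work and logarithmic depth. -/
theorem Runs.reduce_const {w : ℕ} {f : Prog [a, a] a} {φ : a.Val → a.Val → a.Val}
    {I : List a.Val → Prop} {l : List a.Val} (hI : I l) (hl : l.length + 2 < 2 ^ w)
    (hf : ∀ l, I l → 2 ≤ l.length → ∀ i < (l.length + 1) / 2,
      Runs w f (l.getD (2 * i) a.dflt, l.getD (2 * i + 1) a.dflt, ())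
        (· = φ (l.getD (2 * i) a.dflt) (l.getD (2 * i + 1) a.dflt)) 1 1)
    (hs : ∀ l, I l → I (halve φ a.dflt l)) :
    Runs w (reduceP f) (l, ()) (fun v => ∃ l', I l' ∧ l'.length ≤ 1 ∧ v = l'.getD 0 a.dflt)
      (4 * l.length + 1) (Nat.clog 2 l.length + 1) := by
  refine (Runs.reduce (c := fun _ _ => 1) (δ := 1) (Ψ := fun l => 4 * l.length + 1) hI hl le_rfl
    (fun _ => by omega) hf fun l h h' => ⟨hs l h, ?_⟩).mono (fun _ h => h) le_rfl (by omega)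
  simp only [Finset.sum_const, Finset.card_range, smul_eq_mul, mul_one, length_halve]
  omega

end Reduce

/-- The sum of an array. -/
def sumP : Prog [.arr .word] .word := reduceP (v0 + v1)

theorem sum_halve : ∀ l : List ℕ, (halve (· + ·) 0 l).sum = l.sum
  | [] => rfl
  | [_] => rfl
  | x :: y :: l => by simp [halve, sum_halve l, add_assoc]

theorem sumP_runs {w : ℕ} {l : List ℕ} (hl : l.length + 2 < 2 ^ w) (hs : l.sum < 2 ^ w) :
    Runs w sumP (l, ()) (· = l.sum) (4 * l.length + 1) (Nat.clog 2 l.length + 1) := by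
  refine (Runs.reduce_const (a := .word) (φ := fun x y => x + y) (I := fun l' => l'.sum = l.sum)
    rfl hl ?_ fun l' h => (sum_halve l').trans h).imp ?_
  · intro l' hl' h2 i hi
    refine Runs.of_flat rfl le_rfl le_rfl ?_
    simp only [val_add, val_var, get_zero, get_succ]
    refine Nat.mod_eq_of_lt (lt_of_le_of_lt ?_ hs)
    rw [← hl', ← sum_halve l', ← getD_halve (fun x y : ℕ => x + y) _ _ _ hi]
    rw [List.getD_eq_getElem _ _ (by rw [length_halve]; exact hi)]
    exact List.le_sum_of_mem (List.getElem_mem _)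
  · rintro v ⟨l', h1, h2, rfl⟩
    rw [← h1]
    match l', h2 with
    | [], _ => rfl
    | [x], _ => simp

/-- Reduction with an operation that selects one of its arguments which is below both of them for
a transitive relation `le`. -/
theorem select_runs {w : ℕ} {a : Ty} {f : Prog [a, a] a} {φ : a.Val → a.Val → a.Val}
    {le : a.Val → a.Val → Prop} (refl : ∀ x, le x x) (trans : ∀ x y z, le x y → le y z → le x z)
    (hf : ∀ x y, Runs w f (x, y, ()) (· = φ x y) 1 1) (hφ : ∀ x y, φ x y = x ∨ φ x y = y)
    (hl : ∀ x y, le (φ x y) x) (hr : ∀ x y, le (φ x y) y) {l : List a.Val}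
    (hw : l.length + 2 < 2 ^ w) :
    Runs w (reduceP f) (l, ()) (fun v => (v = a.dflt ∨ v ∈ l) ∧ ∀ x ∈ l, le v x)
      (4 * l.length + 1) (Nat.clog 2 l.length + 1) := by
  refine (Runs.reduce_const (φ := φ)
    (I := fun l' => (∀ x ∈ l', x = a.dflt ∨ x ∈ l) ∧ ∀ x ∈ l, ∃ y ∈ l', le y x)
    ⟨fun x hx => .inr hx, fun x hx => ⟨x, hx, refl x⟩⟩ hw (fun l' _ _ i _ => hf _ _) ?_).imp ?_
  · rintro l' ⟨h1, h2⟩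
    constructor
    · intro z hz
      obtain ⟨x, hx, y, hy, rfl⟩ := mem_halve hz
      rcases hφ x y with h | h <;> rw [h]
      · exact h1 _ hx
      · rcases hy with hy | hy
        · exact h1 _ hy
        · exact .inl hy
    · intro x hx
      obtain ⟨y, hy, hyx⟩ := h2 x hx
      obtain ⟨z, hz | hz⟩ := exists_mem_halve (φ := φ) (d := a.dflt) hy
      · exact ⟨_, hz, trans _ _ _ (hl _ _) hyx⟩
      · exact ⟨_, hz, trans _ _ _ (hr _ _) hyx⟩
  · rintro v ⟨l', ⟨h1, h2⟩, h3, rfl⟩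
    match l', h3 with
    | [], _ => exact ⟨.inl rfl, fun x hx => by simpa using h2 x hx⟩
    | [y], _ => exact ⟨by simpa using h1 y, fun x hx => by simpa using h2 x hx⟩

/-! ### Concatenation and filters -/

/-- The concatenation of two arrays. -/
def appendP {a : Ty} : Prog [.arr a, .arr a] (.arr a) :=
  .tab (.len v0 + .len v1)
    (.ite (.lt v0 (.len v1)) (.get v1 v0) (.get v2 (v0 - .len v1)))

theorem appendP_runs {w : ℕ} {a : Ty} {l l' : List a.Val} (h : l.length + l'.length + 1 < 2 ^ w) :
    Runs w (appendP (a := a)) (l, l', ()) (· = l ++ l') (l.length + l'.length + 1) 1 := by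
  have hw0 : 0 < w := pos_of_lt_two_pow h (by omega)
  have h1 : l.length % 2 ^ w = l.length := Nat.mod_eq_of_lt (by omega)
  have h2 : l'.length % 2 ^ w = l'.length := Nat.mod_eq_of_lt (by omega)
  have h3 : (l.length + l'.length) % 2 ^ w = l.length + l'.length := Nat.mod_eq_of_lt (by omega)
  refine (Runs.tab (ℓ := l.length + l'.length) (Q := fun i v => v = (l ++ l').getD i a.dflt)
    (u := fun _ => 1) (Runs.of_flat rfl (by omega) le_rfl ?_) ?_ ?_).imp ?_
  · simp [h1, h2, h3]
  · intro i hi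
    refine Runs.of_flat rfl le_rfl le_rfl ?_
    have h4 : (i - l.length) % 2 ^ w = i - l.length := Nat.mod_eq_of_lt (by omega)
    simp only [val_ite, val_lt, val_var, get_zero, get_succ, val_len, h1, flag_mod hw0, val_get,
      flag_eq_zero, val_sub, h4]
    split_ifs with h5
    · exact (List.getD_append _ _ _ _ h5).symm
    · exact (List.getD_append_right _ _ _ _ (not_lt.1 h5)).symm
  · simp
  · rintro v ⟨g1, g2⟩
    exact ext_getD (d := a.dflt) (by simp [g1]) fun i hi => g2 i (g1 ▸ hi)

/-- The list of all positions at which an array of words is not zero. -/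
def filterP : Prog [.arr .word] (.arr .word) :=
  call1 (reduceP appendP)
    (.tab (.len v0) (.ite (.get v1 v0) (.tab (.lit 1) v1) (.tab (.lit 0) (.lit 0))))

theorem flatten_halve {α : Type} : ∀ l : List (List α),
    (halve (· ++ ·) [] l).flatten = l.flatten
  | [] => rfl
  | [_] => by simp [halve]
  | x :: y :: l => by simp [halve, flatten_halve l]

theorem sum_length_halve {α : Type} (l : List (List α)) :
    ∑ i ∈ Finset.range ((l.length + 1) / 2),
      ((l.getD (2 * i) []).length + (l.getD (2 * i + 1) []).length + 1) =
    l.flatten.length + (l.length + 1) / 2 := by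
  have h : ∀ l : List (List α), ∑ i ∈ Finset.range ((l.length + 1) / 2),
      ((l.getD (2 * i) []).length + (l.getD (2 * i + 1) []).length) = l.flatten.length := by
    intro l
    induction l using List.twoStepInduction with
    | nil => simp
    | singleton x => simp
    | cons_cons x y l ih _ =>
      have : ((x :: y :: l).length + 1) / 2 = (l.length + 1) / 2 + 1 := by
        simp only [List.length_cons]; omega
      rw [this, Finset.sum_range_succ']
      simp only [Nat.mul_add, mul_one, List.getD_cons_succ, mul_zero, zero_add,
        List.getD_cons_zero, List.flatten_cons, List.length_append]
      rw [ih]; omega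
  rw [Finset.sum_add_distrib, h]
  simp

/-- The singletons of the positions are concatenated along a tree. Each of the logarithmically many
levels copies all of them, hence the logarithmic factor in the work. -/
theorem filterP_runs {w : ℕ} {l : List ℕ} (hw : l.length + 2 < 2 ^ w) :
    Runs w filterP (l, ()) (· = (List.range l.length).filter fun i => l.getD i 0 ≠ 0)
      ((Nat.clog 2 l.length + 1) * (3 * l.length + 2)) (Nat.clog 2 l.length + 1) := by
  have hw0 : 0 < w := pos_of_lt_two_pow hw (by omega)
  have h1 : l.length % 2 ^ w = l.length := Nat.mod_eq_of_lt (by omega)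
  have hU : 3 * l.length + 2 ≤ (Nat.clog 2 l.length + 1) * (3 * l.length + 2) :=
    Nat.le_mul_of_pos_left _ (by omega)
  set F : ℕ → List ℕ := fun i => if l.getD i 0 ≠ 0 then [i] else [] with hF
  have hFl : ((List.range l.length).map F).flatten =
      (List.range l.length).filter fun i => l.getD i 0 ≠ 0 := by
    simp only [hF]
    induction List.range l.length with
    | nil => rfl
    | cons i t ih =>
      simp only [List.map_cons, List.flatten_cons, ih, List.filter_cons]
      by_cases h : l.getD i 0 = 0
      · rw [if_neg (not_not.2 h), if_neg (by simpa using h)]; rfl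
      · rw [if_pos h, if_pos (by simpa using h)]; rfl
  refine Runs.call1 (Q₁ := fun v => v = (List.range l.length).map F) ?_ ?_
  · refine (Runs.tab (ℓ := l.length) (Q := fun i v => v = F i) (u := fun _ => 1)
      (Runs.of_flat rfl (by omega) (by omega) (by simp [h1])) ?_ (by simp; omega)).imp ?_
    · intro i hi
      refine Runs.mono (Q := fun v => v = F i) (U := 1) (D := 1) ?_ (fun _ h => h) le_rfl (by omega)
      refine Runs.ite (C := fun v => v = l.getD i 0)
        (Runs.of_flat rfl le_rfl le_rfl (by simp [Ty.dflt])) ?_ ?_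
      · rintro _ rfl h
        refine (Runs.tab (ℓ := 1) (Q := fun _ v => v = i) (u := fun _ => 1)
          (Runs.of_flat rfl le_rfl le_rfl (by simp [one_mod hw0])) (fun j _ =>
            Runs.of_flat rfl le_rfl le_rfl (by simp)) (by simp)).imp ?_
        rintro v ⟨g1, g2⟩
        rw [hF]
        simp only [h, ne_eq, not_false_eq_true, if_true]
        exact ext_getD (d := 0) g1 fun j hj => by
          obtain rfl : j = 0 := by omega
          exact g2 0 one_pos
      · intro h
        refine (Runs.tab (ℓ := 0) (Q := fun _ v => True) (u := fun _ => 1)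
          (Runs.of_flat rfl le_rfl le_rfl (by simp)) (fun j _ =>
            Runs.of_flat rfl le_rfl le_rfl trivial) (by simp)).imp ?_
        rintro v ⟨g1, g2⟩
        rw [hF]
        simp only [← h, ne_eq, not_true_eq_false, if_false]
        exact List.length_eq_zero_iff.1 g1
    · rintro v ⟨g1, g2⟩
      refine ext_getD (d := []) (by simp [g1]) fun i hi => ?_
      rw [g1] at hi
      refine (g2 i hi).trans ?_
      rw [List.getD_eq_getElem _ _ (by simpa using hi)]
      simp
  · rintro _ rfl
    have hlen : ((List.range l.length).map F).flatten.length ≤ l.length := by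
      rw [hFl]; exact (List.length_filter_le _ _).trans (by simp)
    refine (Runs.reduce (a := .arr .word) (φ := fun x y => x ++ y)
      (I := fun l' => l'.flatten = ((List.range l.length).map F).flatten)
      (c := fun x y => x.length + y.length + 1) (δ := 1)
      (Ψ := fun l' => (Nat.clog 2 l'.length + 1) * (l'.flatten.length + 2 * l'.length + 2))
      rfl ?_ le_rfl ?_ ?_ ?_).mono ?_ ?_ ?_
    · simpa using hw
    · intro l'
      exact Nat.mul_pos (by omega) (by omega)
    · intro l' hl' h2 i hi
      refine appendP_runs ?_
      have h3 := Finset.single_le_sum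
        (f := fun i => (l'.getD (2 * i) []).length + (l'.getD (2 * i + 1) []).length)
        (fun _ _ => Nat.zero_le _) (Finset.mem_range.2 hi)
      have h4 := sum_length_halve l'
      rw [Finset.sum_add_distrib] at h4
      simp only [Finset.sum_const, Finset.card_range, smul_eq_mul, mul_one] at h4
      rw [hl'] at h4
      simp only [Ty.dflt] at h3 ⊢
      omega
    · intro l' hl' h2
      refine ⟨(flatten_halve l').trans hl', ?_⟩
      have h3 := sum_length_halve l'
      simp only [Ty.dflt]
      rw [h3, flatten_halve, length_halve, clog_halve h2, add_mul]
      have := Nat.mul_le_mul_left (Nat.clog 2 l'.length)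
        (show l'.flatten.length + 2 * ((l'.length + 1) / 2) + 2 ≤
          l'.flatten.length + 2 * l'.length + 2 by omega)
      omega
    · rintro v ⟨l', g1, g2, rfl⟩
      rw [← hFl, ← g1]
      match l', g2 with
      | [], _ => rfl
      | [x], _ => simp
    · simp only [List.length_map, List.length_range]
      exact Nat.mul_le_mul_left _ (by omega)
    · simp

end Par

namespace SSSP

open Par

/-! ### Walks with lexicographic lengths -/

/-- Lengths of walks: a weight and a number of edges, in lexicographic order. -/
abbrev Len : Type := ℝ ×ₗ ℕ

/-- `Walk E k x y p`: there is a walk from `x` to `y` with `k` edges and length `p`, where `E u v q`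
says that there is an edge from `u` to `v` of length `q`. -/
inductive Walk (E : ℕ → ℕ → Len → Prop) (x : ℕ) : ℕ → ℕ → Len → Prop
  | nil : Walk E x 0 x 0
  | snoc {k u v : ℕ} {p q : Len} : Walk E x k u p → E u v q → Walk E x (k + 1) v (p + q)

/-- `p` is the least length of a walk from `x` to `y`. -/
def IsDist (E : ℕ → ℕ → Len → Prop) (x y : ℕ) (p : Len) : Prop :=
  (∃ k, Walk E x k y p) ∧ ∀ k q, Walk E x k y q → p ≤ q

section Walks

variable {E : ℕ → ℕ → Len → Prop} {x y z j k : ℕ} {p q r : Len}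

theorem Walk.append (h : Walk E x j y p) (h' : Walk E y k z q) : Walk E x (j + k) z (p + q) := by
  induction h' with
  | nil => simpa using h
  | snoc _ e ih => simpa [add_assoc] using ih.snoc e

theorem Walk.single (h : E x y p) : Walk E x 1 y p := by
  simpa using Walk.nil.snoc h

theorem Walk.split (h : Walk E x (j + k) z r) :
    ∃ y p q, Walk E x j y p ∧ Walk E y k z q ∧ r = p + q := by
  induction k generalizing z r with
  | zero => exact ⟨z, r, 0, h, .nil, by simp⟩
  | succ k ih =>
    cases h with
    | snoc h e =>
      obtain ⟨y, p', q', h1, h2, rfl⟩ := ih h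
      exact ⟨y, p', _, h1, h2.snoc e, by rw [add_assoc]⟩

theorem IsDist.unique (h : IsDist E x y p) (h' : IsDist E x y q) : p = q :=
  le_antisymm (h.2 _ _ h'.1.choose_spec) (h'.2 _ _ h.1.choose_spec)

theorem IsDist.left (h : IsDist E x z (p + q)) (h₁ : Walk E x j y p) (h₂ : Walk E y k z q) :
    IsDist E x y p :=
  ⟨⟨j, h₁⟩, fun _ _ h' => le_of_add_le_add_right (h.2 _ _ (h'.append h₂))⟩

theorem IsDist.right (h : IsDist E x z (p + q)) (h₁ : Walk E x j y p) (h₂ : Walk E y k z q) :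
    IsDist E y z q :=
  ⟨⟨k, h₂⟩, fun _ _ h' => le_of_add_le_add_left (h.2 _ _ (h₁.append h'))⟩

end Walks

/-- The edges of a graph that is given by the list of the incoming edges of each vertex; the length
of an edge is its weight, together with the number `1`. -/
def GEdge (g : List (List (ℕ × ℝ))) (u v : ℕ) (q : Len) : Prop :=
  ∃ c, (u, c) ∈ g.getD v [] ∧ q = toLex (c, 1)

/-- All tails of edges are vertices. -/
def WF (g : List (List (ℕ × ℝ))) : Prop :=
  ∀ v, ∀ e ∈ g.getD v [], e.1 < g.length

section GEdge

variable {g : List (List (ℕ × ℝ))} {x y z j k : ℕ} {p q r : Len}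

theorem Walk.hops (h : Walk (GEdge g) x k y p) : (ofLex p).2 = k := by
  induction h with
  | nil => rfl
  | snoc _ e ih =>
    obtain ⟨c, -, rfl⟩ := e
    simp [ofLex_add, ih]

theorem Walk.lt_length (h : Walk (GEdge g) x k y p) (hx : x < g.length) : y < g.length := by
  cases h with
  | nil => exact hx
  | snoc _ e =>
    obtain ⟨c, h, -⟩ := e
    by_contra hy
    rw [List.getD_eq_default _ _ (not_lt.1 hy)] at h
    simp at h

/-- A shortest walk can be cut after any number of edges. -/
theorem IsDist.split (h : IsDist (GEdge g) x z r) (hj : j ≤ (ofLex r).2) :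
    ∃ y p q, IsDist (GEdge g) x y p ∧ IsDist (GEdge g) y z q ∧ r = p + q ∧ (ofLex p).2 = j := by
  obtain ⟨k, hk⟩ := h.1
  have hk' := hk.hops
  obtain ⟨i, rfl⟩ := Nat.exists_eq_add_of_le (hk' ▸ hj)
  obtain ⟨y, p, q, h1, h2, rfl⟩ := hk.split
  exact ⟨y, p, q, h.left h1 h2, h.right h1 h2, rfl, h1.hops⟩

theorem IsDist.walk (h : IsDist (GEdge g) x z r) : Walk (GEdge g) x (ofLex r).2 z r := by
  obtain ⟨k, hk⟩ := h.1
  rwa [hk.hops]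

end GEdge

/-! ### Lengths as data -/

/-- The type of lengths: the pair `(0, _)` stands for infinity, and `(k + 1, c)` for the weight `c`
and `k` edges. -/
abbrev dTy : Ty := .prod .word .real

/-- The length that a value stands for, if it is not infinity. -/
def toLen (a : ℕ × ℝ) : Len := toLex (a.2, a.1 - 1)

/-- The order on values, with infinity at the top. -/
def LeD (a b : ℕ × ℝ) : Prop := b.1 ≠ 0 → a.1 ≠ 0 ∧ toLen a ≤ toLen b

/-- The value `a` is infinity or a length in `S`, and it is at most every length in `C`. -/
def Between (S C : Len → Prop) (a : ℕ × ℝ) : Prop :=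
  (a.1 ≠ 0 → S (toLen a)) ∧ ∀ p, C p → a.1 ≠ 0 ∧ toLen a ≤ p

theorem LeD.refl (a : ℕ × ℝ) : LeD a a := fun h => ⟨h, le_rfl⟩

theorem LeD.trans (a b c : ℕ × ℝ) (h : LeD a b) (h' : LeD b c) : LeD a c := fun hc =>
  ⟨(h (h' hc).1).1, (h (h' hc).1).2.trans (h' hc).2⟩

/-- The smaller one of two lengths. -/
noncomputable def minD (a b : ℕ × ℝ) : ℕ × ℝ :=
  if a.1 = 0 then b else if b.1 = 0 then a else
  if a.2 ≤ b.2 then (if b.2 ≤ a.2 then (if b.1 < a.1 then b else a) else a) else b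

theorem minD_eq (a b : ℕ × ℝ) : minD a b = a ∨ minD a b = b := by
  unfold minD; split_ifs <;> simp

theorem minD_le (a b : ℕ × ℝ) : LeD (minD a b) a ∧ LeD (minD a b) b := by
  unfold minD
  split_ifs with h1 h2 h3 h4 h5
  · exact ⟨fun h => absurd h1 h, .refl _⟩
  · exact ⟨.refl _, fun h => absurd h2 h⟩
  · refine ⟨fun h => ⟨h2, ?_⟩, .refl _⟩
    exact Prod.Lex.toLex_le_toLex.2 (.inr ⟨le_antisymm h4 h3, by dsimp only; omega⟩)
  · refine ⟨.refl _, fun h => ⟨h1, ?_⟩⟩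
    exact Prod.Lex.toLex_le_toLex.2 (.inr ⟨le_antisymm h3 h4, by dsimp only; omega⟩)
  · exact ⟨.refl _, fun h => ⟨h1, Prod.Lex.toLex_le_toLex.2 (.inl (not_le.1 h4))⟩⟩
  · exact ⟨fun h => ⟨h2, Prod.Lex.toLex_le_toLex.2 (.inl (not_le.1 h3))⟩, .refl _⟩

/-- The program for `minD`. -/
def minP : Prog [dTy, dTy] dTy :=
  .ite (.fst v0) (.ite (.fst v1)
    (.ite (.rle (.snd v0) (.snd v1))
      (.ite (.rle (.snd v1) (.snd v0)) (.ite (.lt (.fst v1) (.fst v0)) v1 v0) v0) v1) v0) v1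

theorem minP_runs {w : ℕ} (hw : 0 < w) (a b : ℕ × ℝ) :
    Runs w minP (a, b, ()) (· = minD a b) 1 1 := by
  refine Runs.of_flat rfl le_rfl le_rfl ?_
  simp only [minP, val_ite, val_fst, val_snd, val_var, get_zero, get_succ, val_rle, val_lt]
  unfold minD
  have := one_mod hw
  by_cases h3 : a.2 ≤ b.2 <;> by_cases h4 : b.2 ≤ a.2 <;> by_cases h5 : b.1 < a.1 <;>
    simp [h3, h4, h5, this]

/-- The sum of two lengths. -/
noncomputable def addD (a b : ℕ × ℝ) : ℕ × ℝ :=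
  if a.1 = 0 then (0, 0) else if b.1 = 0 then (0, 0) else (a.1 + b.1 - 1, a.2 + b.2)

theorem addD_ne_zero {a b : ℕ × ℝ} : (addD a b).1 ≠ 0 ↔ a.1 ≠ 0 ∧ b.1 ≠ 0 := by
  unfold addD; split_ifs <;> simp_all; omega

theorem toLen_addD {a b : ℕ × ℝ} (ha : a.1 ≠ 0) (hb : b.1 ≠ 0) :
    toLen (addD a b) = toLen a + toLen b := by
  unfold addD toLen
  rw [if_neg ha, if_neg hb, ← toLex_add, Prod.mk_add_mk]
  congr 2
  dsimp only
  omega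

theorem fst_addD_le {a b : ℕ × ℝ} : (addD a b).1 ≤ a.1 + b.1 := by
  unfold addD; split_ifs <;> simp

/-- The program for `addD`. -/
def addP : Prog [dTy, dTy] dTy :=
  .ite (.fst v0) (.ite (.fst v1)
    (.pair (.fst v0 + .fst v1 - .lit 1) (.radd (.snd v0) (.snd v1)))
    (.pair (.lit 0) .rzero)) (.pair (.lit 0) .rzero)

theorem addP_runs {w : ℕ} {a b : ℕ × ℝ} (h : a.1 + b.1 + 1 < 2 ^ w) :
    Runs w addP (a, b, ()) (· = addD a b) 1 1 := by
  have hw : 0 < w := by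
    rcases Nat.eq_zero_or_pos w with rfl | h'
    · simp at h
    · exact h'
  refine Runs.of_flat rfl le_rfl le_rfl ?_
  have h1 : (a.1 + b.1) % 2 ^ w = a.1 + b.1 := Nat.mod_eq_of_lt (by omega)
  have h2 : (a.1 + b.1 - 1) % 2 ^ w = a.1 + b.1 - 1 := Nat.mod_eq_of_lt (by omega)
  simp only [addP, val_ite, val_fst, val_var, get_zero, get_succ, val_pair, val_lit,
    val_rzero, val_radd, val_add, val_sub, one_mod hw, h1, h2, Nat.zero_mod]
  rfl

/-- The least entry of an array of lengths. -/
def minListP : Prog [.arr dTy] dTy := reduceP minP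

theorem minListP_runs {w : ℕ} {l : List (ℕ × ℝ)} (hw : l.length + 2 < 2 ^ w) :
    Runs w minListP (l, ()) (fun v => (v = (0, 0) ∨ v ∈ l) ∧ ∀ x ∈ l, LeD v x)
      (4 * l.length + 1) (Nat.clog 2 l.length + 1) := by
  have hw0 : 0 < w := pos_of_lt_two_pow hw (by omega)
  exact select_runs (a := dTy) (φ := minD) (le := LeD) LeD.refl LeD.trans (minP_runs hw0) minD_eq
    (fun a b => (minD_le a b).1) (fun a b => (minD_le a b).2) hw

theorem Between.of_min {S C : Len → Prop} {l : List (ℕ × ℝ)} {v : ℕ × ℝ}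
    (hv : (v = (0, 0) ∨ v ∈ l) ∧ ∀ x ∈ l, LeD v x) (hS : ∀ x ∈ l, x.1 ≠ 0 → S (toLen x))
    (hC : ∀ p, C p → ∃ x ∈ l, x.1 ≠ 0 ∧ toLen x ≤ p) : Between S C v := by
  refine ⟨fun h => ?_, fun p hp => ?_⟩
  · rcases hv.1 with rfl | h'
    · simp at h
    · exact hS _ h' h
  · obtain ⟨x, hx, hx0, hxp⟩ := hC p hp
    have := hv.2 x hx hx0
    exact ⟨this.1, this.2.trans hxp⟩

theorem Between.imp {S S' C C' : Len → Prop} {a : ℕ × ℝ} (h : Between S C a)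
    (hS : ∀ p, S p → S' p) (hC : ∀ p, C' p → C p) : Between S' C' a :=
  ⟨fun h' => hS _ (h.1 h'), fun p hp => h.2 p (hC p hp)⟩

theorem Between.eq {S C : Len → Prop} {a : ℕ × ℝ} {p : Len} (h : Between S C a)
    (hS : ∀ q, S q → p ≤ q) (hC : C p) : a.1 ≠ 0 ∧ toLen a = p :=
  ⟨(h.2 p hC).1, le_antisymm (h.2 p hC).2 (hS _ (h.1 (h.2 p hC).1))⟩

/-! ### Shortest walks with a bounded number of edges -/

/-- The type of graphs: for each vertex the incoming edges, with their tails and weights. -/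
abbrev gTy : Ty := .arr (.arr (.prod .word .real))

/-- The number of edges. -/
def numE (g : List (List (ℕ × ℝ))) : ℕ := ∑ v ∈ Finset.range g.length, (g.getD v []).length

/-- `k` rounds of the Bellman–Ford algorithm, for a given source. -/
def bellmanFordP : Prog [gTy, .word, .word] (.arr dTy) :=
  .loop v2
    (.tab (.len v0) (.ite (.eq v0 v2) (.pair (.lit 1) .rzero) (.pair (.lit 0) .rzero)))
    (.tab (.len v2) (call2 minP (.get v2 v0) (call1 minListP (.tab (.len (.get v3 v0))
      (call2 addP (.get v3 (.fst (.get (.get v4 v1) v0)))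
        (.pair (.lit 2) (.snd (.get (.get v4 v1) v0))))))))

theorem toLen_edge (c : ℝ) : toLen (2, c) = toLex (c, 1) := rfl

/-- `D` lists lengths of walks from `x` in `g`, at most those of the walks with at most `k`
edges. For shortest walks with at most `k` edges, the entries are therefore exact. -/
def BFArray (g : List (List (ℕ × ℝ))) (x k : ℕ) (D : List (ℕ × ℝ)) : Prop :=
  D.length = g.length ∧ ∀ y < g.length, (D.getD y (0, 0)).1 ≤ k + 1 ∧
    Between (fun p => ∃ j, Walk (GEdge g) x j y p) (fun p => ∃ j ≤ k, Walk (GEdge g) x j y p)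
      (D.getD y (0, 0))

theorem bellmanFordP_runs {w x k : ℕ} {g : List (List (ℕ × ℝ))} (hg : WF g)
    (hdeg : ∀ v, (g.getD v []).length ≤ g.length) (hx : x < g.length)
    (hw : g.length + k + 8 < 2 ^ w) :
    Runs w bellmanFordP (g, x, k, ()) (BFArray g x k) ((k + 1) * (4 * numE g + g.length))
      ((k + 1) * (Nat.clog 2 g.length + 1)) := by
  have hw0 : 0 < w := pos_of_lt_two_pow hw (by omega)
  have hU : g.length ≤ (k + 1) * (4 * numE g + g.length) :=
    (Nat.le_add_left _ _).trans (Nat.le_mul_of_pos_left _ (by omega))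
  have hD : 1 ≤ (k + 1) * (Nat.clog 2 g.length + 1) := Nat.mul_pos (by omega) (by omega)
  have m1 := one_mod hw0
  have m2 : 2 % 2 ^ w = 2 := Nat.mod_eq_of_lt (by omega)
  have hlen : g.length % 2 ^ w = g.length := Nat.mod_eq_of_lt (by omega)
  unfold bellmanFordP
  refine Runs.loop (a := .arr dTy) (ℓ := k) (I := BFArray g x) (u := fun _ => 4 * numE g + g.length)
    (d := fun _ => Nat.clog 2 g.length + 1) ?_ ?_ ?_ ?_ ?_
  · exact Runs.of_flat rfl (by omega) hD (by simp)
  · refine (Runs.tab (ℓ := g.length) (Q := fun y v => v = if y = x then (1, 0) else (0, 0))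
      (u := fun _ => 1) (Runs.of_flat rfl (by omega) hD (by simp [hlen])) (fun y _ =>
        Runs.of_flat rfl le_rfl hD ?_) (by simpa using hU)).imp ?_
    · by_cases h : y = x <;> simp [h, m1]
    · rintro D ⟨h1, h2⟩
      refine ⟨h1, fun y hy => ?_⟩
      have h3 : D.getD y (0, 0) = if y = x then (1, 0) else (0, 0) := h2 y hy
      rw [h3]
      by_cases h : y = x
      · subst h
        rw [if_pos rfl]
        refine ⟨by simp, fun _ => ⟨0, .nil⟩, ?_⟩
        rintro p ⟨j, hj, hp⟩
        obtain rfl : j = 0 := by omega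
        cases hp
        exact ⟨one_ne_zero, le_rfl⟩
      · rw [if_neg h]
        refine ⟨by simp, fun h' => absurd rfl h', ?_⟩
        rintro p ⟨j, hj, hp⟩
        obtain rfl : j = 0 := by omega
        cases hp
        exact absurd rfl h
  · -- the new entry of `y` is the minimum of the old one and those over the edges into `y`
    rintro i hi D ⟨hDl, hDy⟩
    refine (Runs.tab (ℓ := g.length) (Q := fun y (v : ℕ × ℝ) => v.1 ≤ i + 1 + 1 ∧
        Between (fun p => ∃ j, Walk (GEdge g) x j y p)
          (fun p => ∃ j ≤ i + 1, Walk (GEdge g) x j y p) v)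
      (u := fun v => 4 * (g.getD v []).length + 1)
      ?_ ?_ ?_).imp fun _ h => ⟨h.1, h.2⟩
    · exact Runs.of_flat rfl (by omega) (by omega) (by simp [hlen])
    · intro y hy
      have hdy := hdeg y
      refine Runs.call2 (Q₁ := fun a => a = D.getD y (0, 0))
        (Q₂ := fun a : ℕ × ℝ => a.1 ≤ i + 1 + 1 ∧ Between (fun p => ∃ j, Walk (GEdge g) x j y p)
          (fun p => ∃ j ≤ i, Walk (GEdge g) x (j + 1) y p) a)
        (Runs.of_flat rfl (by omega) (by omega) (by simp [Ty.dflt])) ?_ ?_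
      · refine Runs.call1 (Q₁ := fun l : List (ℕ × ℝ) => l.length = (g.getD y []).length ∧
          ∀ e < (g.getD y []).length, l.getD e (0, 0) =
            addD (D.getD ((g.getD y []).getD e (0, 0)).1 (0, 0))
              (2, ((g.getD y []).getD e (0, 0)).2)) ?_ ?_
        · refine Runs.tab (a := dTy) (ℓ := (g.getD y []).length) (Q := fun e a => a =
            addD (D.getD ((g.getD y []).getD e (0, 0)).1 (0, 0))
              (2, ((g.getD y []).getD e (0, 0)).2)) (u := fun _ => 1) ?_ ?_ ?_
          · refine Runs.of_flat rfl (by omega) (by omega) ?_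
            simp only [val_len, val_get, val_var, get_zero, get_succ]
            exact Nat.mod_eq_of_lt (lt_of_le_of_lt hdy (by omega))
          · intro e he
            refine Runs.call2
              (Q₁ := fun a => a = D.getD ((g.getD y []).getD e (0, 0)).1 (0, 0))
              (Q₂ := fun a => a = (2, ((g.getD y []).getD e (0, 0)).2))
              (Runs.of_flat rfl le_rfl (by omega) (by simp [Ty.dflt]))
              (Runs.of_flat rfl le_rfl (by omega) (by simp [Ty.dflt, m2])) ?_
            rintro _ _ rfl rfl
            have hu : ((g.getD y []).getD e (0, 0)).1 < g.length := by
              rw [List.getD_eq_getElem _ _ he]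
              exact hg y _ (List.getElem_mem _)
            have := (hDy _ hu).1
            exact (addP_runs (by dsimp only; omega)).mono (fun _ h => h) le_rfl (by omega)
          · simp; omega
        · rintro l ⟨h1, h2⟩
          refine (minListP_runs (by omega)).mono (fun v hv => ?_) (by omega)
            (by rw [h1]; exact Nat.add_le_add_right (Nat.clog_mono_right 2 hdy) 1)
          have hmem : ∀ a ∈ l, ∃ u c, (u, c) ∈ g.getD y [] ∧ u < g.length ∧
              a = addD (D.getD u (0, 0)) (2, c) := by
            intro a ha
            obtain ⟨e, he, rfl⟩ := List.getElem_of_mem ha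
            have h3 := h2 e (h1 ▸ he)
            have he' := h1 ▸ he
            rw [List.getD_eq_getElem _ _ he, List.getD_eq_getElem _ _ he'] at h3
            exact ⟨_, _, List.getElem_mem he', hg y _ (List.getElem_mem he'), h3⟩
          constructor
          · rcases hv.1 with rfl | hv'
            · simp
            · obtain ⟨u, c, -, hu, rfl⟩ := hmem _ hv'
              have := (hDy _ hu).1
              have h3 := fst_addD_le (a := D.getD u (0, 0)) (b := (2, c))
              unfold addD at h3 ⊢
              split_ifs at h3 ⊢ <;> simp only at h3 ⊢ <;> omega
          · refine Between.of_min hv ?_ ?_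
            · intro a ha ha0
              obtain ⟨u, c, huc, hu, rfl⟩ := hmem _ ha
              have ha1 := addD_ne_zero.1 ha0
              obtain ⟨j, hj⟩ := (hDy _ hu).2.1 ha1.1
              refine ⟨j + 1, ?_⟩
              rw [toLen_addD ha1.1 ha1.2, toLen_edge]
              exact hj.snoc ⟨c, huc, rfl⟩
            · rintro p ⟨j, hj, hp⟩
              cases hp with
              | @snoc _ u _ p q hp e =>
                obtain ⟨c, huc, rfl⟩ := e
                obtain ⟨e, he, hec⟩ := List.getElem_of_mem huc
                have hu : u < g.length := hg y _ huc
                obtain ⟨h3, h4⟩ := (hDy _ hu).2.2 p ⟨j, hj, hp⟩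
                have h5 := h2 e he
                rw [List.getD_eq_getElem _ _ (h1 ▸ he), List.getD_eq_getElem _ _ he, hec] at h5
                refine ⟨_, List.getElem_mem (h1 ▸ he), ?_, ?_⟩
                · rw [h5]; exact addD_ne_zero.2 ⟨h3, by simp⟩
                · rw [h5, toLen_addD h3 (by simp), toLen_edge]
                  exact add_le_add_left h4 _
      · rintro _ a rfl ⟨ha1, ha⟩
        refine (minP_runs hw0 _ _).mono ?_ (by omega) (by omega)
        rintro _ rfl
        obtain ⟨hy1, hy2⟩ := hDy y hy
        obtain ⟨l1, l2⟩ := minD_le (D.getD y (0, 0)) a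
        refine ⟨?_, ?_, ?_⟩
        · rcases minD_eq (D.getD y (0, 0)) a with h | h <;> rw [h] <;> omega
        · intro h0
          rcases minD_eq (D.getD y (0, 0)) a with h | h <;> rw [h] at h0 ⊢
          · exact hy2.1 h0
          · exact ha.1 h0
        · rintro p ⟨j, hj, hp⟩
          rcases Nat.lt_or_ge j (i + 1) with hj' | hj'
          · obtain ⟨h3, h4⟩ := hy2.2 p ⟨j, by omega, hp⟩
            exact ⟨(l1 h3).1, (l1 h3).2.trans h4⟩
          · obtain rfl : j = i + 1 := by omega
            obtain ⟨h3, h4⟩ := ha.2 p ⟨i, le_rfl, hp⟩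
            exact ⟨(l2 h3).1, (l2 h3).2.trans h4⟩
    · rw [Finset.sum_add_distrib, ← Finset.mul_sum]
      simp [numE]
  · rw [Finset.sum_const, Finset.card_range, smul_eq_mul]
    exact Nat.mul_le_mul_right _ (by omega)
  · rw [Finset.sum_const, Finset.card_range, smul_eq_mul]
    exact Nat.mul_le_mul_right _ (by omega)

/-! ### Predecessors -/

/-- The edge `(u, v)` of weight `c` attains the entry of `v` in `D`. -/
def Tight (g : List (List (ℕ × ℝ))) (D : List (ℕ × ℝ)) (u v : ℕ) : Prop :=
  ∃ c, (u, c) ∈ g.getD v [] ∧ (D.getD u (0, 0)).1 ≠ 0 ∧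
    D.getD v (0, 0) = addD (D.getD u (0, 0)) (2, c)

/-- `par` lists for each vertex a predecessor along a tight edge, or the vertex itself if there is
none. -/
def IsPar (g : List (List (ℕ × ℝ))) (D : List (ℕ × ℝ)) (par : List ℕ) : Prop :=
  par.length = g.length ∧ ∀ v < g.length,
    (par.getD v 0 = v ∨ Tight g D (par.getD v 0) v) ∧
    ∀ u, Tight g D u v → Tight g D (par.getD v 0) v

/-- The first nonzero one of two words. Candidates `u` for a predecessor are represented by `u + 1`,
and `0` stands for none. -/
def orP : Prog [.word, .word] .word := .ite v0 v0 v1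

/-- Predecessors along tight edges. -/
def parentsP : Prog [gTy, .arr dTy] (.arr .word) :=
  .tab (.len v0) (.letIn (call1 (reduceP orP) (.tab (.len (.get v1 v0))
    (.letIn (.get (.get v2 v1) v0)
      (.letIn (call2 addP (.get v4 (.fst v0)) (.pair (.lit 2) (.snd v0)))
        (.letIn (.get v5 v3)
          (.ite (.fst v1) (.ite (.eq (.fst v0) (.fst v1)) (.ite (.rle (.snd v0) (.snd v1))
            (.ite (.rle (.snd v1) (.snd v0)) (.fst v2 + .lit 1) (.lit 0))
            (.lit 0)) (.lit 0)) (.lit 0)))))))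
    (.ite v0 (v0 - .lit 1) v1))

theorem parentsP_runs {w B : ℕ} {g : List (List (ℕ × ℝ))} {D : List (ℕ × ℝ)} (hg : WF g)
    (hdeg : ∀ v, (g.getD v []).length ≤ g.length)
    (hDB : ∀ y < g.length, (D.getD y (0, 0)).1 ≤ B)
    (hw : g.length + B + 8 < 2 ^ w) :
    Runs w parentsP (g, D, ()) (IsPar g D) (4 * numE g + g.length + 1)
      (Nat.clog 2 g.length + 1) := by
  have hw0 : 0 < w := pos_of_lt_two_pow hw (by omega)
  have m1 := one_mod hw0
  have m2 : 2 % 2 ^ w = 2 := Nat.mod_eq_of_lt (by omega)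
  have hlen : g.length % 2 ^ w = g.length := Nat.mod_eq_of_lt (by omega)
  unfold parentsP
  refine Runs.tab (a := .word) (ℓ := g.length) (Q := fun v p => (p = v ∨ Tight g D p v) ∧
      ∀ u, Tight g D u v → Tight g D p v) (u := fun v => 4 * (g.getD v []).length + 1)
    ?_ ?_ ?_
  · exact Runs.of_flat rfl (by omega) (by omega) (by simp [hlen])
  · intro v hv
    have hdv := hdeg v
    refine Runs.letIn (Q := fun r => (r = 0 ∨ ∃ u, r = u + 1 ∧ u < g.length ∧ Tight g D u v) ∧
      ∀ u, Tight g D u v → r ≠ 0) ?_ ?_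
    · refine Runs.call1 (Q₁ := fun l : List ℕ => l.length = (g.getD v []).length ∧
        ∀ e < (g.getD v []).length, ∃ u c, (g.getD v []).getD e (0, 0) = (u, c) ∧
          ((l.getD e 0 = 0 ∧ ¬ ((D.getD u (0, 0)).1 ≠ 0 ∧
            D.getD v (0, 0) = addD (D.getD u (0, 0)) (2, c))) ∨
          (l.getD e 0 = u + 1 ∧ (D.getD u (0, 0)).1 ≠ 0 ∧
            D.getD v (0, 0) = addD (D.getD u (0, 0)) (2, c)))) ?_ ?_
      · refine Runs.tab (a := .word) (ℓ := (g.getD v []).length) (Q := fun e r => ∃ u c,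
          (g.getD v []).getD e (0, 0) = (u, c) ∧ ((r = 0 ∧ ¬ ((D.getD u (0, 0)).1 ≠ 0 ∧
            D.getD v (0, 0) = addD (D.getD u (0, 0)) (2, c))) ∨
          (r = u + 1 ∧ (D.getD u (0, 0)).1 ≠ 0 ∧
            D.getD v (0, 0) = addD (D.getD u (0, 0)) (2, c)))) (u := fun _ => 1) ?_ ?_ ?_
        · refine Runs.of_flat rfl (by omega) (by omega) ?_
          simp only [val_len, val_get, val_var, get_zero, get_succ]
          exact Nat.mod_eq_of_lt (lt_of_le_of_lt hdv (by omega))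
        · intro e he
          refine Runs.of_flat rfl le_rfl (by omega) ?_
          obtain ⟨u, c, huc⟩ : ∃ u c, (g.getD v []).getD e (0, 0) = (u, c) := ⟨_, _, rfl⟩
          have hu : u < g.length := by
            rw [List.getD_eq_getElem _ _ he] at huc
            have := hg v _ (List.getElem_mem he)
            rw [huc] at this
            exact this
          refine ⟨u, c, huc, ?_⟩
          have hB := hDB u hu
          have ha := (addP_runs (w := w) (a := D.getD u (0, 0)) (b := (2, c))
            (by dsimp only; omega)).val
          have huc' : (g.getD v (Ty.dflt (.arr (.prod .word .real)))).getD e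
            (Ty.dflt (.prod .word .real)) = (u, c) := huc
          have m3 : (u + 1) % 2 ^ w = u + 1 := Nat.mod_eq_of_lt (by omega)
          simp only [val_letIn, val_call2, val_ite, val_fst, val_snd, val_get, val_var, get_zero,
            get_succ, val_pair, val_lit, val_eq, val_rle, val_add, huc', m2, m1, m3,
            Nat.zero_mod]
          rw [show D.getD u (Ty.dflt dTy) = D.getD u (0, 0) from rfl,
            show D.getD v (Ty.dflt dTy) = D.getD v (0, 0) from rfl, ha]
          have hz : (addD (D.getD u (0, 0)) (2, c)).1 ≠ 0 ↔ (D.getD u (0, 0)).1 ≠ 0 := by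
            rw [addD_ne_zero]; simp
          generalize D.getD v (0, 0) = b at *
          generalize addD (D.getD u (0, 0)) (2, c) = a at *
          rw [← hz]
          by_cases h1 : a.1 = 0 <;> by_cases h2 : b.1 = a.1 <;> by_cases h3 : b.2 ≤ a.2 <;>
            by_cases h4 : a.2 ≤ b.2 <;> simp [h1, h2, h3, h4, m1, Prod.ext_iff]
          · exact le_antisymm h3 h4
          · intro h; exact absurd h.ge h4
          · intro h; exact absurd h.le h3
          · intro h; exact absurd h.le h3
        · simp; omega
      · rintro l ⟨h1, h2⟩
        refine (select_runs (a := .word) (f := orP) (φ := fun x y : ℕ => if x = 0 then y else x)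
          (le := fun x y : ℕ => y ≠ 0 → x ≠ 0) (fun _ h => h) (fun _ _ _ h h' h'' => h (h' h''))
          (fun x y => Runs.of_flat rfl le_rfl le_rfl (by simp only [orP, val_ite]; rfl)) ?_ ?_ ?_
          (by omega)).mono ?_ (by omega)
          (by rw [h1]; exact Nat.add_le_add_right (Nat.clog_mono_right 2 hdv) 1)
        · intro x y; split_ifs <;> simp
        · intro x y h; rw [if_neg h]; exact h
        · intro x y h; split_ifs with h'
          · exact h
          · exact h'
        · rintro r ⟨hr1, hr2⟩
          constructor
          · rcases hr1 with rfl | hr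
            · exact .inl rfl
            · obtain ⟨e, he, rfl⟩ := List.getElem_of_mem hr
              obtain ⟨u, c, h3, h4⟩ := h2 e (h1 ▸ he)
              have he' := h1 ▸ he
              rw [List.getD_eq_getElem _ _ he] at h4
              rw [List.getD_eq_getElem _ _ he'] at h3
              rcases h4 with h4 | h4
              · exact .inl h4.1
              · have hm : (u, c) ∈ g.getD v [] := h3 ▸ List.getElem_mem he'
                exact .inr ⟨u, h4.1, hg v _ hm, c, hm, h4.2⟩
          · rintro u ⟨c, hm, h5⟩
            obtain ⟨e, he, hec⟩ := List.getElem_of_mem hm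
            obtain ⟨u', c', h3, h4⟩ := h2 e he
            have he' := h1.symm ▸ he
            rw [List.getD_eq_getElem _ _ he, hec] at h3
            obtain ⟨rfl, rfl⟩ := Prod.mk.inj h3
            rw [List.getD_eq_getElem _ _ he'] at h4
            refine hr2 _ (List.getElem_mem he') ?_
            rcases h4 with h4 | h4
            · exact absurd h5 h4.2
            · rw [h4.1]; exact Nat.succ_ne_zero u
    · rintro r ⟨h1, h2⟩
      refine Runs.of_flat rfl (by omega) (by omega) ?_
      rcases h1 with rfl | ⟨u, rfl, hu, ht⟩
      · simp only [val_ite, val_var, get_zero, get_succ, if_true, true_or, true_and]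
        exact fun u hu => absurd rfl (h2 u hu)
      · have m3 : u % 2 ^ w = u := Nat.mod_eq_of_lt (by omega)
        simp [m1, m3, ht]
  · rw [Finset.sum_add_distrib, ← Finset.mul_sum]
    simp [numE]

/-! ### Iterated predecessors by pointer doubling -/

/-- The first `2 ^ k` iterates of a function on vertices, for each vertex, and the next one. -/
def iteratesP : Prog [.arr .word, .word] (.arr (.prod .word (.arr .word))) :=
  .loop v1 (.tab (.len v0) (.pair (.get v1 v0) (.tab (.lit 1) v1)))
    (.tab (.len v1) (.letIn (.get v2 v0) (.letIn (.get v3 (.fst v0))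
      (.pair (.fst v0) (call2 appendP (.snd v1) (.snd v0))))))

/-- The value computed by `iteratesP`. -/
def IsIter (f : List ℕ) (k : ℕ) (l : List (ℕ × List ℕ)) : Prop :=
  l.length = f.length ∧ ∀ v < f.length, l.getD v (0, []) =
    ((fun u => f.getD u 0)^[2 ^ k] v, (List.range (2 ^ k)).map fun j => (fun u => f.getD u 0)^[j] v)

theorem iteratesP_runs {w k : ℕ} {f : List ℕ} (hf : ∀ v < f.length, f.getD v 0 < f.length)
    (hw : f.length + 2 ^ k + 2 < 2 ^ w) :
    Runs w iteratesP (f, k, ()) (IsIter f k) (f.length * (3 * 2 ^ k) + k + 1) (k + 1) := by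
  have hw0 : 0 < w := pos_of_lt_two_pow hw (Nat.succ_pos _)
  have hk := Nat.one_le_two_pow (n := k)
  have m1 := one_mod hw0
  have hlen : f.length % 2 ^ w = f.length := Nat.mod_eq_of_lt (by omega)
  have hit : ∀ j v, v < f.length → (fun u => f.getD u 0)^[j] v < f.length := by
    intro j
    induction j with
    | zero => exact fun v hv => hv
    | succ j ih => exact fun v hv => ih _ (hf v hv)
  have hU : ∀ k, ∑ i ∈ Finset.range k, (f.length * (2 ^ (i + 1) + 1) + 1) ≤
      f.length * (3 * 2 ^ k) + k := by
    intro k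
    induction k with
    | zero => simp
    | succ k ih =>
      rw [Finset.sum_range_succ]
      have h1 : 1 ≤ 2 ^ k := Nat.one_le_two_pow
      have h2 := Nat.mul_le_mul_left f.length
        (show 2 ^ (k + 1) + 1 + 3 * 2 ^ k ≤ 3 * 2 ^ (k + 1) by rw [pow_succ]; omega)
      rw [mul_add] at h2
      omega
  have hkk : k < 2 ^ k := Nat.lt_two_pow_self
  have hUk : f.length ≤ f.length * (3 * 2 ^ k) := Nat.le_mul_of_pos_right _ (by omega)
  unfold iteratesP
  refine Runs.loop (a := .arr (.prod .word (.arr .word))) (ℓ := k) (I := IsIter f)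
    (u := fun i => f.length * (2 ^ (i + 1) + 1) + 1)
    (d := fun _ => 1) ?_ ?_ ?_ ?_ ?_
  · exact Runs.of_flat rfl (by omega) (by omega) (by simp)
  · refine (Runs.tab (ℓ := f.length) (Q := fun v a => a = (f.getD v 0, [v])) (u := fun _ => 1)
      (Runs.of_flat rfl (by omega) (by omega) (by simp [hlen])) ?_ (by simp; omega)).imp ?_
    · intro v hv
      refine Runs.pair (Q₁ := fun a => a = f.getD v 0) (Q₂ := fun a => a = [v])
        (Runs.of_flat rfl le_rfl (by omega) (by simp [Ty.dflt])) ?_ (by rintro _ _ rfl rfl; rfl)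
      refine (Runs.tab (ℓ := 1) (Q := fun _ a => a = v) (u := fun _ => 1)
        (Runs.of_flat rfl le_rfl (by omega) (by simp [m1])) (fun _ _ =>
          Runs.of_flat rfl le_rfl (by omega) (by simp)) (by simp)).imp ?_
      rintro l ⟨h1, h2⟩
      exact ext_getD (d := 0) h1 fun j hj => by
        obtain rfl : j = 0 := by omega
        exact h2 0 one_pos
    · rintro l ⟨h1, h2⟩
      exact ⟨h1, fun v hv => by rw [pow_zero]; exact h2 v hv⟩
  · rintro i hi l ⟨h1, h2⟩
    have hik : 2 ^ (i + 1) ≤ 2 ^ k := Nat.pow_le_pow_right two_pos hi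
    have hi1 := Nat.one_le_two_pow (n := i)
    have hi2 : 2 ^ (i + 1) = 2 ^ i + 2 ^ i := by rw [pow_succ]; omega
    refine (Runs.tab (ℓ := f.length) (Q := fun v a => a =
        ((fun u => f.getD u 0)^[2 ^ (i + 1)] v,
          (List.range (2 ^ (i + 1))).map fun j => (fun u => f.getD u 0)^[j] v))
      (u := fun _ => 2 ^ (i + 1) + 1)
      (Runs.of_flat rfl (by omega) le_rfl (by simp [h1, hlen])) ?_ (by simp)).imp ?_
    case refine_2 => exact fun _ h => ⟨h.1, h.2⟩
    intro v hv
    have hv' := hit (2 ^ i) v hv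
    refine Runs.letIn (Q := fun a : ℕ × List ℕ => a = ((fun u => f.getD u 0)^[2 ^ i] v,
      (List.range (2 ^ i)).map fun j => (fun u => f.getD u 0)^[j] v))
      (Runs.of_flat rfl (by omega) le_rfl (h2 v hv)) ?_
    · rintro _ rfl
      refine Runs.letIn (Q := fun a : ℕ × List ℕ => a =
        ((fun u => f.getD u 0)^[2 ^ i] ((fun u => f.getD u 0)^[2 ^ i] v), (List.range (2 ^ i)).map
          fun j => (fun u => f.getD u 0)^[j] ((fun u => f.getD u 0)^[2 ^ i] v)))
        (Runs.of_flat rfl (by omega) le_rfl (h2 _ hv')) ?_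
      · rintro _ rfl
        refine Runs.pair
          (Q₁ := fun a => a = (fun u => f.getD u 0)^[2 ^ i] ((fun u => f.getD u 0)^[2 ^ i] v))
          (Q₂ := fun a => a = (List.range (2 ^ i)).map (fun j => (fun u => f.getD u 0)^[j] v) ++
            (List.range (2 ^ i)).map
              fun j => (fun u => f.getD u 0)^[j] ((fun u => f.getD u 0)^[2 ^ i] v))
          (Runs.of_flat rfl (by omega) le_rfl (by simp)) ?_ ?_
        · refine Runs.call2 (Q₁ := fun a => a = (List.range (2 ^ i)).map
              (fun j => (fun u => f.getD u 0)^[j] v))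
            (Q₂ := fun a => a = (List.range (2 ^ i)).map
              fun j => (fun u => f.getD u 0)^[j] ((fun u => f.getD u 0)^[2 ^ i] v))
            (Runs.of_flat rfl (by omega) le_rfl (by simp))
            (Runs.of_flat rfl (by omega) le_rfl (by simp)) ?_
          rintro _ _ rfl rfl
          refine (appendP_runs (a := .word) ?_).mono (fun _ h => h) ?_ le_rfl
          · simp only [List.length_map, List.length_range]; omega
          · simp only [List.length_map, List.length_range]; omega
        · rintro _ _ rfl rfl
          rw [hi2, Function.iterate_add_apply, List.range_add, List.map_append, List.map_map]
          congr 3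
          funext j
          simp only [Function.comp, ← Function.iterate_add_apply]
          rw [add_comm]
  · exact (hU k).trans (by omega)
  · simp

/-! ### Halving a set of vertices without many pairs in one part -/

/-- The vertex at position `i` of the set with index `P`. -/
def vtx (S : List (ℕ × List ℕ)) (P i : ℕ) : ℕ := (S.getD P (0, [])).2.getD i 0

/-- The flag of the set with index `P`; the set is alive if this is not zero. -/
def flg (S : List (ℕ × List ℕ)) (P : ℕ) : ℕ := (S.getD P (0, [])).1

/-- The number of ordered pairs of positions of alive sets whose vertices are both in `T` and
satisfy the relation `b`. -/
def pairCount (S : List (ℕ × List ℕ)) (H : ℕ) (T : List ℕ) (b : ℕ → ℕ → Bool) : ℕ :=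
  ∑ P ∈ Finset.range S.length, ∑ i ∈ Finset.range H, ∑ j ∈ Finset.range H,
    if flg S P ≠ 0 ∧ T.getD (vtx S P i) 0 ≠ 0 ∧ T.getD (vtx S P j) 0 ≠ 0 ∧
      b (vtx S P i) (vtx S P j) = true then 1 else 0

/-- The number of positions of alive sets whose vertices are in `T`. -/
def linCount (S : List (ℕ × List ℕ)) (H : ℕ) (T : List ℕ) : ℕ :=
  ∑ P ∈ Finset.range S.length, ∑ i ∈ Finset.range H,
    if flg S P ≠ 0 ∧ T.getD (vtx S P i) 0 ≠ 0 then 1 else 0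

/-- The number of vertices in `T`. -/
def suppCount (T : List ℕ) : ℕ :=
  ∑ v ∈ Finset.range T.length, if T.getD v 0 ≠ 0 then 1 else 0

/-- The number of alive sets. -/
def liveCount (S : List (ℕ × List ℕ)) : ℕ :=
  ∑ P ∈ Finset.range S.length, if flg S P ≠ 0 then 1 else 0

/-- Different vertices. -/
def neB (u v : ℕ) : Bool := !(u == v)

/-- Different vertices in the same block of length `p`. -/
def blockB (p u v : ℕ) : Bool := !(u == v) && (u / p == v / p)

/-- Different vertices in the same block of length `p` on the same side of the partition `g`. -/
def agreeB (g : List ℕ) (p u v : ℕ) : Bool := blockB p u v && (g.getD u 0 == g.getD v 0)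

/-- Vertices on the same side of `g` in different blocks of length `p` that form one block of length
`2 * p`. -/
def newAgreeB (g : List ℕ) (p u v : ℕ) : Bool :=
  u / (2 * p) == v / (2 * p) && !(u / p == v / p) && (g.getD u 0 == g.getD v 0)

/-- Vertices on different sides of `g` in different blocks of length `p` that form one block of
length `2 * p`. -/
def newDisagreeB (g : List ℕ) (p u v : ℕ) : Bool :=
  u / (2 * p) == v / (2 * p) && !(u / p == v / p) && !(g.getD u 0 == g.getD v 0)

section Counting

variable {S : List (ℕ × List ℕ)} {H n p : ℕ} {T g g' : List ℕ}

theorem pairCount_le (b : ℕ → ℕ → Bool) : pairCount S H T b ≤ S.length * (H * H) := by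
  have : ∀ P ∈ Finset.range S.length, (∑ i ∈ Finset.range H, ∑ j ∈ Finset.range H,
      if flg S P ≠ 0 ∧ T.getD (vtx S P i) 0 ≠ 0 ∧ T.getD (vtx S P j) 0 ≠ 0 ∧
      b (vtx S P i) (vtx S P j) = true then 1 else 0) ≤ H * H := by
    intro P _
    refine (Finset.sum_le_card_nsmul _ _ H fun i _ => ?_).trans (by simp)
    refine (Finset.sum_le_card_nsmul _ _ 1 fun j _ => ?_).trans (by simp)
    split_ifs <;> simp
  exact (Finset.sum_le_card_nsmul _ _ _ this).trans (by simp)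

theorem linCount_le : linCount S H T ≤ S.length * H := by
  have : ∀ P ∈ Finset.range S.length, (∑ i ∈ Finset.range H,
      if flg S P ≠ 0 ∧ T.getD (vtx S P i) 0 ≠ 0 then 1 else 0) ≤ H := by
    intro P _
    refine (Finset.sum_le_card_nsmul _ _ 1 fun j _ => ?_).trans (by simp)
    split_ifs <;> simp
  exact (Finset.sum_le_card_nsmul _ _ _ this).trans (by simp)

theorem suppCount_le : suppCount T ≤ T.length := by
  refine (Finset.sum_le_card_nsmul _ _ 1 fun j _ => ?_).trans (by simp)
  split_ifs <;> simp

theorem liveCount_le : liveCount S ≤ S.length := by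
  refine (Finset.sum_le_card_nsmul _ _ 1 fun j _ => ?_).trans (by simp)
  split_ifs <;> simp

/-- Linear relations between indicator functions carry over to the numbers of pairs. -/
theorem pairCount_add {b₁ b₂ b₃ : ℕ → ℕ → Bool}
    (h : ∀ u v, (b₁ u v).toNat = (b₂ u v).toNat + (b₃ u v).toNat) :
    pairCount S H T b₁ = pairCount S H T b₂ + pairCount S H T b₃ := by
  simp only [pairCount, ← Finset.sum_add_distrib]
  refine Finset.sum_congr rfl fun P _ => Finset.sum_congr rfl fun i _ =>
    Finset.sum_congr rfl fun j _ => ?_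
  have := h (vtx S P i) (vtx S P j)
  by_cases hc : flg S P ≠ 0 ∧ T.getD (vtx S P i) 0 ≠ 0 ∧ T.getD (vtx S P j) 0 ≠ 0
  · simp only [hc.1, hc.2.1, hc.2.2, ne_eq, not_false_eq_true, true_and]
    cases h1 : b₁ (vtx S P i) (vtx S P j) <;> cases h2 : b₂ (vtx S P i) (vtx S P j) <;>
      cases h3 : b₃ (vtx S P i) (vtx S P j) <;> simp_all
  · rw [if_neg (by tauto), if_neg (by tauto), if_neg (by tauto)]

/-- Merging neighbouring blocks, with one half of each merged block moved to the other side if that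
makes fewer pairs agree: at most half of all pairs in one block agree. -/
theorem agree_step (hg : ∀ v, g.getD v 0 < 2)
    (ih : 2 * pairCount S H T (agreeB g p) ≤ pairCount S H T (blockB p))
    (hS : ∀ P < S.length, ∀ i < H, vtx S P i < n)
    (hg' : ∀ v < n, g'.getD v 0 =
      if pairCount S H T (newDisagreeB g p) < pairCount S H T (newAgreeB g p) then
        (g.getD v 0 + v / p) % 2 else g.getD v 0) :
    2 * pairCount S H T (agreeB g' (2 * p)) ≤ pairCount S H T (blockB (2 * p)) := by
  have key : ∀ u v, u / (2 * p) = u / p / 2 ∧ v / (2 * p) = v / p / 2 := by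
    intro u v
    rw [mul_comm, Nat.div_div_eq_div_mul, Nat.div_div_eq_div_mul]
    exact ⟨rfl, rfl⟩
  -- the pairs in merged blocks are old or new, and the new ones agree or disagree
  have h1 : pairCount S H T (blockB (2 * p)) = pairCount S H T (blockB p) +
      pairCount S H T fun u v => u / (2 * p) == v / (2 * p) && !(u / p == v / p) := by
    refine pairCount_add fun u v => ?_
    obtain ⟨k1, k2⟩ := key u v
    simp only [blockB, k1, k2]
    by_cases h : u = v
    · subst h; simp
    · by_cases h' : u / p = v / p <;> simp [h, h', Bool.beq_eq_decide_eq]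
  have h2 : (pairCount S H T fun u v => u / (2 * p) == v / (2 * p) && !(u / p == v / p)) =
      pairCount S H T (newAgreeB g p) + pairCount S H T (newDisagreeB g p) := by
    refine pairCount_add fun u v => ?_
    simp only [newAgreeB, newDisagreeB]
    cases (u / (2 * p) == v / (2 * p) && !(u / p == v / p)) <;>
      cases (g.getD u 0 == g.getD v 0) <;> rfl
  -- exchanging the sides in the odd blocks does not change whether old pairs agree, and it
  -- exchanges the new pairs that agree and those that disagree
  have h3 : pairCount S H T (agreeB g' (2 * p)) = pairCount S H T (agreeB g p) +
      if pairCount S H T (newDisagreeB g p) < pairCount S H T (newAgreeB g p) then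
        pairCount S H T (newDisagreeB g p) else pairCount S H T (newAgreeB g p) := by
    have hsum : ∀ b₁ b₂ b₃ : ℕ → ℕ → Bool, (∀ u < n, ∀ v < n,
        (b₁ u v).toNat = (b₂ u v).toNat + (b₃ u v).toNat) →
        pairCount S H T b₁ = pairCount S H T b₂ + pairCount S H T b₃ := by
      intro b₁ b₂ b₃ hb
      have hr : ∀ b : ℕ → ℕ → Bool, pairCount S H T b =
          pairCount S H T fun u v => decide (u < n) && decide (v < n) && b u v := by
        intro b
        refine Finset.sum_congr rfl fun P hP => Finset.sum_congr rfl fun i hi =>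
          Finset.sum_congr rfl fun j hj => ?_
        simp [hS P (Finset.mem_range.1 hP) i (Finset.mem_range.1 hi),
          hS P (Finset.mem_range.1 hP) j (Finset.mem_range.1 hj)]
      rw [hr b₁, hr b₂, hr b₃]
      refine pairCount_add fun u v => ?_
      by_cases hu : u < n <;> by_cases hv : v < n <;> simp [hu, hv]
      exact hb u hu v hv
    split_ifs at hg' ⊢ with hlt
    · -- if `u / p ≠ v / p` but `u / p / 2 = v / p / 2`, then exactly one of `u / p`, `v / p` is odd
      refine hsum _ _ _ fun u hu v hv => ?_
      obtain ⟨k1, k2⟩ := key u v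
      have gu := hg u
      have gv := hg v
      simp only [agreeB, blockB, newDisagreeB, hg' u hu, hg' v hv, k1, k2]
      by_cases h : u = v
      · subst h; simp
      · generalize u / p = x at *
        generalize v / p = y at *
        by_cases h4 : x = y
        · subst h4
          have : ((g.getD u 0 + x) % 2 = (g.getD v 0 + x) % 2) ↔ g.getD u 0 = g.getD v 0 := by
            omega
          simp [h, Bool.beq_eq_decide_eq, this, -List.getD_eq_getElem?_getD]
        · by_cases h5 : x / 2 = y / 2
          · have : ((g.getD u 0 + x) % 2 = (g.getD v 0 + y) % 2) ↔ ¬ g.getD u 0 = g.getD v 0 := by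
              omega
            simp [h, h4, h5, Bool.beq_eq_decide_eq, this, -List.getD_eq_getElem?_getD]
          · simp [h, h4, h5, Bool.beq_eq_decide_eq]
    · refine hsum _ _ _ fun u hu v hv => ?_
      obtain ⟨k1, k2⟩ := key u v
      simp only [agreeB, blockB, newAgreeB, hg' u hu, hg' v hv, k1, k2]
      by_cases h : u = v
      · subst h; simp
      · by_cases h4 : u / p = v / p <;>
          simp [h, h4, Bool.beq_eq_decide_eq, -List.getD_eq_getElem?_getD]
  rw [h1, h2, h3]
  split_ifs <;> omega

theorem linCount_split {T₀ T₁ : List ℕ} (hg : ∀ v, g.getD v 0 < 2)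
    (hS : ∀ P < S.length, ∀ i < H, vtx S P i < n)
    (h₀ : ∀ v < n, T₀.getD v 0 ≠ 0 ↔ T.getD v 0 ≠ 0 ∧ g.getD v 0 = 0)
    (h₁ : ∀ v < n, T₁.getD v 0 ≠ 0 ↔ T.getD v 0 ≠ 0 ∧ g.getD v 0 = 1) :
    linCount S H T = linCount S H T₀ + linCount S H T₁ := by
  simp only [linCount, ← Finset.sum_add_distrib]
  refine Finset.sum_congr rfl fun P hP => Finset.sum_congr rfl fun i hi => ?_
  have hv := hS P (Finset.mem_range.1 hP) i (Finset.mem_range.1 hi)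
  have := hg (vtx S P i)
  simp only [h₀ _ hv, h₁ _ hv]
  by_cases h : g.getD (vtx S P i) 0 = 0
  · simp [h, -List.getD_eq_getElem?_getD]
  · have h' : g.getD (vtx S P i) 0 = 1 := by omega
    simp [h', -List.getD_eq_getElem?_getD]

theorem suppCount_split {T₀ T₁ : List ℕ} (hg : ∀ v, g.getD v 0 < 2)
    (hT : T.length = n) (hT₀ : T₀.length = n) (hT₁ : T₁.length = n)
    (h₀ : ∀ v < n, T₀.getD v 0 ≠ 0 ↔ T.getD v 0 ≠ 0 ∧ g.getD v 0 = 0)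
    (h₁ : ∀ v < n, T₁.getD v 0 ≠ 0 ↔ T.getD v 0 ≠ 0 ∧ g.getD v 0 = 1) :
    suppCount T = suppCount T₀ + suppCount T₁ := by
  simp only [suppCount, hT, hT₀, hT₁, ← Finset.sum_add_distrib]
  refine Finset.sum_congr rfl fun v hv => ?_
  have hv := Finset.mem_range.1 hv
  have := hg v
  simp only [h₀ _ hv, h₁ _ hv]
  by_cases h : g.getD v 0 = 0
  · simp [h, -List.getD_eq_getElem?_getD]
  · have h' : g.getD v 0 = 1 := by omega
    simp [h', -List.getD_eq_getElem?_getD]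

theorem pairCount_split {T₀ T₁ : List ℕ} (hg : ∀ v, g.getD v 0 < 2)
    (hS : ∀ P < S.length, ∀ i < H, vtx S P i < n)
    (h₀ : ∀ v < n, T₀.getD v 0 ≠ 0 ↔ T.getD v 0 ≠ 0 ∧ g.getD v 0 = 0)
    (h₁ : ∀ v < n, T₁.getD v 0 ≠ 0 ↔ T.getD v 0 ≠ 0 ∧ g.getD v 0 = 1) :
    pairCount S H T (fun u v => neB u v && (g.getD u 0 == g.getD v 0)) =
      pairCount S H T₀ neB + pairCount S H T₁ neB := by
  simp only [pairCount, ← Finset.sum_add_distrib]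
  refine Finset.sum_congr rfl fun P hP => Finset.sum_congr rfl fun i hi =>
    Finset.sum_congr rfl fun j hj => ?_
  have hu := hS P (Finset.mem_range.1 hP) i (Finset.mem_range.1 hi)
  have hv := hS P (Finset.mem_range.1 hP) j (Finset.mem_range.1 hj)
  have gu := hg (vtx S P i)
  have gv := hg (vtx S P j)
  simp only [h₀ _ hu, h₁ _ hu, h₀ _ hv, h₁ _ hv, Bool.beq_eq_decide_eq]
  obtain h | h : g.getD (vtx S P i) 0 = 0 ∨ g.getD (vtx S P i) 0 = 1 := by omega
  all_goals
    obtain h' | h' : g.getD (vtx S P j) 0 = 0 ∨ g.getD (vtx S P j) 0 = 1 := by omega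
    all_goals simp [h, h', -List.getD_eq_getElem?_getD]

/-- The potential of a set `T` of vertices with respect to a family of `N` alive sets of size `H`,
for sampling with probability `1 / Q`: up to a factor, a lower bound for the expected number of sets
that are hit by a sample of `T` (by the first two terms of the inclusion-exclusion formula), minus a
penalty for the size of the sample. -/
def pot (S : List (ℕ × List ℕ)) (H N n Q : ℕ) (T : List ℕ) : ℤ :=
  Q * (4 * n * linCount S H T - N * H * suppCount T) - 2 * n * pairCount S H T neB

/-- One of the two halves of a set has at least the relative potential of the set: the first part
of the potential of the set is the sum of those of the halves, and at most half of the pairs are in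
one of the halves. The condition compares the potentials of the halves, with the negative terms
moved to the other side such that it can be evaluated in natural numbers. -/
theorem pot_half {T₀ T₁ : List ℕ} {N Q : ℕ} (hg : ∀ v, g.getD v 0 < 2)
    (hT : T.length = n) (hT₀ : T₀.length = n) (hT₁ : T₁.length = n)
    (hS : ∀ P < S.length, ∀ i < H, vtx S P i < n)
    (h₀ : ∀ v < n, T₀.getD v 0 ≠ 0 ↔ T.getD v 0 ≠ 0 ∧ g.getD v 0 = 0)
    (h₁ : ∀ v < n, T₁.getD v 0 ≠ 0 ↔ T.getD v 0 ≠ 0 ∧ g.getD v 0 = 1)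
    (hp : 2 * pairCount S H T (fun u v => neB u v && (g.getD u 0 == g.getD v 0)) ≤
      pairCount S H T neB) :
    pot S H N n (2 * Q) T ≤ 4 * pot S H N n Q
      (if Q * (4 * n * linCount S H T₀ + N * H * suppCount T₁) + 2 * n * pairCount S H T₁ neB <
        Q * (4 * n * linCount S H T₁ + N * H * suppCount T₀) + 2 * n * pairCount S H T₀ neB
        then T₁ else T₀) := by
  rw [pairCount_split hg hS h₀ h₁] at hp
  have hl := linCount_split hg hS h₀ h₁
  have hs := suppCount_split hg hT hT₀ hT₁ h₀ h₁
  have hp' := Nat.mul_le_mul_left n hp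
  unfold pot
  rw [hl, hs]
  split_ifs with hlt
  · zify at hlt hp' ⊢
    linarith
  · rw [not_lt] at hlt
    zify at hlt hp' ⊢
    linarith

/-- The potential of the set of all vertices, where `Q = H`: each alive set contributes `H`
positions and at most `H ^ 2` pairs. -/
theorem pot_all (hT : T.length = n) (h1 : ∀ v < n, T.getD v 0 ≠ 0)
    (hS : ∀ P < S.length, ∀ i < H, vtx S P i < n) :
    (liveCount S * H * H * n : ℤ) ≤ pot S H (liveCount S) n H T := by
  have hl : linCount S H T = liveCount S * H := by
    rw [linCount, liveCount, Finset.sum_mul]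
    refine Finset.sum_congr rfl fun P hP => ?_
    have : ∀ i ∈ Finset.range H, (if flg S P ≠ 0 ∧ T.getD (vtx S P i) 0 ≠ 0 then 1 else 0) =
        if flg S P ≠ 0 then 1 else 0 := by
      intro i hi
      have := h1 _ (hS P (Finset.mem_range.1 hP) i (Finset.mem_range.1 hi))
      simp [this, -List.getD_eq_getElem?_getD]
    rw [Finset.sum_congr rfl this]
    simp [mul_comm]
  have hs : suppCount T ≤ n := hT ▸ suppCount_le
  have hp : pairCount S H T neB ≤ liveCount S * (H * H) := by
    rw [pairCount, liveCount, Finset.sum_mul]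
    refine Finset.sum_le_sum fun P hP => ?_
    by_cases hf : flg S P = 0
    · simp [hf]
    · simp only [hf, ne_eq, not_false_eq_true, true_and, if_true, one_mul]
      refine (Finset.sum_le_card_nsmul _ _ H fun i _ => ?_).trans (by simp)
      refine (Finset.sum_le_card_nsmul _ _ 1 fun j _ => ?_).trans (by simp)
      split_ifs <;> simp
  have h2 := Nat.mul_le_mul_left (liveCount S * H * H) hs
  have h3 := Nat.mul_le_mul_left n hp
  unfold pot
  rw [hl]
  zify at h2 h3
  push_cast
  linarith

/-- The number of alive sets that meet `T`. -/
def hitCount (S : List (ℕ × List ℕ)) (H : ℕ) (T : List ℕ) : ℕ :=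
  ∑ P ∈ Finset.range S.length,
    if flg S P ≠ 0 ∧ (∑ i ∈ Finset.range H, if T.getD (vtx S P i) 0 ≠ 0 then 1 else 0) ≠ 0
      then 1 else 0

/-- A set with `c` elements in `T` contributes `c` to the number of positions and `c * (c - 1)` to
the number of pairs, and `c - c * (c - 1) / 2 ≤ 1`. -/
theorem linCount_le_hitCount (hnd : ∀ P < S.length, flg S P ≠ 0 → ∀ i < H, ∀ j < H,
      vtx S P i = vtx S P j → i = j) :
    2 * linCount S H T ≤ pairCount S H T neB + 2 * hitCount S H T := by
  simp only [linCount, pairCount, hitCount, Finset.mul_sum, ← Finset.sum_add_distrib]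
  refine Finset.sum_le_sum fun P hP => ?_
  by_cases hf : flg S P = 0
  · simp [hf]
  simp only [hf, ne_eq, not_false_eq_true, true_and]
  set K := (Finset.range H).filter fun i => ¬ T.getD (vtx S P i) 0 = 0 with hK
  have h1 : (∑ i ∈ Finset.range H, if ¬ T.getD (vtx S P i) 0 = 0 then 1 else 0) = K.card := by
    rw [hK, Finset.card_filter]
  have h2 : (∑ i ∈ Finset.range H, ∑ j ∈ Finset.range H,
      if ¬ T.getD (vtx S P i) 0 = 0 ∧ ¬ T.getD (vtx S P j) 0 = 0 ∧
        neB (vtx S P i) (vtx S P j) = true then 1 else 0) = K.card * K.card - K.card := by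
    rw [← Finset.offDiag_card, ← Finset.sum_product', ← Finset.card_filter]
    congr 1
    ext ⟨i, j⟩
    simp only [Finset.mem_filter, Finset.mem_product, Finset.mem_range, Finset.mem_offDiag, hK]
    constructor
    · rintro ⟨⟨hi, hj⟩, h3, h4, h5⟩
      refine ⟨⟨hi, h3⟩, ⟨hj, h4⟩, ?_⟩
      rintro rfl
      simp [neB] at h5
    · rintro ⟨⟨hi, h3⟩, ⟨hj, h4⟩, h5⟩
      refine ⟨⟨hi, hj⟩, h3, h4, ?_⟩
      have : vtx S P i ≠ vtx S P j := fun h => h5 (hnd P (Finset.mem_range.1 hP) hf i hi j hj h)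
      simpa [neB] using this
  rw [← Finset.mul_sum, h1, h2]
  -- `2 * c ≤ c * (c - 1)` for `c ≥ 3`, and the set is hit for `c = 1, 2`
  rcases Nat.lt_or_ge K.card 3 with h | h
  · interval_cases K.card <;> simp
  · have := Nat.mul_le_mul_right K.card h
    split_ifs <;> omega

end Counting

/-! ### Programs that count -/

/-- The sum of the words that are computed by `e` for the indices below `k`. -/
def sumTab {Γ : List Ty} (k : Prog Γ .word) (e : Prog (.word :: Γ) .word) : Prog Γ .word :=
  call1 sumP (.tab k e)

theorem sumTab_runs {w : ℕ} {Γ : List Ty} {ρ : Env Γ} {k : Prog Γ .word}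
    {e : Prog (.word :: Γ) .word} {ℓ : ℕ} {f u : ℕ → ℕ} {U D : ℕ}
    (hk : Runs w k ρ (· = ℓ) U D) (he : ∀ i < ℓ, Runs w e (i, ρ) (· = f i) (u i) D)
    (hU : ∑ i ∈ Finset.range ℓ, u i ≤ U) (hU' : 4 * ℓ + 1 ≤ U) (hD : Nat.clog 2 ℓ + 1 ≤ D)
    (hℓ : ℓ + 2 < 2 ^ w) (hs : ∑ i ∈ Finset.range ℓ, f i < 2 ^ w) :
    Runs w (sumTab k e) ρ (· = ∑ i ∈ Finset.range ℓ, f i) U D := by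
  refine Runs.call1 (Runs.tab (a := .word) (Q := fun i v => v = f i) hk he hU) ?_
  rintro l ⟨h1, h2⟩
  have hl : l = (List.range ℓ).map f := by
    refine ext_getD (d := 0) (by simp [h1]) fun i hi => ?_
    rw [h1] at hi
    refine (h2 i hi).trans ?_
    rw [List.getD_eq_getElem _ _ (by simpa using hi)]
    simp
  have hsum : l.sum = ∑ i ∈ Finset.range ℓ, f i := by
    rw [hl]; rfl
  rw [← hsum] at hs ⊢
  exact (sumP_runs (by omega) hs).mono (fun _ h => h) (by omega) (by rw [h1]; exact hD)

/-- The type of families of sets of vertices: each set has a flag that tells whether it is alive,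
and the list of its elements. -/
abbrev sTy : Ty := .arr (.prod .word (.arr .word))

/-- The program for `pairCount`, for a relation that is computed by `β` from two vertices, an array
and a word. -/
def pairCountP (β : Prog [.word, .word, .arr .word, .word] .word) :
    Prog [sTy, .arr .word, .arr .word, .word, .word] .word :=
  sumTab (.len v0) (sumTab v5 (sumTab v6
    (.letIn (.get (.snd (.get v3 v2)) v1) (.letIn (.get (.snd (.get v4 v3)) v1)
      (.letIn (call4 β v1 v0 v7 v8)
        (.ite (.fst (.get v6 v5)) (.ite (.get v7 v2) (.ite (.get v7 v1) v0 (.lit 0)) (.lit 0))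
          (.lit 0)))))))

/-- The work of one pass over all pairs of elements of the sets. -/
def passCost (S : List (ℕ × List ℕ)) (H n : ℕ) : ℕ := 16 * (S.length * (H * H) + n)

/-- The assumptions about the sizes of a family of sets and of machine words. All numbers that occur
are less than `8 * n ^ 5 + 64`, and `d` bounds the depth of sums over the family. -/
structure Sizes (w n H d : ℕ) (S : List (ℕ × List ℕ)) : Prop where
  one_le_n : 1 ≤ n
  one_le_H : 1 ≤ H
  H_le : H ≤ n
  length_le : S.length ≤ n * n
  lt_two_pow : 8 * n ^ 5 + 64 < 2 ^ w
  clog_length : Nat.clog 2 S.length ≤ d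
  clog_n : Nat.clog 2 n ≤ d
  vtx_lt : ∀ P < S.length, ∀ i < H, vtx S P i < n

section Programs

variable {w n H d : ℕ} {S : List (ℕ × List ℕ)}

theorem Sizes.clog_H (h : Sizes w n H d S) : Nat.clog 2 H ≤ d :=
  (Nat.clog_mono_right 2 h.H_le).trans h.clog_n

theorem Sizes.w_pos (h : Sizes w n H d S) : 0 < w := by
  rcases Nat.eq_zero_or_pos w with rfl | h'
  · have := h.lt_two_pow; simp at this
  · exact h'

theorem Sizes.pow_le (h : Sizes w n H d S) : n ≤ n ^ 5 ∧ n * n ≤ n ^ 5 ∧ n * n * n ≤ n ^ 5 ∧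
    n * n * n * n ≤ n ^ 5 := by
  have h1 := h.one_le_n
  have h2 : n ^ 5 = n * n * n * n * n := by ring
  have h3 : n ≤ n * n := Nat.le_mul_of_pos_left _ h1
  have h4 : n * n ≤ n * n * n := Nat.le_mul_of_pos_right _ h1
  have h5 : n * n * n ≤ n * n * n * n := Nat.le_mul_of_pos_right _ h1
  have h6 : n * n * n * n ≤ n * n * n * n * n := Nat.le_mul_of_pos_right _ h1
  omega

theorem Sizes.length_mul_le (h : Sizes w n H d S) :
    S.length * H ≤ n * n * n ∧ S.length * (H * H) ≤ n * n * n * n := by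
  have h1 := Nat.mul_le_mul h.length_le h.H_le
  have h2 := Nat.mul_le_mul h1 h.H_le
  exact ⟨h1, by rwa [mul_assoc] at h2⟩

theorem Sizes.cost_le (h : Sizes w n H d S) :
    S.length * ((H + 1) * (4 * H + 1)) + 4 * S.length + 1 ≤ passCost S H n ∧
    n + 4 * n + 1 ≤ passCost S H n := by
  have h1 := h.one_le_H
  have h2 := h.one_le_n
  have h3 : H ≤ H * H := Nat.le_mul_of_pos_left _ h1
  have h4 : (H + 1) * (4 * H + 1) ≤ 10 * (H * H) := by
    have : (H + 1) * (4 * H + 1) = 4 * (H * H) + 5 * H + 1 := by ring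
    omega
  have h5 := Nat.mul_le_mul_left S.length h4
  have h6 : S.length ≤ S.length * (H * H) := Nat.le_mul_of_pos_right _ (by omega)
  have h7 : S.length * (10 * (H * H)) = 10 * (S.length * (H * H)) := by ring
  unfold passCost
  constructor <;> omega

theorem pairCountP_runs (h : Sizes w n H d S)
    {β : Prog [.word, .word, .arr .word, .word] .word} {b : ℕ → ℕ → Bool} {T g : List ℕ} {p : ℕ}
    (hβ : ∀ u < n, ∀ v < n, Runs w β (u, v, g, p, ()) (· = (b u v).toNat) 1 1) :
    Runs w (pairCountP β) (S, T, g, p, H, ()) (· = pairCount S H T b) (passCost S H n)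
      (d + 1) := by
  have c1 := h.cost_le.1
  have c2 := h.length_le
  have c3 := h.pow_le
  have c4 := h.lt_two_pow
  have c5 := h.H_le
  have c6 := h.length_mul_le
  have c7 := h.clog_length
  have c8 := h.clog_H
  have c9 := h.one_le_H
  have hc : pairCount S H T b < 2 ^ w := lt_of_le_of_lt (pairCount_le b) (by omega)
  have hlen : S.length % 2 ^ w = S.length := Nat.mod_eq_of_lt (by omega)
  have hterm : ∀ P i j, (if flg S P ≠ 0 ∧ T.getD (vtx S P i) 0 ≠ 0 ∧ T.getD (vtx S P j) 0 ≠ 0 ∧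
      b (vtx S P i) (vtx S P j) = true then 1 else 0) ≤ 1 := by
    intro P i j; split_ifs <;> simp
  have hin : ∀ P i, (∑ j ∈ Finset.range H, if flg S P ≠ 0 ∧ T.getD (vtx S P i) 0 ≠ 0 ∧
      T.getD (vtx S P j) 0 ≠ 0 ∧ b (vtx S P i) (vtx S P j) = true then 1 else 0) ≤ H :=
    fun P i => (Finset.sum_le_card_nsmul _ _ 1 fun j _ => hterm P i j).trans (by simp)
  have hmid : ∀ P, (∑ i ∈ Finset.range H, ∑ j ∈ Finset.range H,
      if flg S P ≠ 0 ∧ T.getD (vtx S P i) 0 ≠ 0 ∧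
      T.getD (vtx S P j) 0 ≠ 0 ∧ b (vtx S P i) (vtx S P j) = true then 1 else 0) ≤ H * H :=
    fun P => (Finset.sum_le_card_nsmul _ _ H fun j _ => hin P j).trans (by simp)
  have hHH : H * H ≤ n * n := Nat.mul_le_mul c5 c5
  refine sumTab_runs (u := fun _ => (H + 1) * (4 * H + 1)) ?_ ?_ ?_ (by omega) (by omega)
    (by omega) hc
  · exact Runs.of_flat rfl (by omega) (by omega) (by simp [hlen])
  · intro P hP
    have hm : H * (4 * H + 1) + (4 * H + 1) = (H + 1) * (4 * H + 1) := by ring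
    refine sumTab_runs (u := fun _ => 4 * H + 1) ?_ ?_ ?_ (by omega) (by omega) (by omega)
      (lt_of_le_of_lt (hmid P) (by omega))
    · exact Runs.of_flat rfl (by omega) (by omega) (by simp)
    · intro i hi
      refine sumTab_runs (u := fun _ => 1) ?_ ?_ (by simp; omega) (by omega) (by omega) (by omega)
        (lt_of_le_of_lt (hin P i) (by omega))
      · exact Runs.of_flat rfl (by omega) (by omega) (by simp)
      · intro j hj
        refine Runs.letIn (Q := fun u => u = vtx S P i)
          (Runs.of_flat rfl le_rfl (by omega) (by rfl)) ?_
        rintro _ rfl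
        refine Runs.letIn (Q := fun u => u = vtx S P j)
          (Runs.of_flat rfl le_rfl (by omega) (by rfl)) ?_
        rintro _ rfl
        refine Runs.letIn (Q := fun u => u = (b (vtx S P i) (vtx S P j)).toNat) ?_ ?_
        · refine Runs.call4 (Q₁ := fun x => x = vtx S P i) (Q₂ := fun x => x = vtx S P j)
            (Q₃ := fun x => x = g) (Q₄ := fun x => x = p) ?_ ?_ ?_ ?_ ?_
          · exact Runs.of_flat rfl le_rfl (by omega) rfl
          · exact Runs.of_flat rfl le_rfl (by omega) rfl
          · exact Runs.of_flat rfl le_rfl (by omega) rfl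
          · exact Runs.of_flat rfl le_rfl (by omega) rfl
          · rintro _ _ _ _ rfl rfl rfl rfl
            exact (hβ _ (h.vtx_lt P hP i hi) _ (h.vtx_lt P hP j hj)).mono (fun _ h => h) le_rfl
              (by omega)
        · rintro _ rfl
          refine Runs.of_flat rfl le_rfl (by omega) ?_
          simp only [val_ite, val_fst, val_get, val_var, get_zero, get_succ, val_lit,
            Nat.zero_mod]
          change (if flg S P = 0 then 0 else if T.getD (vtx S P i) 0 = 0 then 0 else
            if T.getD (vtx S P j) 0 = 0 then 0 else (b (vtx S P i) (vtx S P j)).toNat) = _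
          cases hb : b (vtx S P i) (vtx S P j) <;> split_ifs <;> simp_all
    · simp only [Finset.sum_const, Finset.card_range, smul_eq_mul]; omega
  · simp only [Finset.sum_const, Finset.card_range, smul_eq_mul]; omega

/-- The program for `newAgreeB`. -/
def newAgreeP : Prog [.word, .word, .arr .word, .word] .word :=
  .ite (.eq (v0 / (.lit 2 * v3)) (v1 / (.lit 2 * v3)))
    (.ite (.eq (v0 / v3) (v1 / v3)) (.lit 0) (.ite (.eq (.get v2 v0) (.get v2 v1)) (.lit 1)
      (.lit 0))) (.lit 0)

/-- The program for `newDisagreeB`. -/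
def newDisagreeP : Prog [.word, .word, .arr .word, .word] .word :=
  .ite (.eq (v0 / (.lit 2 * v3)) (v1 / (.lit 2 * v3)))
    (.ite (.eq (v0 / v3) (v1 / v3)) (.lit 0) (.ite (.eq (.get v2 v0) (.get v2 v1)) (.lit 0)
      (.lit 1))) (.lit 0)

/-- The program for `neB`. -/
def neP : Prog [.word, .word, .arr .word, .word] .word :=
  .ite (.eq v0 v1) (.lit 0) (.lit 1)

theorem newP_runs {u v p : ℕ} {g : List ℕ} (hw : 2 < 2 ^ w) (hu : u < 2 ^ w) (hv : v < 2 ^ w)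
    (hp : 2 * p < 2 ^ w) :
    Runs w newAgreeP (u, v, g, p, ()) (· = (newAgreeB g p u v).toNat) 1 1 ∧
    Runs w newDisagreeP (u, v, g, p, ()) (· = (newDisagreeB g p u v).toNat) 1 1 := by
  have hw0 : 0 < w := by
    rcases Nat.eq_zero_or_pos w with rfl | h'
    · simp at hw
    · exact h'
  have m1 := one_mod hw0
  have m2 : 2 % 2 ^ w = 2 := Nat.mod_eq_of_lt hw
  have m3 : 2 * p % 2 ^ w = 2 * p := Nat.mod_eq_of_lt hp
  have hd : ∀ x q, x < 2 ^ w → x / q % 2 ^ w = x / q := fun x q hx =>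
    Nat.mod_eq_of_lt ((Nat.div_le_self _ _).trans_lt hx)
  constructor
  · refine Runs.of_flat rfl le_rfl le_rfl ?_
    simp only [newAgreeP, val_ite, val_eq, val_div, val_mul, val_lit, val_var, get_zero, get_succ,
      val_get, m1, m2, m3, hd _ _ hu, hd _ _ hv, Nat.zero_mod]
    change _ = (u / (2 * p) == v / (2 * p) && !(u / p == v / p) &&
      (g.getD u Ty.word.dflt == g.getD v Ty.word.dflt)).toNat
    simp only [Bool.beq_eq_decide_eq]
    by_cases h1 : u / (2 * p) = v / (2 * p) <;> by_cases h2 : u / p = v / p <;>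
      by_cases h3 : g.getD u Ty.word.dflt = g.getD v Ty.word.dflt <;>
      simp [h1, h2, h3, m1, -List.getD_eq_getElem?_getD]
  · refine Runs.of_flat rfl le_rfl le_rfl ?_
    simp only [newDisagreeP, val_ite, val_eq, val_div, val_mul, val_lit, val_var, get_zero,
      get_succ, val_get, m1, m2, m3, hd _ _ hu, hd _ _ hv, Nat.zero_mod]
    change _ = (u / (2 * p) == v / (2 * p) && !(u / p == v / p) &&
      !(g.getD u Ty.word.dflt == g.getD v Ty.word.dflt)).toNat
    simp only [Bool.beq_eq_decide_eq]
    by_cases h1 : u / (2 * p) = v / (2 * p) <;> by_cases h2 : u / p = v / p <;>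
      by_cases h3 : g.getD u Ty.word.dflt = g.getD v Ty.word.dflt <;>
      simp [h1, h2, h3, m1, -List.getD_eq_getElem?_getD]

theorem neP_runs {u v p : ℕ} {g : List ℕ} (hw : 0 < w) :
    Runs w neP (u, v, g, p, ()) (· = (neB u v).toNat) 1 1 := by
  have m1 := one_mod hw
  refine Runs.of_flat rfl le_rfl le_rfl ?_
  simp only [neP, val_ite, val_eq, val_lit, val_var, get_zero, get_succ, m1, Nat.zero_mod, neB,
    Bool.beq_eq_decide_eq]
  by_cases h1 : u = v <;> simp [h1, m1]

/-- The program for `linCount`. -/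
def linCountP : Prog [sTy, .arr .word, .word] .word :=
  sumTab (.len v0) (sumTab v3 (.ite (.fst (.get v2 v1))
    (.ite (.get v3 (.get (.snd (.get v2 v1)) v0)) (.lit 1) (.lit 0)) (.lit 0)))

theorem linCountP_runs (h : Sizes w n H d S) {T : List ℕ} :
    Runs w linCountP (S, T, H, ()) (· = linCount S H T) (passCost S H n) (d + 1) := by
  have c1 := h.cost_le.1
  have c2 := h.length_le
  have c3 := h.pow_le
  have c4 := h.lt_two_pow
  have c5 := h.H_le
  have c6 := h.length_mul_le
  have c7 := h.clog_length
  have c8 := h.clog_H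
  have c9 := h.one_le_H
  have m1 := one_mod h.w_pos
  have hlen : S.length % 2 ^ w = S.length := Nat.mod_eq_of_lt (by omega)
  have hin : ∀ P, (∑ i ∈ Finset.range H,
      if flg S P ≠ 0 ∧ T.getD (vtx S P i) 0 ≠ 0 then 1 else 0) ≤ H :=
    fun P => (Finset.sum_le_card_nsmul _ _ 1 fun j _ => by split_ifs <;> simp).trans (by simp)
  refine sumTab_runs (u := fun _ => 4 * H + 1) ?_ ?_ ?_ (by omega) (by omega) (by omega)
    (lt_of_le_of_lt linCount_le (by omega))
  · exact Runs.of_flat rfl (by omega) (by omega) (by simp [hlen])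
  · intro P hP
    refine sumTab_runs (u := fun _ => 1) ?_ ?_ (by simp; omega) (by omega) (by omega) (by omega)
      (lt_of_le_of_lt (hin P) (by omega))
    · exact Runs.of_flat rfl (by omega) (by omega) (by simp)
    · intro i hi
      refine Runs.of_flat rfl le_rfl (by omega) ?_
      simp only [val_ite, val_fst, val_snd, val_get, val_var, get_zero, get_succ, val_lit,
        Nat.zero_mod, m1]
      change (if flg S P = 0 then 0 else if T.getD (vtx S P i) 0 = 0 then 0 else 1) = _
      split_ifs <;> simp_all
  · simp only [Finset.sum_const, Finset.card_range, smul_eq_mul]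
    have := Nat.mul_le_mul_left S.length
      (show 4 * H + 1 ≤ (H + 1) * (4 * H + 1) from Nat.le_mul_of_pos_left _ (by omega))
    omega

/-- The program for `suppCount`. -/
def suppCountP : Prog [.arr .word] .word :=
  sumTab (.len v0) (.ite (.get v1 v0) (.lit 1) (.lit 0))

theorem suppCountP_runs {U D : ℕ} {T : List ℕ} (hw : T.length + 2 < 2 ^ w)
    (hU : 4 * T.length + 1 ≤ U) (hD : Nat.clog 2 T.length + 1 ≤ D) :
    Runs w suppCountP (T, ()) (· = suppCount T) U D := by
  have hw0 : 0 < w := by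
    rcases Nat.eq_zero_or_pos w with rfl | h'
    · simp at hw
    · exact h'
  have m1 := one_mod hw0
  have hlen : T.length % 2 ^ w = T.length := Nat.mod_eq_of_lt (by omega)
  refine sumTab_runs (u := fun _ => 1) ?_ ?_ (by simp; omega) hU hD hw
    (lt_of_le_of_lt suppCount_le (by omega))
  · exact Runs.of_flat rfl (by omega) (by omega) (by simp [hlen])
  · intro v hv
    refine Runs.of_flat rfl le_rfl (by omega) ?_
    simp only [val_ite, val_get, val_var, get_zero, get_succ, val_lit, Nat.zero_mod, m1]
    change (if T.getD v 0 = 0 then 0 else 1) = _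
    split_ifs <;> simp_all

/-- The program for `liveCount`. -/
def liveCountP : Prog [sTy] .word :=
  sumTab (.len v0) (.ite (.fst (.get v1 v0)) (.lit 1) (.lit 0))

theorem liveCountP_runs (h : Sizes w n H d S) :
    Runs w liveCountP (S, ()) (· = liveCount S) (passCost S H n) (d + 1) := by
  have c1 := h.cost_le.1
  have c2 := h.length_le
  have c3 := h.pow_le
  have c4 := h.lt_two_pow
  have c7 := h.clog_length
  have m1 := one_mod h.w_pos
  have hlen : S.length % 2 ^ w = S.length := Nat.mod_eq_of_lt (by omega)
  refine sumTab_runs (u := fun _ => 1) ?_ ?_ (by simp; omega) (by omega) (by omega) (by omega)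
    (lt_of_le_of_lt liveCount_le (by omega))
  · exact Runs.of_flat rfl (by omega) (by omega) (by simp [hlen])
  · intro v hv
    refine Runs.of_flat rfl le_rfl (by omega) ?_
    simp only [val_ite, val_get, val_fst, val_var, get_zero, get_succ, val_lit, Nat.zero_mod, m1]
    change (if flg S v = 0 then 0 else 1) = _
    split_ifs <;> simp_all

end Programs

/-! ### Choosing the better half of a set -/

section Programs

variable {w n H d : ℕ} {S : List (ℕ × List ℕ)}

theorem pairCount_congr {T : List ℕ} {b b' : ℕ → ℕ → Bool}
    (hS : ∀ P < S.length, ∀ i < H, vtx S P i < n) (h : ∀ u < n, ∀ v < n, b u v = b' u v) :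
    pairCount S H T b = pairCount S H T b' := by
  refine Finset.sum_congr rfl fun P hP => Finset.sum_congr rfl fun i hi =>
    Finset.sum_congr rfl fun j hj => ?_
  rw [h _ (hS P (Finset.mem_range.1 hP) i (Finset.mem_range.1 hi)) _
    (hS P (Finset.mem_range.1 hP) j (Finset.mem_range.1 hj))]

/-- `g` is a partition of the vertices into two sides such that at most half of the pairs in `T`
agree. -/
def IsSide (S : List (ℕ × List ℕ)) (H n : ℕ) (T g : List ℕ) : Prop :=
  g.length = n ∧ (∀ v, g.getD v 0 < 2) ∧
    2 * pairCount S H T (fun u v => neB u v && (g.getD u 0 == g.getD v 0)) ≤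
      pairCount S H T neB

/-- The computation of a partition as in `IsSide`: blocks of vertices of length `p = 1, 2, 4, …` are
merged. -/
def sideP : Prog [sTy, .arr .word, .word] (.arr .word) :=
  .letIn (call1 clogP (.len v1)) (.snd (.loop v0 (.pair (.lit 1) (.tab (.len v2) (.lit 0)))
    (.letIn (call5 (pairCountP newAgreeP) v3 v4 (.snd v1) (.fst v1) v5)
      (.letIn (call5 (pairCountP newDisagreeP) v4 v5 (.snd v2) (.fst v2) v6)
        (.pair (.fst v3 * .lit 2) (.tab (.len v6) (.ite (.lt v1 v2)
          ((.get (.snd v4) v0 + v0 / .fst v4) % .lit 2) (.get (.snd v4) v0))))))))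

theorem sideP_runs (h : Sizes w n H d S) {T : List ℕ} (hT : T.length = n) :
    Runs w sideP (S, T, H, ()) (IsSide S H n T)
      ((Nat.clog 2 n + 1) * passCost S H n) ((Nat.clog 2 n + 1) * (d + 1)) := by
  have c1 := h.cost_le.2
  have c2 := h.length_le
  have c3 := h.pow_le
  have c4 := h.lt_two_pow
  have c6 := h.length_mul_le
  have c8 := h.clog_n
  have c9 := h.one_le_n
  have m1 := one_mod h.w_pos
  have m2 : 2 % 2 ^ w = 2 := Nat.mod_eq_of_lt (by omega)
  have hlen : T.length % 2 ^ w = n := by rw [hT]; exact Nat.mod_eq_of_lt (by omega)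
  have hlog : Nat.clog 2 n ≤ n := Nat.clog_le_of_le_pow n.lt_two_pow_self.le
  have hU : passCost S H n ≤ (Nat.clog 2 n + 1) * passCost S H n :=
    Nat.le_mul_of_pos_left _ (by omega)
  have hD : d + 1 ≤ (Nat.clog 2 n + 1) * (d + 1) := Nat.le_mul_of_pos_left _ (by omega)
  refine Runs.letIn (Q := fun L => L = Nat.clog 2 n) ?_ ?_
  · refine Runs.call1 (Q₁ := fun x => x = n) ?_ ?_
    · exact Runs.of_flat rfl (by omega) (by omega) (by simp [hlen])
    · rintro _ rfl
      exact (clogP_runs (by omega)).mono (fun _ h => h) (by omega) (by omega)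
  rintro _ rfl
  refine Runs.snd (Runs.imp (Runs.loop (a := .prod .word (.arr .word)) (ℓ := Nat.clog 2 n)
    (I := fun k (x : ℕ × List ℕ) => x.1 = 2 ^ k ∧ x.2.length = n ∧ (∀ v, x.2.getD v 0 < 2) ∧
      2 * pairCount S H T (agreeB x.2 x.1) ≤ pairCount S H T (blockB x.1))
    (u := fun _ => passCost S H n) (d := fun _ => d + 1) ?_ ?_ ?_ ?_ ?_) ?_)
  · exact Runs.of_flat rfl (by omega) (by omega) rfl
  · refine Runs.pair (Q₁ := fun x => x = 1)
      (Q₂ := fun g : List ℕ => g.length = n ∧ ∀ v, g.getD v 0 < 2) ?_ ?_ ?_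
    · exact Runs.of_flat rfl (by omega) (by omega) (by simp [m1])
    · refine (Runs.tab (a := .word) (ℓ := n) (Q := fun _ x => x = 0) (u := fun _ => 1)
        ?_ ?_ (by simp; omega)).imp ?_
      · exact Runs.of_flat rfl (by omega) (by omega) (by simp [hlen])
      · intro i hi
        exact Runs.of_flat rfl le_rfl (by omega) (by simp)
      · rintro g ⟨h1, h2⟩
        refine ⟨h1, fun v => ?_⟩
        rcases Nat.lt_or_ge v n with hv | hv
        · exact (h2 v hv).trans_lt two_pos
        · rw [List.getD_eq_default _ _ (h1.le.trans hv)]; exact two_pos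
    · rintro _ g rfl ⟨h1, h2⟩
      refine ⟨rfl, h1, h2, ?_⟩
      have : pairCount S H T (agreeB g 1) = 0 := by
        simp only [pairCount]
        refine Finset.sum_eq_zero fun P _ => Finset.sum_eq_zero fun i _ =>
          Finset.sum_eq_zero fun j _ => if_neg ?_
        simp [agreeB, blockB]
      dsimp only
      omega
  · rintro k hk (⟨p, g⟩ : ℕ × List ℕ) ⟨hp, hg1, hg2, hg3⟩
    dsimp only at hp hg1 hg2 hg3
    have hpn : p < n := by
      rw [hp]; exact (Nat.lt_clog_iff_pow_lt one_lt_two).1 hk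
    have m3 : p * 2 % 2 ^ w = p * 2 := Nat.mod_eq_of_lt (by omega)
    have hβ : ∀ u < n, ∀ v < n,
        Runs w newAgreeP (u, v, g, p, ()) (· = (newAgreeB g p u v).toNat) 1 1 ∧
        Runs w newDisagreeP (u, v, g, p, ()) (· = (newDisagreeB g p u v).toNat) 1 1 :=
      fun u hu v hv => newP_runs (by omega) (by omega) (by omega) (by omega)
    refine Runs.letIn (Q := fun x => x = pairCount S H T (newAgreeB g p)) ?_ ?_
    · refine Runs.call5 (Q₁ := fun x => x = S) (Q₂ := fun x => x = T) (Q₃ := fun x => x = g)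
        (Q₄ := fun x => x = p) (Q₅ := fun x => x = H) ?_ ?_ ?_ ?_ ?_ ?_
      · exact Runs.of_flat rfl (by omega) (by omega) rfl
      · exact Runs.of_flat rfl (by omega) (by omega) rfl
      · exact Runs.of_flat rfl (by omega) (by omega) rfl
      · exact Runs.of_flat rfl (by omega) (by omega) rfl
      · exact Runs.of_flat rfl (by omega) (by omega) rfl
      · rintro _ _ _ _ _ rfl rfl rfl rfl rfl
        exact pairCountP_runs h fun u hu v hv => (hβ u hu v hv).1
    rintro _ rfl
    refine Runs.letIn (Q := fun x => x = pairCount S H T (newDisagreeB g p)) ?_ ?_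
    · refine Runs.call5 (Q₁ := fun x => x = S) (Q₂ := fun x => x = T) (Q₃ := fun x => x = g)
        (Q₄ := fun x => x = p) (Q₅ := fun x => x = H) ?_ ?_ ?_ ?_ ?_ ?_
      · exact Runs.of_flat rfl (by omega) (by omega) rfl
      · exact Runs.of_flat rfl (by omega) (by omega) rfl
      · exact Runs.of_flat rfl (by omega) (by omega) rfl
      · exact Runs.of_flat rfl (by omega) (by omega) rfl
      · exact Runs.of_flat rfl (by omega) (by omega) rfl
      · rintro _ _ _ _ _ rfl rfl rfl rfl rfl
        exact pairCountP_runs h fun u hu v hv => (hβ u hu v hv).2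
    rintro _ rfl
    refine Runs.pair (Q₁ := fun x => x = p * 2)
      (Q₂ := fun g' : List ℕ => g'.length = n ∧ ∀ v < n, g'.getD v 0 =
        if pairCount S H T (newDisagreeB g p) < pairCount S H T (newAgreeB g p) then
          (g.getD v 0 + v / p) % 2 else g.getD v 0) ?_ ?_ ?_
    · exact Runs.of_flat rfl (by omega) (by omega) (by simp [m2, m3])
    · refine (Runs.tab (a := .word) (ℓ := n) (Q := fun v x => x =
          if pairCount S H T (newDisagreeB g p) < pairCount S H T (newAgreeB g p) then
            (g.getD v 0 + v / p) % 2 else g.getD v 0) (u := fun _ => 1)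
        ?_ ?_ (by simp; omega)).imp fun _ h => ⟨h.1, h.2⟩
      · exact Runs.of_flat rfl (by omega) (by omega) (by simp [hlen])
      · intro v hv
        refine Runs.of_flat rfl le_rfl (by omega) ?_
        have hgv := hg2 v
        have hdv := Nat.div_le_self v p
        have m4 : v / p % 2 ^ w = v / p := Nat.mod_eq_of_lt (by omega)
        have m5 : (g.getD v 0 + v / p) % 2 ^ w = g.getD v 0 + v / p :=
          Nat.mod_eq_of_lt (by omega)
        have m6 : (g.getD v 0 + v / p) % 2 % 2 ^ w = (g.getD v 0 + v / p) % 2 :=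
          Nat.mod_eq_of_lt (by omega)
        simp only [val_ite, val_lt, val_mod, val_add, val_div, val_get, val_fst, val_snd, val_var,
          get_zero, get_succ, val_lit, m2, m4]
        rw [show g.getD v Ty.word.dflt = g.getD v 0 from rfl, m5, m6]
        by_cases hlt : pairCount S H T (newDisagreeB g p) < pairCount S H T (newAgreeB g p) <;>
          simp [hlt, m1]
    · rintro _ g' rfl ⟨h1, h2⟩
      refine ⟨by rw [pow_succ, hp], h1, fun v => ?_, ?_⟩
      · rcases Nat.lt_or_ge v n with hv | hv
        · have := hg2 v
          dsimp only
          rw [h2 v hv]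
          split_ifs <;> omega
        · dsimp only
          rw [List.getD_eq_default _ _ (h1.le.trans hv)]; exact two_pos
      · dsimp only
        rw [mul_comm p 2]
        exact agree_step hg2 hg3 h.vtx_lt h2
  · simp only [Finset.sum_const, Finset.card_range, smul_eq_mul, Nat.add_mul]; omega
  · simp only [Finset.sum_const, Finset.card_range, smul_eq_mul, Nat.add_mul]; omega
  · rintro (⟨p, g⟩ : ℕ × List ℕ) ⟨hp, hg1, hg2, hg3⟩
    refine ⟨hg1, hg2, ?_⟩
    dsimp only at hp hg3 ⊢
    -- in the end all vertices are in one block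
    have hnp : n ≤ p := by rw [hp]; exact Nat.le_pow_clog one_lt_two n
    have hdp : ∀ u < n, u / p = 0 := fun u hu => Nat.div_eq_of_lt (by omega)
    have e₁ : pairCount S H T (fun u v => neB u v && (g.getD u 0 == g.getD v 0)) =
        pairCount S H T (agreeB g p) := pairCount_congr h.vtx_lt fun u hu v hv => by
      simp [neB, agreeB, blockB, hdp u hu, hdp v hv]
    have e₂ : pairCount S H T neB = pairCount S H T (blockB p) :=
      pairCount_congr h.vtx_lt fun u hu v hv => by simp [neB, blockB, hdp u hu, hdp v hv]
    rw [e₁, e₂]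
    exact hg3

/-- The comparison value of the two halves of a set; the fourth argument consists of the inverse of
the sampling probability and the number of alive sets. -/
def scoreP : Prog [sTy, .arr .word, .arr .word, .prod .word .word, .word] .word :=
  .letIn (call3 linCountP v0 v1 v4) (.letIn (call1 suppCountP v3)
    (.letIn (call5 (pairCountP neP) v2 v4 v4 (.lit 0) v6)
      (.fst v6 * (.lit 4 * .len v4 * v2 + .snd v6 * v7 * v1) + .lit 2 * .len v4 * v0)))

theorem scoreP_runs (h : Sizes w n H d S) {T₀ T₁ : List ℕ} {Q N : ℕ} (h₀ : T₀.length = n)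
    (h₁ : T₁.length = n) (hQ : Q ≤ n) (hN : N ≤ n * n) :
    Runs w scoreP (S, T₀, T₁, (Q, N), H, ())
      (· = Q * (4 * n * linCount S H T₀ + N * H * suppCount T₁) + 2 * n * pairCount S H T₁ neB)
      (passCost S H n) (d + 1) := by
  have c1 := h.cost_le.2
  have c2 := h.length_le
  have c3 := h.pow_le
  have c4 := h.lt_two_pow
  have c6 := h.length_mul_le
  have c8 := h.clog_n
  have c9 := h.one_le_n
  refine Runs.letIn (Q := fun x => x = linCount S H T₀) ?_ ?_
  · refine Runs.call3 (Q₁ := fun x => x = S) (Q₂ := fun x => x = T₀) (Q₃ := fun x => x = H)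
      ?_ ?_ ?_ ?_
    · exact Runs.of_flat rfl (by omega) (by omega) rfl
    · exact Runs.of_flat rfl (by omega) (by omega) rfl
    · exact Runs.of_flat rfl (by omega) (by omega) rfl
    · rintro _ _ _ rfl rfl rfl
      exact linCountP_runs h
  rintro _ rfl
  refine Runs.letIn (Q := fun x => x = suppCount T₁) ?_ ?_
  · refine Runs.call1 (Q₁ := fun x => x = T₁) ?_ ?_
    · exact Runs.of_flat rfl (by omega) (by omega) rfl
    · rintro _ rfl
      exact suppCountP_runs (by omega) (by omega) (by rw [h₁]; omega)
  rintro _ rfl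
  refine Runs.letIn (Q := fun x => x = pairCount S H T₁ neB) ?_ ?_
  · refine Runs.call5 (Q₁ := fun x => x = S) (Q₂ := fun x => x = T₁) (Q₃ := fun x => x = T₁)
      (Q₄ := fun x => x = 0) (Q₅ := fun x => x = H) ?_ ?_ ?_ ?_ ?_ ?_
    · exact Runs.of_flat rfl (by omega) (by omega) rfl
    · exact Runs.of_flat rfl (by omega) (by omega) rfl
    · exact Runs.of_flat rfl (by omega) (by omega) rfl
    · exact Runs.of_flat rfl (by omega) (by omega) (by simp)
    · exact Runs.of_flat rfl (by omega) (by omega) rfl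
    · rintro _ _ _ _ _ rfl rfl rfl rfl rfl
      exact pairCountP_runs h fun u hu v hv => neP_runs h.w_pos
  rintro _ rfl
  refine Runs.of_flat rfl (by omega) (by omega) ?_
  have hl : linCount S H T₀ ≤ n * n * n := linCount_le.trans c6.1
  have hs : suppCount T₁ ≤ n := h₁ ▸ suppCount_le
  have hp : pairCount S H T₁ neB ≤ n * n * n * n := (pairCount_le _).trans c6.2
  generalize linCount S H T₀ = l at *
  generalize suppCount T₁ = s at *
  generalize pairCount S H T₁ neB = q at *
  have e1 : 4 * n * l ≤ 4 * (n * n * n * n) := by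
    calc 4 * n * l ≤ 4 * n * (n * n * n) := Nat.mul_le_mul_left _ hl
      _ = _ := by ring
  have e2 : N * H ≤ n * n * n := Nat.mul_le_mul hN h.H_le
  have e3 : N * H * s ≤ n * n * n * n := Nat.mul_le_mul e2 hs
  have e4 : Q * (4 * n * l + N * H * s) ≤ 5 * n ^ 5 := by
    calc Q * (4 * n * l + N * H * s) ≤ n * (4 * (n * n * n * n) + n * n * n * n) :=
          Nat.mul_le_mul hQ (Nat.add_le_add e1 e3)
      _ = _ := by ring
  have e5 : 2 * n * q ≤ 2 * n ^ 5 := by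
    calc 2 * n * q ≤ 2 * n * (n * n * n * n) := Nat.mul_le_mul_left _ hp
      _ = _ := by ring
  have m2 : 2 % 2 ^ w = 2 := Nat.mod_eq_of_lt (by omega)
  have m4 : 4 % 2 ^ w = 4 := Nat.mod_eq_of_lt (by omega)
  have k1 : n % 2 ^ w = n := Nat.mod_eq_of_lt (by omega)
  have k2 : 4 * n % 2 ^ w = 4 * n := Nat.mod_eq_of_lt (by omega)
  have k3 : 4 * n * l % 2 ^ w = 4 * n * l := Nat.mod_eq_of_lt (by omega)
  have k4 : N * H % 2 ^ w = N * H := Nat.mod_eq_of_lt (by omega)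
  have k5 : N * H * s % 2 ^ w = N * H * s := Nat.mod_eq_of_lt (by omega)
  have k6 : (4 * n * l + N * H * s) % 2 ^ w = 4 * n * l + N * H * s :=
    Nat.mod_eq_of_lt (by omega)
  have k7 : Q * (4 * n * l + N * H * s) % 2 ^ w = Q * (4 * n * l + N * H * s) :=
    Nat.mod_eq_of_lt (by omega)
  have k8 : 2 * n % 2 ^ w = 2 * n := Nat.mod_eq_of_lt (by omega)
  have k9 : 2 * n * q % 2 ^ w = 2 * n * q := Nat.mod_eq_of_lt (by omega)
  have k10 : (Q * (4 * n * l + N * H * s) + 2 * n * q) % 2 ^ w =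
    Q * (4 * n * l + N * H * s) + 2 * n * q := Nat.mod_eq_of_lt (by omega)
  simp only [val_add, val_mul, val_fst, val_snd, val_var, get_zero, get_succ, val_len, val_lit,
    h₀, m2, m4, k1, k2, k3, k4, k5, k6, k7, k8, k9, k10]

/-- The half of a set that has the larger potential; the arguments after the set are the inverse of
the sampling probability, the number of alive sets and their size. -/
def halfP : Prog [sTy, .arr .word, .word, .word, .word] (.arr .word) :=
  .letIn (call3 sideP v0 v1 v4)
    (.letIn (.tab (.len v2) (.ite (.get v3 v0) (.ite (.get v1 v0) (.lit 0) (.lit 1)) (.lit 0)))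
      (.letIn (.tab (.len v3) (.ite (.get v4 v0) (.ite (.get v2 v0) (.lit 1) (.lit 0)) (.lit 0)))
        (.letIn (call5 scoreP v3 v1 v0 (.pair v5 v6) v7)
          (.letIn (call5 scoreP v4 v1 v2 (.pair v6 v7) v8)
            (.ite (.lt v1 v0) v2 v3)))))

theorem halfP_runs (h : Sizes w n H d S) {T : List ℕ} {Q N : ℕ} (hT : T.length = n) (hQ : Q ≤ n)
    (hN : N ≤ n * n) :
    Runs w halfP (S, T, Q, N, H, ())
      (fun T' => T'.length = n ∧ pot S H N n (2 * Q) T ≤ 4 * pot S H N n Q T')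
      ((Nat.clog 2 n + 1) * passCost S H n) ((Nat.clog 2 n + 1) * (d + 1)) := by
  have c1 := h.cost_le.2
  have c3 := h.pow_le
  have c4 := h.lt_two_pow
  have c9 := h.one_le_n
  have m1 := one_mod h.w_pos
  have hlen : T.length % 2 ^ w = n := by rw [hT]; exact Nat.mod_eq_of_lt (by omega)
  have hU : passCost S H n ≤ (Nat.clog 2 n + 1) * passCost S H n :=
    Nat.le_mul_of_pos_left _ (by omega)
  have hD : d + 1 ≤ (Nat.clog 2 n + 1) * (d + 1) := Nat.le_mul_of_pos_left _ (by omega)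
  refine Runs.letIn (Q := IsSide S H n T) ?_ ?_
  · refine Runs.call3 (Q₁ := fun x => x = S) (Q₂ := fun x => x = T) (Q₃ := fun x => x = H)
      ?_ ?_ ?_ ?_
    · exact Runs.of_flat rfl (by omega) (by omega) rfl
    · exact Runs.of_flat rfl (by omega) (by omega) rfl
    · exact Runs.of_flat rfl (by omega) (by omega) rfl
    · rintro _ _ _ rfl rfl rfl
      exact sideP_runs h hT
  rintro (g : List ℕ) ⟨hg1, hg2, hg3⟩
  refine Runs.letIn (Q := fun T₀ : List ℕ => T₀.length = n ∧
    ∀ v < n, T₀.getD v 0 ≠ 0 ↔ T.getD v 0 ≠ 0 ∧ g.getD v 0 = 0) ?_ ?_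
  · refine (Runs.tab (a := .word) (ℓ := n) (Q := fun v x => x ≠ 0 ↔ T.getD v 0 ≠ 0 ∧
      g.getD v 0 = 0) (u := fun _ => 1) ?_ ?_ (by simp; omega)).imp fun _ h => ⟨h.1, h.2⟩
    · exact Runs.of_flat rfl (by omega) (by omega) (by simp [hlen])
    · intro v hv
      refine Runs.of_flat rfl le_rfl (by omega) ?_
      simp only [val_ite, val_get, val_var, get_zero, get_succ, val_lit, Nat.zero_mod, m1]
      change (if T.getD v 0 = 0 then 0 else if g.getD v 0 = 0 then 1 else 0) ≠ 0 ↔ _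
      split_ifs <;> simp_all
  rintro T₀ ⟨h₀, h₀'⟩
  refine Runs.letIn (Q := fun T₁ : List ℕ => T₁.length = n ∧
    ∀ v < n, T₁.getD v 0 ≠ 0 ↔ T.getD v 0 ≠ 0 ∧ g.getD v 0 = 1) ?_ ?_
  · refine (Runs.tab (a := .word) (ℓ := n) (Q := fun v x => x ≠ 0 ↔ T.getD v 0 ≠ 0 ∧
      g.getD v 0 = 1) (u := fun _ => 1) ?_ ?_ (by simp; omega)).imp fun _ h => ⟨h.1, h.2⟩
    · exact Runs.of_flat rfl (by omega) (by omega) (by simp [hlen])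
    · intro v hv
      refine Runs.of_flat rfl le_rfl (by omega) ?_
      have hgv := hg2 v
      have hgv' : g.getD v 0 = 1 ↔ ¬ g.getD v 0 = 0 := by omega
      simp only [val_ite, val_get, val_var, get_zero, get_succ, val_lit, Nat.zero_mod, m1]
      change (if T.getD v 0 = 0 then 0 else if g.getD v 0 = 0 then 0 else 1) ≠ 0 ↔ _
      rw [hgv']
      split_ifs <;> simp_all
  rintro T₁ ⟨h₁, h₁'⟩
  refine Runs.letIn (Q := fun x => x = Q * (4 * n * linCount S H T₀ + N * H * suppCount T₁) +
    2 * n * pairCount S H T₁ neB) ?_ ?_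
  · refine Runs.call5 (Q₁ := fun x => x = S) (Q₂ := fun x => x = T₀) (Q₃ := fun x => x = T₁)
      (Q₄ := fun x : ℕ × ℕ => x = (Q, N)) (Q₅ := fun x => x = H) ?_ ?_ ?_ ?_ ?_ ?_
    · exact Runs.of_flat rfl (by omega) (by omega) rfl
    · exact Runs.of_flat rfl (by omega) (by omega) rfl
    · exact Runs.of_flat rfl (by omega) (by omega) rfl
    · exact Runs.of_flat rfl (by omega) (by omega) rfl
    · exact Runs.of_flat rfl (by omega) (by omega) rfl
    · rintro _ _ _ _ _ rfl rfl rfl rfl rfl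
      exact (scoreP_runs h h₀ h₁ hQ hN).mono (fun _ h => h) hU hD
  rintro _ rfl
  refine Runs.letIn (Q := fun x => x = Q * (4 * n * linCount S H T₁ + N * H * suppCount T₀) +
    2 * n * pairCount S H T₀ neB) ?_ ?_
  · refine Runs.call5 (Q₁ := fun x => x = S) (Q₂ := fun x => x = T₁) (Q₃ := fun x => x = T₀)
      (Q₄ := fun x : ℕ × ℕ => x = (Q, N)) (Q₅ := fun x => x = H) ?_ ?_ ?_ ?_ ?_ ?_
    · exact Runs.of_flat rfl (by omega) (by omega) rfl
    · exact Runs.of_flat rfl (by omega) (by omega) rfl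
    · exact Runs.of_flat rfl (by omega) (by omega) rfl
    · exact Runs.of_flat rfl (by omega) (by omega) rfl
    · exact Runs.of_flat rfl (by omega) (by omega) rfl
    · rintro _ _ _ _ _ rfl rfl rfl rfl rfl
      exact (scoreP_runs h h₁ h₀ hQ hN).mono (fun _ h => h) hU hD
  rintro _ rfl
  refine Runs.of_flat rfl (by omega) (by omega) ?_
  have key := pot_half (Q := Q) (N := N) hg2 hT h₀ h₁ h.vtx_lt h₀' h₁' hg3
  simp only [val_ite, val_lt, val_var, get_zero, get_succ]
  split_ifs at key with hlt
  · simp only [hlt, if_true, m1, one_ne_zero, if_false]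
    exact ⟨h₁, key⟩
  · simp only [hlt, if_false, Nat.zero_mod, if_true]
    exact ⟨h₀, key⟩

end Programs

/-! ### Hitting sets -/

section Programs

variable {w n H d i : ℕ} {S : List (ℕ × List ℕ)}

/-- A set of vertices that hits a quarter of the alive sets, by `i` halvings of the set of all
vertices; the arguments after the family are the size `2 ^ i` of the sets, the number of
vertices and `i`. -/
def sampleP : Prog [sTy, .word, .word, .word] (.arr .word) :=
  .letIn (call1 liveCountP v0)
    (.snd (.loop v4 (.pair v2 (.tab v3 (.lit 1)))
      (.letIn (.fst v1 / .lit 2) (.pair v0 (call5 halfP v4 (.snd v2) v0 v3 v5)))))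

theorem sampleP_runs (h : Sizes w n H d S) (hH : H = 2 ^ i) :
    Runs w sampleP (S, H, n, i, ())
      (fun T => T.length = n ∧ (n * liveCount S : ℤ) ≤ pot S H (liveCount S) n 1 T)
      ((i + 1) * ((Nat.clog 2 n + 1) * passCost S H n))
      ((i + 1) * ((Nat.clog 2 n + 1) * (d + 1))) := by
  have c1 := h.cost_le.2
  have c2 := h.length_le
  have c3 := h.pow_le
  have c4 := h.lt_two_pow
  have c5 := h.H_le
  have c9 := h.one_le_n
  have m1 := one_mod h.w_pos
  have m2 : 2 % 2 ^ w = 2 := Nat.mod_eq_of_lt (by omega)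
  have hN : liveCount S ≤ n * n := liveCount_le.trans c2
  have hU1 : passCost S H n ≤ (Nat.clog 2 n + 1) * passCost S H n :=
    Nat.le_mul_of_pos_left _ (by omega)
  have hD1 : d + 1 ≤ (Nat.clog 2 n + 1) * (d + 1) := Nat.le_mul_of_pos_left _ (by omega)
  have hU : (Nat.clog 2 n + 1) * passCost S H n ≤
      (i + 1) * ((Nat.clog 2 n + 1) * passCost S H n) := Nat.le_mul_of_pos_left _ (by omega)
  have hD : (Nat.clog 2 n + 1) * (d + 1) ≤ (i + 1) * ((Nat.clog 2 n + 1) * (d + 1)) :=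
    Nat.le_mul_of_pos_left _ (by omega)
  refine Runs.letIn (Q := fun x => x = liveCount S) ?_ ?_
  · refine Runs.call1 (Q₁ := fun x => x = S) ?_ ?_
    · exact Runs.of_flat rfl (by omega) (by omega) rfl
    · rintro _ rfl
      exact (liveCountP_runs h).mono (fun _ h => h) (by omega) (by omega)
  rintro _ rfl
  refine Runs.snd (Runs.imp (Runs.loop (a := .prod .word (.arr .word)) (ℓ := i)
    (I := fun t (x : ℕ × List ℕ) => x.1 = 2 ^ (i - t) ∧ x.2.length = n ∧
      (liveCount S * H * H * n : ℤ) ≤ 4 ^ t * pot S H (liveCount S) n x.1 x.2)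
    (u := fun _ => (Nat.clog 2 n + 1) * passCost S H n)
    (d := fun _ => (Nat.clog 2 n + 1) * (d + 1)) ?_ ?_ ?_ ?_ ?_) ?_)
  · exact Runs.of_flat rfl (by omega) (by omega) rfl
  · refine Runs.pair (Q₁ := fun x => x = H)
      (Q₂ := fun T : List ℕ => T.length = n ∧ ∀ v < n, T.getD v 0 ≠ 0) ?_ ?_ ?_
    · exact Runs.of_flat rfl (by omega) (by omega) rfl
    · refine (Runs.tab (a := .word) (ℓ := n) (Q := fun _ x => x ≠ 0) (u := fun _ => 1)
        ?_ ?_ (by simp; omega)).imp fun _ h => ⟨h.1, h.2⟩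
      · exact Runs.of_flat rfl (by omega) (by omega) rfl
      · intro v hv
        exact Runs.of_flat rfl le_rfl (by omega) (by simp [m1])
    · rintro _ T rfl ⟨h1, h2⟩
      refine ⟨by simpa using hH, h1, ?_⟩
      rw [pow_zero, one_mul]
      exact pot_all h1 h2 h.vtx_lt
  · rintro t ht (⟨Q, T⟩ : ℕ × List ℕ) ⟨h1, h2, h3⟩
    dsimp only at h1 h2 h3
    have hpow : 2 ^ (i - t) = 2 * 2 ^ (i - (t + 1)) := by
      rw [← pow_succ']; congr 1; omega
    have hle : 2 ^ (i - (t + 1)) ≤ n :=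
      (Nat.pow_le_pow_right two_pos (by omega)).trans (hH ▸ c5)
    have m3 : Q / 2 % 2 ^ w = 2 ^ (i - (t + 1)) := by
      rw [h1, hpow, Nat.mul_div_cancel_left _ two_pos]
      exact Nat.mod_eq_of_lt (by omega)
    refine Runs.letIn (Q := fun q => q = 2 ^ (i - (t + 1))) ?_ ?_
    · exact Runs.of_flat rfl (by omega) (by omega) (by simp [m2, m3])
    rintro _ rfl
    refine Runs.pair (Q₁ := fun q => q = 2 ^ (i - (t + 1)))
      (Q₂ := fun T' : List ℕ => T'.length = n ∧ pot S H (liveCount S) n (2 * 2 ^ (i - (t + 1))) T ≤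
        4 * pot S H (liveCount S) n (2 ^ (i - (t + 1)) : ℕ) T') ?_ ?_ ?_
    · exact Runs.of_flat rfl (by omega) (by omega) rfl
    · refine Runs.call5 (Q₁ := fun x => x = S) (Q₂ := fun x => x = T)
        (Q₃ := fun x => x = 2 ^ (i - (t + 1))) (Q₄ := fun x => x = liveCount S)
        (Q₅ := fun x => x = H) ?_ ?_ ?_ ?_ ?_ ?_
      · exact Runs.of_flat rfl (by omega) (by omega) rfl
      · exact Runs.of_flat rfl (by omega) (by omega) rfl
      · exact Runs.of_flat rfl (by omega) (by omega) rfl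
      · exact Runs.of_flat rfl (by omega) (by omega) rfl
      · exact Runs.of_flat rfl (by omega) (by omega) rfl
      · rintro _ _ _ _ _ rfl rfl rfl rfl rfl
        exact halfP_runs h h2 hle hN
    · rintro _ T' rfl ⟨h4, h5⟩
      refine ⟨rfl, h4, h3.trans ?_⟩
      dsimp only
      rw [h1, hpow, pow_succ, mul_assoc]
      exact mul_le_mul_of_nonneg_left h5 (by positivity)
  · simp only [Finset.sum_const, Finset.card_range, smul_eq_mul]
    exact Nat.mul_le_mul_right _ (by omega)
  · simp only [Finset.sum_const, Finset.card_range, smul_eq_mul]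
    exact Nat.mul_le_mul_right _ (by omega)
  · rintro (⟨Q, T⟩ : ℕ × List ℕ) ⟨h1, h2, h3⟩
    refine ⟨h2, ?_⟩
    dsimp only at h1 h2 h3
    rw [Nat.sub_self, pow_zero] at h1
    subst h1
    -- the factor `H ^ 2` of `pot_all` makes up for the factor `4` that is lost in each halving
    have h4 : (liveCount S * H * H * n : ℤ) = 4 ^ i * (n * liveCount S) := by
      rw [hH, show (4 : ℤ) = 2 * 2 by norm_num, mul_pow]
      push_cast
      ring
    rw [h4] at h3
    exact le_of_mul_le_mul_left h3 (by positivity)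

/-- By the inclusion-exclusion bound `linCount_le_hitCount`, a set of large potential hits a quarter
of the alive sets, and it is small. -/
theorem hit_of_pot {T : List ℕ} (hn : 1 ≤ n) (hnd : ∀ P < S.length, flg S P ≠ 0 → ∀ i < H,
      ∀ j < H, vtx S P i = vtx S P j → i = j)
    (hT : (n * liveCount S : ℤ) ≤ pot S H (liveCount S) n 1 T) :
    liveCount S ≤ 4 * hitCount S H T ∧ (liveCount S ≠ 0 → H * suppCount T ≤ 3 * n) := by
  have h1 := Nat.mul_le_mul_left n (linCount_le_hitCount (T := T) hnd)
  have h2 : hitCount S H T ≤ liveCount S := by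
    refine Finset.sum_le_sum fun P _ => ?_
    split_ifs <;> simp_all
  unfold pot at hT
  have h3 := Nat.mul_le_mul_left n h2
  -- both claims follow from this inequality, the second one with `hitCount ≤ liveCount`
  have h4 : n * liveCount S + liveCount S * (H * suppCount T) ≤ 4 * (n * hitCount S H T) := by
    zify at h1 ⊢
    push_cast at hT
    linarith
  constructor
  · refine le_of_mul_le_mul_left ?_ (show 0 < n from hn)
    calc n * liveCount S ≤ 4 * (n * hitCount S H T) := by omega
      _ = _ := by ring
  · intro h5
    refine le_of_mul_le_mul_left ?_ (Nat.pos_of_ne_zero h5)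
    calc liveCount S * (H * suppCount T) ≤ 3 * (n * liveCount S) := by omega
      _ = _ := by ring

/-- One round of the greedy construction of a hitting set: a sample is added to the set, and the
sets that it hits are not alive any more. Nothing is added if no set is alive, since there is no
bound on the size of the sample in this case. -/
def roundP : Prog [sTy, .arr .word, .word, .word] (.prod sTy (.arr .word)) :=
  .letIn (call4 sampleP v0 v2 (.len v1) v3) (.letIn (call1 liveCountP v1)
    (.pair
      (.tab (.len v2) (.pair
        (.ite (.fst (.get v3 v0))
          (.ite (sumTab v5 (.ite (.get v3 (.get (.snd (.get v4 v1)) v0)) (.lit 1) (.lit 0)))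
            (.lit 0) (.lit 1)) (.lit 0))
        (.snd (.get v3 v0))))
      (.tab (.len v3) (.ite (.get v4 v0) (.lit 1)
        (.ite v1 (.ite (.get v2 v0) (.lit 1) (.lit 0)) (.lit 0))))))

/-- The relation between the states before and after a round. -/
structure IsRound (H n : ℕ) (S S' : List (ℕ × List ℕ)) (U U' : List ℕ) : Prop where
  length_eq : S'.length = S.length
  snd_eq : ∀ P < S.length, (S'.getD P (0, [])).2 = (S.getD P (0, [])).2
  flg_of : ∀ P < S.length, flg S' P ≠ 0 → flg S P ≠ 0
  hit : ∀ P < S.length, flg S P ≠ 0 → flg S' P = 0 → ∃ i < H, U'.getD (vtx S P i) 0 ≠ 0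
  length_U : U'.length = n
  mono : ∀ v < n, U.getD v 0 ≠ 0 → U'.getD v 0 ≠ 0
  live_le : 4 * liveCount S' ≤ 3 * liveCount S
  supp_le : H * suppCount U' ≤ H * suppCount U + 3 * n

theorem IsRound.mk' {S' : List (ℕ × List ℕ)} {T U U' : List ℕ} (hn : 1 ≤ n)
    (hS : ∀ P < S.length, ∀ i < H, vtx S P i < n)
    (hnd : ∀ P < S.length, flg S P ≠ 0 → ∀ i < H, ∀ j < H, vtx S P i = vtx S P j → i = j)
    (hT : (n * liveCount S : ℤ) ≤ pot S H (liveCount S) n 1 T) (hTl : T.length = n)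
    (hUl : U.length = n) (hl : S'.length = S.length)
    (hs : ∀ P < S.length, S'.getD P (0, []) =
      (if flg S P ≠ 0 ∧ (∑ i ∈ Finset.range H, if T.getD (vtx S P i) 0 ≠ 0 then 1 else 0) = 0
        then 1 else 0, (S.getD P (0, [])).2))
    (hl' : U'.length = n)
    (hu : ∀ v < n, U'.getD v 0 =
      if U.getD v 0 ≠ 0 ∨ (liveCount S ≠ 0 ∧ T.getD v 0 ≠ 0) then 1 else 0) :
    IsRound H n S S' U U' := by
  obtain ⟨p1, p2⟩ := hit_of_pot hn hnd hT
  have hf : ∀ P < S.length, flg S' P =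
      if flg S P ≠ 0 ∧ (∑ i ∈ Finset.range H, if T.getD (vtx S P i) 0 ≠ 0 then 1 else 0) = 0
        then 1 else 0 := by
    intro P hP
    rw [flg, hs P hP]
  refine ⟨hl, fun P hP => by rw [hs P hP], ?_, ?_, hl', ?_, ?_, ?_⟩
  · intro P hP h
    rw [hf P hP] at h
    by_contra h'
    simp [h'] at h
  · intro P hP h1 h2
    have h0 : liveCount S ≠ 0 := by
      have := Finset.single_le_sum (f := fun P => if flg S P ≠ 0 then 1 else 0)
        (fun _ _ => Nat.zero_le _) (Finset.mem_range.2 hP)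
      simp only [h1, ne_eq, not_false_eq_true, if_true] at this
      exact Nat.one_le_iff_ne_zero.1 this
    have h3 : (∑ i ∈ Finset.range H, if T.getD (vtx S P i) 0 ≠ 0 then 1 else 0) ≠ 0 := by
      intro h3
      rw [hf P hP, if_pos ⟨h1, h3⟩] at h2
      exact one_ne_zero h2
    obtain ⟨i, hi, h4⟩ := Finset.exists_ne_zero_of_sum_ne_zero h3
    have hi' := Finset.mem_range.1 hi
    refine ⟨i, hi', ?_⟩
    have h5 : T.getD (vtx S P i) 0 ≠ 0 := fun h5 => h4 (if_neg (not_not.2 h5))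
    rw [hu _ (hS P hP i hi'), if_pos (.inr ⟨h0, h5⟩)]
    exact one_ne_zero
  · intro v hv h
    rw [hu v hv, if_pos (.inl h)]
    exact one_ne_zero
  · have : liveCount S = liveCount S' + hitCount S H T := by
      rw [liveCount, liveCount, hitCount, hl, ← Finset.sum_add_distrib]
      refine Finset.sum_congr rfl fun P hP => ?_
      rw [hf P (Finset.mem_range.1 hP)]
      generalize (∑ i ∈ Finset.range H, if T.getD (vtx S P i) 0 ≠ 0 then 1 else 0) = c
      by_cases h1 : flg S P = 0 <;> by_cases h2 : c = 0 <;> simp [h1, h2]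
    omega
  · have h1 : suppCount U' ≤ suppCount U + if liveCount S ≠ 0 then suppCount T else 0 := by
      by_cases h0 : liveCount S = 0
      · rw [if_neg (not_not.2 h0), add_zero, suppCount, suppCount, hl', hUl]
        refine Finset.sum_le_sum fun v hv => ?_
        rw [hu v (Finset.mem_range.1 hv)]
        generalize U.getD v 0 = a
        by_cases ha : a = 0 <;> simp [ha, h0]
      · rw [if_pos h0, suppCount, suppCount, suppCount, hl', hUl, hTl, ← Finset.sum_add_distrib]
        refine Finset.sum_le_sum fun v hv => ?_
        rw [hu v (Finset.mem_range.1 hv)]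
        generalize U.getD v 0 = a
        generalize T.getD v 0 = b
        by_cases ha : a = 0 <;> by_cases hb : b = 0 <;> simp [ha, hb, h0]
    have h2 := Nat.mul_le_mul_left H h1
    rw [Nat.mul_add] at h2
    split_ifs at h2 with h0
    · have := p2 h0; omega
    · omega

theorem roundP_runs (h : Sizes w n H d S) (hH : H = 2 ^ i) {U : List ℕ} (hUl : U.length = n)
    (hnd : ∀ P < S.length, flg S P ≠ 0 → ∀ i < H, ∀ j < H, vtx S P i = vtx S P j → i = j) :
    Runs w roundP (S, U, H, i, ()) (fun x : List (ℕ × List ℕ) × List ℕ => IsRound H n S x.1 U x.2)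
      ((i + 1) * ((Nat.clog 2 n + 1) * passCost S H n))
      ((i + 1) * ((Nat.clog 2 n + 1) * (d + 1))) := by
  have c0 := h.cost_le.1
  have c1 := h.cost_le.2
  have c2 := h.length_le
  have c3 := h.pow_le
  have c4 := h.lt_two_pow
  have c5 := h.H_le
  have c8 := h.clog_H
  have c9 := h.one_le_n
  have m1 := one_mod h.w_pos
  have k1 : S.length % 2 ^ w = S.length := Nat.mod_eq_of_lt (by omega)
  have k2 : U.length % 2 ^ w = n := by rw [hUl]; exact Nat.mod_eq_of_lt (by omega)
  have hU1 : passCost S H n ≤ (Nat.clog 2 n + 1) * passCost S H n :=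
    Nat.le_mul_of_pos_left _ (by omega)
  have hD1 : d + 1 ≤ (Nat.clog 2 n + 1) * (d + 1) := Nat.le_mul_of_pos_left _ (by omega)
  have hU : (Nat.clog 2 n + 1) * passCost S H n ≤
      (i + 1) * ((Nat.clog 2 n + 1) * passCost S H n) := Nat.le_mul_of_pos_left _ (by omega)
  have hD : (Nat.clog 2 n + 1) * (d + 1) ≤ (i + 1) * ((Nat.clog 2 n + 1) * (d + 1)) :=
    Nat.le_mul_of_pos_left _ (by omega)
  refine Runs.letIn (Q := fun T : List ℕ => T.length = n ∧
    (n * liveCount S : ℤ) ≤ pot S H (liveCount S) n 1 T) ?_ ?_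
  · refine Runs.call4 (Q₁ := fun x => x = S) (Q₂ := fun x => x = H) (Q₃ := fun x => x = n)
      (Q₄ := fun x => x = i) ?_ ?_ ?_ ?_ ?_
    · exact Runs.of_flat rfl (by omega) (by omega) rfl
    · exact Runs.of_flat rfl (by omega) (by omega) rfl
    · exact Runs.of_flat rfl (by omega) (by omega) (by simp [k2])
    · exact Runs.of_flat rfl (by omega) (by omega) rfl
    · rintro _ _ _ _ rfl rfl rfl rfl
      exact sampleP_runs h hH
  rintro (T : List ℕ) ⟨t1, t2⟩
  refine Runs.letIn (Q := fun x => x = liveCount S) ?_ ?_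
  · refine Runs.call1 (Q₁ := fun x => x = S) ?_ ?_
    · exact Runs.of_flat rfl (by omega) (by omega) rfl
    · rintro _ rfl
      exact (liveCountP_runs h).mono (fun _ h => h) (by omega) (by omega)
  rintro _ rfl
  refine Runs.pair (Q₁ := fun S' : List (ℕ × List ℕ) => S'.length = S.length ∧
      ∀ P < S.length, S'.getD P (0, []) =
      (if flg S P ≠ 0 ∧ (∑ i ∈ Finset.range H, if T.getD (vtx S P i) 0 ≠ 0 then 1 else 0) = 0
        then 1 else 0, (S.getD P (0, [])).2))
    (Q₂ := fun U' : List ℕ => U'.length = n ∧ ∀ v < n, U'.getD v 0 =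
      if U.getD v 0 ≠ 0 ∨ (liveCount S ≠ 0 ∧ T.getD v 0 ≠ 0) then 1 else 0) ?_ ?_ ?_
  · refine (Runs.tab (a := .prod .word (.arr .word)) (ℓ := S.length)
      (Q := fun P (x : ℕ × List ℕ) => x = (if flg S P ≠ 0 ∧
        (∑ i ∈ Finset.range H, if T.getD (vtx S P i) 0 ≠ 0 then 1 else 0) = 0
        then 1 else 0, (S.getD P (0, [])).2)) (u := fun _ => 4 * H + 1) ?_ ?_ ?_).imp
        fun _ h => ⟨h.1, h.2⟩
    · exact Runs.of_flat rfl (by omega) (by omega) (by simp [k1])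
    · intro P hP
      refine Runs.pair (Q₁ := fun x : ℕ => x = if flg S P ≠ 0 ∧
        (∑ i ∈ Finset.range H, if T.getD (vtx S P i) 0 ≠ 0 then 1 else 0) = 0 then 1 else 0)
        (Q₂ := fun x : List ℕ => x = (S.getD P (0, [])).2) ?_ ?_ ?_
      · refine Runs.ite (C := fun x => x = flg S P) ?_ ?_ ?_
        · exact Runs.of_flat rfl (by omega) (by omega) rfl
        · rintro _ rfl hP0
          refine Runs.ite (C := fun x => x =
            ∑ i ∈ Finset.range H, if T.getD (vtx S P i) 0 ≠ 0 then 1 else 0) ?_ ?_ ?_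
          · refine sumTab_runs (u := fun _ => 1) ?_ ?_ (by simp; omega) (by omega) (by omega)
              (by omega) ?_
            · exact Runs.of_flat rfl (by omega) (by omega) rfl
            · intro j hj
              refine Runs.of_flat rfl le_rfl (by omega) ?_
              simp only [val_ite, val_snd, val_get, val_var, get_zero, get_succ, val_lit,
                Nat.zero_mod, m1]
              change (if T.getD (vtx S P j) 0 = 0 then 0 else 1) = _
              split_ifs <;> simp_all
            · refine lt_of_le_of_lt ((Finset.sum_le_card_nsmul _ _ 1 fun j _ => ?_).trans
                (by simp; exact c5)) (show n < 2 ^ w by omega)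
              split_ifs <;> simp
          · rintro _ rfl h0
            refine Runs.of_flat rfl (by omega) (by omega) ?_
            rw [if_neg fun h' => h0 h'.2]
            simp
          · intro h0
            refine Runs.of_flat rfl (by omega) (by omega) ?_
            rw [if_pos ⟨hP0, h0.symm⟩]
            simp [m1]
        · intro h0
          refine Runs.of_flat rfl (by omega) (by omega) ?_
          rw [if_neg fun h' => h'.1 h0.symm]
          simp
      · exact Runs.of_flat rfl (by omega) (by omega) rfl
      · rintro _ _ rfl rfl; rfl
    · simp only [Finset.sum_const, Finset.card_range, smul_eq_mul]
      have := Nat.mul_le_mul_left S.length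
        (show 4 * H + 1 ≤ (H + 1) * (4 * H + 1) from Nat.le_mul_of_pos_left _ (by omega))
      omega
  · refine (Runs.tab (a := .word) (ℓ := n) (Q := fun v (x : ℕ) => x =
      if U.getD v 0 ≠ 0 ∨ (liveCount S ≠ 0 ∧ T.getD v 0 ≠ 0) then 1 else 0) (u := fun _ => 1)
      ?_ ?_ (by simp; omega)).imp fun _ h => ⟨h.1, h.2⟩
    · exact Runs.of_flat rfl (by omega) (by omega) (by simp [k2])
    · intro v hv
      refine Runs.of_flat rfl le_rfl (by omega) ?_
      simp only [val_ite, val_get, val_var, get_zero, get_succ, val_lit, Nat.zero_mod, m1]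
      change (if U.getD v 0 = 0 then (if liveCount S = 0 then 0 else if T.getD v 0 = 0 then 0
        else 1) else 1) = _
      by_cases h1 : U.getD v 0 = 0 <;> by_cases h2 : liveCount S = 0 <;>
        by_cases h3 : T.getD v 0 = 0 <;> simp [h1, h2, h3, -List.getD_eq_getElem?_getD]
  · rintro S' U' ⟨s1, s2⟩ ⟨u1, u2⟩
    exact IsRound.mk' c9 h.vtx_lt hnd t2 t1 hUl s1 s2 u1 u2

/-- A small set of vertices that hits all alive sets; the arguments after the family are the number
of vertices, its logarithm, `i` and the size `2 ^ i` of the sets. -/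
def hitP : Prog [sTy, .word, .word, .word, .word] (.arr .word) :=
  call1 filterP (.snd (.loop (.lit 6 * v2) (.pair v0 (.tab v1 (.lit 0)))
    (call4 roundP (.fst v1) (.snd v1) v6 v5)))

/-- `Z` is a small set that hits all alive sets: it is the union of the samples of `6 * L` rounds,
which have at most `3 * n / H` elements each. -/
structure IsHittingSet (S : List (ℕ × List ℕ)) (H n : ℕ) (Z : List ℕ) : Prop where
  lt : ∀ v ∈ Z, v < n
  length_le : Z.length ≤ n
  mul_length_le : H * Z.length ≤ 18 * n * Nat.clog 2 n
  hit : ∀ P < S.length, flg S P ≠ 0 → ∃ i < H, vtx S P i ∈ Z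

theorem hitP_runs (h : Sizes w n H d S) (hH : H = 2 ^ i) (hn : 2 ≤ n)
    (hnd : ∀ P < S.length, flg S P ≠ 0 → ∀ i < H, ∀ j < H, vtx S P i = vtx S P j → i = j) :
    Runs w hitP (S, n, Nat.clog 2 n, i, H, ()) (IsHittingSet S H n)
      ((6 * Nat.clog 2 n + 1) * ((i + 1) * ((Nat.clog 2 n + 1) * passCost S H n)))
      ((6 * Nat.clog 2 n + 1) * ((i + 1) * ((Nat.clog 2 n + 1) * (d + 1)))) := by
  have c1 := h.cost_le.2
  have c3 := h.pow_le
  have c4 := h.lt_two_pow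
  have c7 := h.clog_n
  have hL : 1 ≤ Nat.clog 2 n := Nat.clog_pos one_lt_two hn
  have hlog : Nat.clog 2 n ≤ n := Nat.clog_le_of_le_pow n.lt_two_pow_self.le
  have hU1 : passCost S H n ≤ (Nat.clog 2 n + 1) * passCost S H n :=
    Nat.le_mul_of_pos_left _ (by omega)
  have hU1' : (Nat.clog 2 n + 1) * (3 * n + 2) ≤ (Nat.clog 2 n + 1) * passCost S H n :=
    Nat.mul_le_mul_left _ (by omega)
  have hD1 : d + 1 ≤ (Nat.clog 2 n + 1) * (d + 1) := Nat.le_mul_of_pos_left _ (by omega)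
  have hU2 : (Nat.clog 2 n + 1) * passCost S H n ≤
      (i + 1) * ((Nat.clog 2 n + 1) * passCost S H n) := Nat.le_mul_of_pos_left _ (by omega)
  have hD2 : (Nat.clog 2 n + 1) * (d + 1) ≤ (i + 1) * ((Nat.clog 2 n + 1) * (d + 1)) :=
    Nat.le_mul_of_pos_left _ (by omega)
  have hU : (i + 1) * ((Nat.clog 2 n + 1) * passCost S H n) ≤
      (6 * Nat.clog 2 n + 1) * ((i + 1) * ((Nat.clog 2 n + 1) * passCost S H n)) :=
    Nat.le_mul_of_pos_left _ (by omega)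
  have hD : (i + 1) * ((Nat.clog 2 n + 1) * (d + 1)) ≤
      (6 * Nat.clog 2 n + 1) * ((i + 1) * ((Nat.clog 2 n + 1) * (d + 1))) :=
    Nat.le_mul_of_pos_left _ (by omega)
  refine Runs.call1 (Q₁ := fun U : List ℕ => U.length = n ∧
    H * suppCount U ≤ 18 * n * Nat.clog 2 n ∧
    ∀ P < S.length, flg S P ≠ 0 → ∃ i < H, U.getD (vtx S P i) 0 ≠ 0) ?_ ?_
  · refine Runs.snd (Runs.imp (Runs.loop (a := .prod sTy (.arr .word)) (ℓ := 6 * Nat.clog 2 n)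
      (I := fun r (x : List (ℕ × List ℕ) × List ℕ) => x.1.length = S.length ∧
        (∀ P < S.length, (x.1.getD P (0, [])).2 = (S.getD P (0, [])).2) ∧
        (∀ P < S.length, flg x.1 P ≠ 0 → flg S P ≠ 0) ∧
        (∀ P < S.length, flg S P ≠ 0 → flg x.1 P = 0 → ∃ i < H, x.2.getD (vtx S P i) 0 ≠ 0) ∧
        x.2.length = n ∧ 4 ^ r * liveCount x.1 ≤ 3 ^ r * liveCount S ∧
        H * suppCount x.2 ≤ 3 * n * r)
      (u := fun _ => (i + 1) * ((Nat.clog 2 n + 1) * passCost S H n))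
      (d := fun _ => (i + 1) * ((Nat.clog 2 n + 1) * (d + 1))) ?_ ?_ ?_ ?_ ?_) ?_)
    · refine Runs.of_flat rfl (by omega) (by omega) ?_
      have m6 : 6 % 2 ^ w = 6 := Nat.mod_eq_of_lt (by omega)
      have m7 : 6 * Nat.clog 2 n % 2 ^ w = 6 * Nat.clog 2 n := Nat.mod_eq_of_lt (by omega)
      simp [m6, m7]
    · refine Runs.pair (Q₁ := fun x => x = S)
        (Q₂ := fun T : List ℕ => T.length = n ∧ ∀ v < n, T.getD v 0 = 0) ?_ ?_ ?_
      · exact Runs.of_flat rfl (by omega) (by omega) rfl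
      · refine (Runs.tab (a := .word) (ℓ := n) (Q := fun _ x => x = 0) (u := fun _ => 1)
          ?_ ?_ (by simp; omega)).imp fun _ h => ⟨h.1, h.2⟩
        · exact Runs.of_flat rfl (by omega) (by omega) rfl
        · intro v hv
          exact Runs.of_flat rfl le_rfl (by omega) (by simp)
      · rintro _ U rfl ⟨h1, h2⟩
        refine ⟨rfl, fun _ _ => rfl, fun _ _ h => h, fun _ _ h h' => absurd h' h, h1, by simp, ?_⟩
        have : suppCount U = 0 := Finset.sum_eq_zero fun v hv => by
          rw [h2 v (h1 ▸ Finset.mem_range.1 hv)]; simp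
        dsimp only
        rw [this]; simp
    · rintro r hr (⟨S', U⟩ : List (ℕ × List ℕ) × List ℕ) ⟨i1, i2, i3, i4, i5, i6, i7⟩
      dsimp only at i1 i2 i3 i4 i5 i6 i7
      have hvtx : ∀ P < S.length, ∀ i, vtx S' P i = vtx S P i := fun P hP i => by
        rw [vtx, i2 P hP, ← vtx]
      have hsz : Sizes w n H d S' := ⟨h.one_le_n, h.one_le_H, h.H_le, i1 ▸ h.length_le,
        h.lt_two_pow, i1 ▸ h.clog_length, h.clog_n, fun P hP i hi => by
          rw [i1] at hP; rw [hvtx P hP]; exact h.vtx_lt P hP i hi⟩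
      have hcost : passCost S' H n = passCost S H n := by rw [passCost, i1, ← passCost]
      refine Runs.call4 (Q₁ := fun x => x = S') (Q₂ := fun x => x = U) (Q₃ := fun x => x = H)
        (Q₄ := fun x => x = i) ?_ ?_ ?_ ?_ ?_
      · exact Runs.of_flat rfl (by omega) (by omega) rfl
      · exact Runs.of_flat rfl (by omega) (by omega) rfl
      · exact Runs.of_flat rfl (by omega) (by omega) rfl
      · exact Runs.of_flat rfl (by omega) (by omega) rfl
      rintro S' U H i rfl rfl rfl rfl
      rw [← hcost]
      refine (roundP_runs hsz hH i5 fun P hP hf a ha b hb hab => ?_).imp ?_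
      · rw [i1] at hP
        rw [hvtx P hP, hvtx P hP] at hab
        exact hnd P hP (i3 P hP hf) a ha b hb hab
      rintro (⟨S'', U'⟩ : List (ℕ × List ℕ) × List ℕ) hR
      dsimp only at hR
      have e1 := hR.length_eq
      refine ⟨e1.trans i1, fun P hP => (hR.snd_eq P (i1 ▸ hP)).trans (i2 P hP),
        fun P hP h' => i3 P hP (hR.flg_of P (i1 ▸ hP) h'), ?_, hR.length_U, ?_, ?_⟩
      · intro P hP h1 h2
        by_cases h3 : flg S' P = 0
        · obtain ⟨j, hj, h4⟩ := i4 P hP h1 h3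
          exact ⟨j, hj, hR.mono _ (h.vtx_lt P hP j hj) h4⟩
        · obtain ⟨j, hj, h4⟩ := hR.hit P (i1 ▸ hP) h3 h2
          rw [hvtx P hP] at h4
          exact ⟨j, hj, h4⟩
      · have h1 := Nat.mul_le_mul_left (4 ^ r) hR.live_le
        calc 4 ^ (r + 1) * liveCount S'' = 4 ^ r * (4 * liveCount S'') := by ring
          _ ≤ 4 ^ r * (3 * liveCount S') := h1
          _ = 3 * (4 ^ r * liveCount S') := by ring
          _ ≤ 3 * (3 ^ r * liveCount S) := Nat.mul_le_mul_left _ i6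
          _ = _ := by ring
      · have h1 := hR.supp_le
        have h2 : 3 * n * (r + 1) = 3 * n * r + 3 * n := by ring
        dsimp only
        omega
    · simp only [Finset.sum_const, Finset.card_range, smul_eq_mul]
      exact Nat.mul_le_mul_right _ (by omega)
    · simp only [Finset.sum_const, Finset.card_range, smul_eq_mul]
      exact Nat.mul_le_mul_right _ (by omega)
    · rintro (⟨S', U⟩ : List (ℕ × List ℕ) × List ℕ) ⟨i1, i2, i3, i4, i5, i6, i7⟩
      dsimp only at i1 i2 i3 i4 i5 i6 i7
      refine ⟨i5, i7.trans (le_of_eq (by ring)), fun P hP hf => i4 P hP hf ?_⟩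
      -- `4 ^ (6 * L) * live ≤ 3 ^ (6 * L) * n ^ 2 < 4 ^ (6 * L)` since `3 ^ 6 * 4 < 4 ^ 6`
      have hlive : liveCount S' = 0 := by
        by_contra h0
        have h1 : liveCount S ≤ 4 ^ Nat.clog 2 n := by
          have h2 := Nat.le_pow_clog one_lt_two n
          calc liveCount S ≤ n * n := liveCount_le.trans h.length_le
            _ ≤ 2 ^ Nat.clog 2 n * 2 ^ Nat.clog 2 n := Nat.mul_le_mul h2 h2
            _ = _ := by rw [← mul_pow]; norm_num
        have h2 : (2916 : ℕ) ^ Nat.clog 2 n < 4096 ^ Nat.clog 2 n :=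
          Nat.pow_lt_pow_left (by norm_num) (by omega)
        have h3 : 4 ^ (6 * Nat.clog 2 n) * 1 ≤ 3 ^ (6 * Nat.clog 2 n) * 4 ^ Nat.clog 2 n :=
          (Nat.mul_le_mul_left _ (Nat.one_le_iff_ne_zero.2 h0)).trans
            (i6.trans (Nat.mul_le_mul_left _ h1))
        rw [pow_mul, pow_mul, ← mul_pow, mul_one] at h3
        norm_num at h3
        omega
      have := Finset.single_le_sum (f := fun P => if flg S' P ≠ 0 then 1 else 0)
        (fun _ _ => Nat.zero_le _) (Finset.mem_range.2 (i1.symm ▸ hP))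
      by_contra h0
      rw [liveCount] at hlive
      simp only [h0, ne_eq, not_false_eq_true, if_true, hlive] at this
      omega
  · rintro (U : List ℕ) ⟨u1, u2, u3⟩
    have hcard : ((List.range U.length).filter fun v => U.getD v 0 ≠ 0).length = suppCount U := by
      rw [suppCount, ← Finset.card_filter]
      rfl
    refine (filterP_runs (by omega)).mono ?_ (by rw [u1]; omega) (by rw [u1]; omega)
    rintro _ rfl
    refine ⟨?_, ?_, ?_, ?_⟩
    · intro v hv
      rw [List.mem_filter, List.mem_range, u1] at hv
      exact hv.1
    · exact (List.length_filter_le _ _).trans (by simp [u1])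
    · rw [hcard]; exact u2
    · intro P hP hf
      obtain ⟨j, hj, h1⟩ := u3 P hP hf
      refine ⟨j, hj, List.mem_filter.2 ⟨?_, by simpa using h1⟩⟩
      rw [List.mem_range, u1]
      exact h.vtx_lt P hP j hj

end Programs

/-! ### Shortest path trees -/

section Trees

variable {g : List (List (ℕ × ℝ))} {D : List (ℕ × ℝ)} {par : List ℕ} {x y k : ℕ} {p : Len}

theorem Tight.lt (hg : WF g) {u v : ℕ} (h : Tight g D u v) : u < g.length := by
  obtain ⟨c, hc, -⟩ := h
  exact hg v _ hc

theorem Tight.fst_eq {u v : ℕ} (h : Tight g D u v) :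
    (D.getD v (0, 0)).1 = (D.getD u (0, 0)).1 + 1 := by
  obtain ⟨c, -, h1, h2⟩ := h
  rw [h2, addD, if_neg h1, if_neg (by simp)]
  rfl

theorem IsPar.lt (h : IsPar g D par) (hg : WF g) {v : ℕ} (hv : v < g.length) :
    par.getD v 0 < g.length := by
  rcases (h.2 v hv).1 with h' | h'
  · rw [h']; exact hv
  · exact h'.lt hg

theorem IsPar.iterate_lt (h : IsPar g D par) (hg : WF g) :
    ∀ (j : ℕ) {v : ℕ}, v < g.length → (fun u => par.getD u 0)^[j] v < g.length
  | 0, _, hv => hv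
  | j + 1, _, hv => IsPar.iterate_lt h hg j (h.lt hg hv)

/-- If `H` steps to the predecessor lead from `H` edges to none, then every step does reduce the
number of edges. -/
theorem IsPar.fst_iterate (h : IsPar g D par) (hg : WF g) {H : ℕ} (hy : y < g.length)
    (h1 : (D.getD y (0, 0)).1 = H + 1)
    (h2 : (D.getD ((fun u => par.getD u 0)^[H] y) (0, 0)).1 = 1) :
    ∀ j ≤ H, (D.getD ((fun u => par.getD u 0)^[j] y) (0, 0)).1 = H + 1 - j := by
  -- no step reduces the number of edges by more than one
  have step : ∀ j, (D.getD ((fun u => par.getD u 0)^[j] y) (0, 0)).1 ≤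
      (D.getD ((fun u => par.getD u 0)^[j + 1] y) (0, 0)).1 + 1 := by
    intro j
    rw [Function.iterate_succ_apply']
    rcases (h.2 _ (h.iterate_lt hg j hy)).1 with h' | h'
    · rw [h']; omega
    · rw [h'.fst_eq]
  have up : ∀ j, H + 1 ≤ (D.getD ((fun u => par.getD u 0)^[j] y) (0, 0)).1 + j := by
    intro j
    induction j with
    | zero => simpa using h1.ge
    | succ j ih => have := step j; omega
  have down : ∀ j ≤ H,
      (D.getD ((fun u => par.getD u 0)^[H - j] y) (0, 0)).1 ≤ 1 + j := by
    intro j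
    induction j with
    | zero => intro _; simpa using h2.le
    | succ j ih =>
      intro hj
      have h3 := step (H - (j + 1))
      rw [show H - (j + 1) + 1 = H - j by omega] at h3
      have := ih (by omega)
      omega
  intro j hj
  have h3 := down (H - j) (by omega)
  rw [show H - (H - j) = j by omega] at h3
  have := up j
  omega

theorem toLen_inj {a b : ℕ × ℝ} (ha : a.1 ≠ 0) (hb : b.1 ≠ 0) (h : toLen a = toLen b) : a = b := by
  have h' := Prod.mk.inj (toLex_inj.1 h)
  refine Prod.ext ?_ h'.1
  have := h'.2
  omega

/-- `D` lists lengths of walks from `x`, and the entries are exact for all vertices with a shortest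
walk of at most `k` edges. -/
def IsDistArray (g : List (List (ℕ × ℝ))) (x k : ℕ) (D : List (ℕ × ℝ)) : Prop :=
  ∀ y < g.length, Between (fun p => ∃ j, Walk (GEdge g) x j y p)
    (fun p => IsDist (GEdge g) x y p ∧ (ofLex p).2 ≤ k) (D.getD y (0, 0))

theorem BFArray.isDistArray (h : BFArray g x k D) : IsDistArray g x k D := fun y hy =>
  (h.2 y hy).2.imp (fun _ h => h) fun _ hp => ⟨_, hp.2, hp.1.walk⟩

/-- The predecessors of `y` form a shortest walk to `y`: the `j`-th one divides a shortest walk into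
shortest walks, the second of which has `j` edges. -/
theorem IsDistArray.walk_back (hD : IsDistArray g x k D) (h : IsPar g D par) (hg : WF g)
    (hx : x < g.length) (hp : IsDist (GEdge g) x y p) (hk : (ofLex p).2 ≤ k) :
    ∀ j ≤ (ofLex p).2, ∃ p' q', IsDist (GEdge g) x ((fun u => par.getD u 0)^[j] y) p' ∧
      IsDist (GEdge g) ((fun u => par.getD u 0)^[j] y) y q' ∧ p = p' + q' ∧
      (ofLex p').2 = (ofLex p).2 - j ∧ (D.getD ((fun u => par.getD u 0)^[j] y) (0, 0)).1 ≠ 0 ∧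
      toLen (D.getD ((fun u => par.getD u 0)^[j] y) (0, 0)) = p' ∧
      (0 < j → Tight g D ((fun u => par.getD u 0)^[j] y) ((fun u => par.getD u 0)^[j - 1] y)) := by
  have exact' : ∀ {y p}, IsDist (GEdge g) x y p → (ofLex p).2 ≤ k →
      (D.getD y (0, 0)).1 ≠ 0 ∧ toLen (D.getD y (0, 0)) = p := fun {y p} h1 h2 =>
    (hD y (h1.walk.lt_length hx)).eq (fun _ ⟨_, hq⟩ => h1.2 _ _ hq) ⟨h1, h2⟩
  intro j
  induction j with
  | zero =>
    intro _
    have h1 := exact' hp hk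
    refine ⟨p, 0, hp, ?_, by simp, by simp, h1.1, h1.2, by simp⟩
    exact IsDist.right (x := x) (p := p) (by simpa using hp) hp.walk Walk.nil
  | succ j ih =>
    intro hj
    obtain ⟨p', q', h1, h2, h3, h4, h5, h6, -⟩ := ih (by omega)
    clear ih
    rw [Function.iterate_succ_apply', Nat.add_sub_cancel]
    generalize hz : (fun u => par.getD u 0)^[j] y = z at *
    have hzn : z < g.length := h1.walk.lt_length hx
    obtain ⟨u, a, b, k1, k2, k3, k4⟩ := h1.split (j := (ofLex p).2 - (j + 1)) (by omega)
    -- the last edge of a shortest walk to `z` is tight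
    have k5 : (ofLex b).2 = 1 := by
      have := congrArg (fun q => (ofLex q).2) k3
      simp only [ofLex_add, Prod.snd_add] at this
      omega
    have k6 := k2.walk
    rw [k5] at k6
    have k7 : GEdge g u z b := by
      rcases k6 with _ | ⟨h', e⟩
      cases h' with
      | nil => simpa using e
    obtain ⟨c, hc, rfl⟩ := k7
    obtain ⟨k8, k9⟩ := exact' k1 (by omega)
    have ht : Tight g D u z := by
      refine ⟨c, hc, k8, toLen_inj h5 (addD_ne_zero.2 ⟨k8, by simp⟩) ?_⟩
      rw [toLen_addD k8 (by simp), toLen_edge, h6, k9, k3]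
    -- so the predecessor of `z` is tight, too, and its entry has to be exact
    have ht' := (h.2 z hzn).2 u ht
    obtain ⟨c', hc', l1, l2⟩ := id ht'
    have l3 : p' = toLen (D.getD (par.getD z 0) (0, 0)) + toLex (c', 1) := by
      rw [← h6, l2, toLen_addD l1 (by simp), toLen_edge]
    obtain ⟨i, hi⟩ := (hD _ (h.lt hg hzn)).1 l1
    have he : Walk (GEdge g) (par.getD z 0) 1 z (toLex (c', 1)) := Walk.single ⟨c', hc', rfl⟩
    rw [l3] at h1 h3
    rw [add_assoc] at h3
    refine ⟨_, _, h1.left hi he, IsDist.right (h3 ▸ hp) hi (he.append h2.walk), h3, ?_, l1, rfl,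
      fun _ => ht'⟩
    have := congrArg (fun q => (ofLex q).2) l3
    simp only [ofLex_add, Prod.snd_add, ofLex_toLex] at this
    omega

end Trees

/-- The lengths of shortest walks from a vertex, and the iterates of the predecessors; the arguments
after the vertex are `i` and the number `2 ^ i` of edges. -/
def treeP : Prog [gTy, .word, .word, .word] (.prod (.arr dTy) (.arr (.prod .word (.arr .word)))) :=
  .letIn (call3 bellmanFordP v0 v1 v3) (.pair v0 (call2 iteratesP (call2 parentsP v1 v0) v3))

/-- The value computed by `treeP`. -/
def IsTree (g : List (List (ℕ × ℝ))) (x i : ℕ) (R : List (ℕ × ℝ) × List (ℕ × List ℕ)) : Prop :=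
  BFArray g x (2 ^ i) R.1 ∧ ∃ par, IsPar g R.1 par ∧ IsIter par i R.2

/-- The work of `treeP`. -/
def treeCost (g : List (List (ℕ × ℝ))) (i : ℕ) : ℕ :=
  (2 ^ i + 1) * (4 * numE g + g.length) + g.length * (3 * 2 ^ i) + i + 2

theorem treeP_runs {w x i : ℕ} {g : List (List (ℕ × ℝ))} (hg : WF g)
    (hdeg : ∀ v, (g.getD v []).length ≤ g.length) (hx : x < g.length)
    (hw : g.length + 2 ^ i + 16 < 2 ^ w) :
    Runs w treeP (g, x, i, 2 ^ i, ()) (IsTree g x i) (treeCost g i)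
      ((2 ^ i + 1) * (Nat.clog 2 g.length + 1)) := by
  have hi := i.lt_two_pow_self
  have hD1 : Nat.clog 2 g.length + 1 ≤ (2 ^ i + 1) * (Nat.clog 2 g.length + 1) :=
    Nat.le_mul_of_pos_left _ (by omega)
  have hD2 : 2 ^ i + 1 ≤ (2 ^ i + 1) * (Nat.clog 2 g.length + 1) :=
    Nat.le_mul_of_pos_right _ (by omega)
  have hU : 4 * numE g + g.length ≤ (2 ^ i + 1) * (4 * numE g + g.length) :=
    Nat.le_mul_of_pos_left _ (by omega)
  have hc : treeCost g i =
    (2 ^ i + 1) * (4 * numE g + g.length) + g.length * (3 * 2 ^ i) + i + 2 := rfl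
  refine Runs.letIn (Q := BFArray g x (2 ^ i)) ?_ ?_
  · refine Runs.call3 (Q₁ := fun v => v = g) (Q₂ := fun v => v = x) (Q₃ := fun v => v = 2 ^ i)
      ?_ ?_ ?_ ?_
    · exact Runs.of_flat rfl (by omega) (by omega) rfl
    · exact Runs.of_flat rfl (by omega) (by omega) rfl
    · exact Runs.of_flat rfl (by omega) (by omega) rfl
    · rintro _ _ _ rfl rfl rfl
      exact (bellmanFordP_runs hg hdeg hx (by omega)).mono (fun _ h => h) (by omega) le_rfl
  rintro (D : List (ℕ × ℝ)) hD
  refine Runs.pair (Q₁ := fun v => v = D)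
    (Q₂ := fun v => ∃ par, IsPar g D par ∧ IsIter par i v) ?_ ?_ ?_
  · exact Runs.of_flat rfl (by omega) (by omega) rfl
  · refine Runs.call2 (Q₁ := IsPar g D) (Q₂ := fun v => v = i) ?_ ?_ ?_
    · refine Runs.call2 (Q₁ := fun v => v = g) (Q₂ := fun v => v = D) ?_ ?_ ?_
      · exact Runs.of_flat rfl (by omega) (by omega) rfl
      · exact Runs.of_flat rfl (by omega) (by omega) rfl
      · rintro _ _ rfl rfl
        exact (parentsP_runs (B := 2 ^ i + 1) hg hdeg (fun y hy => (hD.2 y hy).1) (by omega)).mono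
          (fun _ h => h) (by omega) (by omega)
    · exact Runs.of_flat rfl (by omega) (by omega) rfl
    · rintro (par : List ℕ) _ hp rfl
      have hl := hp.1
      refine (iteratesP_runs (fun v hv => ?_) (by omega)).mono (fun v h => ⟨par, hp, h⟩)
        (by rw [hl]; omega) (by omega)
      rw [hl] at hv ⊢
      exact hp.lt hg hv
  · rintro _ v rfl hv
    exact ⟨hD, hv⟩

/-! ### Vertices on all shortest walks of a given number of edges -/

/-- Every shortest walk with `k` edges contains a vertex of `S`, up to walks of the same length. -/
def Meets (g : List (List (ℕ × ℝ))) (k : ℕ) (S : List ℕ) : Prop :=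
  ∀ u v p, u < g.length → IsDist (GEdge g) u v p → (ofLex p).2 = k →
    ∃ z ∈ S, ∃ p₁ p₂, IsDist (GEdge g) u z p₁ ∧ IsDist (GEdge g) z v p₂ ∧ p = p₁ + p₂

/-- From a set that meets the shortest walks with `H = 2 ^ i` edges, a smaller set that meets those
with `2 * H` edges. The arguments after the set are `i`, `H` and the logarithm of the number of
vertices. -/
def levelP : Prog [gTy, .arr .word, .word, .word, .word] (.arr .word) :=
  .letIn (.tab (.len v1) (call4 treeP v1 (.get v2 v0) v3 v4))
    (.letIn (.tab (.len v2 * .len v1)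
      (.letIn (.get v1 (v0 / .len v2)) (.letIn (v1 % .len v3) (.letIn (.get (.snd v1) v0)
        (.pair (.ite (.eq (.fst (.get (.fst v2) v1)) (v8 + .lit 1))
          (.ite (.eq (.fst (.get (.fst v2) (.fst v0))) (.lit 1)) (.lit 1) (.lit 0)) (.lit 0))
          (.snd v0))))))
      (call5 hitP v0 (.len v2) v6 v4 v5))

/-- The work of `levelP`. -/
def levelCost (g : List (List (ℕ × ℝ))) (s i : ℕ) : ℕ :=
  s * treeCost g i + (6 * Nat.clog 2 g.length + 1) * ((i + 1) * ((Nat.clog 2 g.length + 1) *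
    (16 * (s * g.length * (2 ^ i * 2 ^ i) + g.length))))

/-- The depth of `levelP`. -/
def levelDepth (n i : ℕ) : ℕ :=
  (2 ^ i + 1) * (Nat.clog 2 n + 1) +
    (6 * Nat.clog 2 n + 1) * ((i + 1) * ((Nat.clog 2 n + 1) * (2 * Nat.clog 2 n + 1)))

/-- The family of sets in `levelP`: the set with index `a * n + y` consists of `y` and its first
`2 ^ i - 1` predecessors in the tree of the vertex `S[a]`. It is alive if the length of `y` has
`2 ^ i` edges and the predecessors lead to the root. -/
def IsFamily (g : List (List (ℕ × ℝ))) (S : List ℕ) (i : ℕ) (F : List (ℕ × List ℕ)) : Prop :=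
  F.length = S.length * g.length ∧ ∀ a < S.length, ∀ y < g.length, ∃ D par,
    IsDistArray g (S.getD a 0) (2 ^ i) D ∧ IsPar g D par ∧
    (flg F (a * g.length + y) ≠ 0 ↔ (D.getD y (0, 0)).1 = 2 ^ i + 1 ∧
      (D.getD ((fun u => par.getD u 0)^[2 ^ i] y) (0, 0)).1 = 1) ∧
    ∀ j < 2 ^ i, vtx F (a * g.length + y) j = (fun u => par.getD u 0)^[j] y

section Family

variable {g : List (List (ℕ × ℝ))} {S : List ℕ} {F : List (ℕ × List ℕ)} {i : ℕ}

theorem IsFamily.exists_index (h : IsFamily g S i F) {P : ℕ} (hP : P < F.length) :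
    ∃ a < S.length, ∃ y < g.length, P = a * g.length + y := by
  rw [h.1] at hP
  have hn : 0 < g.length := Nat.pos_of_ne_zero fun h0 => by simp [h0] at hP
  exact ⟨P / g.length, Nat.div_lt_of_lt_mul (by rwa [mul_comm] at hP), P % g.length,
    Nat.mod_lt _ hn, (Nat.div_add_mod' _ _).symm⟩

theorem IsFamily.vtx_lt (h : IsFamily g S i F) (hg : WF g) :
    ∀ P < F.length, ∀ j < 2 ^ i, vtx F P j < g.length := by
  intro P hP j hj
  obtain ⟨a, ha, y, hy, rfl⟩ := h.exists_index hP
  obtain ⟨D, par, -, h2, -, h4⟩ := h.2 a ha y hy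
  rw [h4 j hj]
  exact h2.iterate_lt hg j hy

theorem IsFamily.injective (h : IsFamily g S i F) (hg : WF g) :
    ∀ P < F.length, flg F P ≠ 0 → ∀ j < 2 ^ i, ∀ j' < 2 ^ i, vtx F P j = vtx F P j' → j = j' := by
  intro P hP hf j hj j' hj' he
  obtain ⟨a, ha, y, hy, rfl⟩ := h.exists_index hP
  obtain ⟨D, par, -, h2, h3, h4⟩ := h.2 a ha y hy
  rw [h4 j hj, h4 j' hj'] at he
  obtain ⟨f1, f2⟩ := h3.1 hf
  have e1 := h2.fst_iterate hg hy f1 f2 j hj.le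
  have e2 := h2.fst_iterate hg hy f1 f2 j' hj'.le
  rw [he, e2] at e1
  omega

/-- A shortest walk with `2 * H` edges can be changed such that it passes through a vertex of `S`
within its first `H` edges, and the ends of the next `H` edges form a set of the family. -/
theorem IsFamily.meets (h : IsFamily g S i F) (hg : WF g) (hS : ∀ z ∈ S, z < g.length)
    (hm : Meets g (2 ^ i) S) {Z : List ℕ}
    (hZ : ∀ P < F.length, flg F P ≠ 0 → ∃ j < 2 ^ i, vtx F P j ∈ Z) : Meets g (2 ^ (i + 1)) Z := by
  intro u v p hu hp hk
  have hpow : 2 ^ (i + 1) = 2 ^ i + 2 ^ i := by rw [pow_succ]; omega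
  obtain ⟨m, p₁, p₂, h1, h2, h3, h4⟩ := hp.split (j := 2 ^ i) (by omega)
  obtain ⟨z, hz, q₁, q₂, k1, k2, k3⟩ := hm u m p₁ hu h1 h4
  have hzn := hS z hz
  have hq : (ofLex q₁).2 ≤ 2 ^ i := by
    have := congrArg (fun q => (ofLex q).2) k3
    simp only [ofLex_add, Prod.snd_add] at this
    omega
  have hp' : p = q₁ + (q₂ + p₂) := by rw [h3, k3, add_assoc]
  have k4 : IsDist (GEdge g) z v (q₂ + p₂) :=
    IsDist.right (hp' ▸ hp) k1.walk (k2.walk.append h2.walk)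
  -- at least `2 ^ i` edges are left after `z`
  obtain ⟨y, r₁, r₂, l1, l2, l3, l4⟩ := k4.split (j := 2 ^ i) (by
    have := congrArg (fun q => (ofLex q).2) hp'
    rw [ofLex_add, Prod.snd_add] at this
    omega)
  have hyn := l1.walk.lt_length hzn
  obtain ⟨a, ha, rfl⟩ := List.getElem_of_mem hz
  obtain ⟨D, par, f1, f2, f3, f4⟩ := h.2 a ha y hyn
  rw [List.getD_eq_getElem _ _ ha] at f1
  have back := f1.walk_back f2 hg hzn l1 l4.le
  -- the tree of `z` contains a shortest walk to `y`, so that this set is alive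
  have hf : flg F (a * g.length + y) ≠ 0 := by
    refine f3.2 ⟨?_, ?_⟩
    · obtain ⟨p', q', -, -, -, b4, b5, b6, -⟩ := back 0 (by omega)
      rw [← b6, l4] at b4
      simp only [toLen, ofLex_toLex, Function.iterate_zero, id_eq] at b4 b5
      omega
    · obtain ⟨p', q', -, -, -, b4, b5, b6, -⟩ := back (2 ^ i) l4.ge
      rw [← b6, l4] at b4
      simp only [toLen, ofLex_toLex] at b4 b5
      omega
  obtain ⟨j, hj, hjZ⟩ := hZ (a * g.length + y) (by
    rw [h.1]
    calc a * g.length + y < a * g.length + g.length := by omega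
      _ = (a + 1) * g.length := by ring
      _ ≤ _ := Nat.mul_le_mul_right _ ha) hf
  rw [f4 j hj] at hjZ
  obtain ⟨p', q', b1, b2, b3, -⟩ := back j (by omega)
  have hp'' : p = (q₁ + p') + (q' + r₂) := by rw [hp', l3, b3]; abel
  have w1 := k1.walk.append b1.walk
  have w2 := b2.walk.append l2.walk
  exact ⟨_, hjZ, _, _, IsDist.left (hp'' ▸ hp) w1 w2, IsDist.right (hp'' ▸ hp) w1 w2, hp''⟩

end Family

/-- The properties of the sets of vertices on the levels. The constant is twice that of
`IsHittingSet`, since a set for walks with `2 ^ (i + 1)` edges hits sets of size `2 ^ i`. -/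
structure IsLevel (g : List (List (ℕ × ℝ))) (i : ℕ) (S : List ℕ) : Prop where
  lt : ∀ z ∈ S, z < g.length
  length_le : S.length ≤ g.length
  length_mul_le : S.length * 2 ^ i ≤ 36 * g.length * Nat.clog 2 g.length
  meets : Meets g (2 ^ i) S

theorem levelP_runs {w n L i : ℕ} {g : List (List (ℕ × ℝ))} {S : List ℕ} (hg : WF g)
    (hdeg : ∀ v, (g.getD v []).length ≤ g.length) (hn' : g.length = n) (hL : Nat.clog 2 n = L)
    (hn : 2 ≤ n) (hi : 2 ^ i ≤ n) (hw : 8 * n ^ 5 + 64 < 2 ^ w) (hS : IsLevel g i S) :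
    Runs w levelP (g, S, i, 2 ^ i, L, ()) (IsLevel g (i + 1))
      (levelCost g S.length i) (levelDepth n i) := by
  have hL1 : 1 ≤ L := hL ▸ Nat.clog_pos one_lt_two hn
  have hn5 : n ≤ n ^ 5 ∧ n * n ≤ n ^ 5 := by
    have h1 : n ^ 5 = n * n * (n * (n * n)) := by ring
    have h2 : n ≤ n * n := Nat.le_mul_of_pos_left _ (by omega)
    have h3 : n * n ≤ n * n * (n * (n * n)) := Nat.le_mul_of_pos_right _ (by positivity)
    omega
  have hlS : S.length ≤ n := hn' ▸ hS.length_le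
  have hSn : S.length * n ≤ n * n := Nat.mul_le_mul_right _ hlS
  have hi0 := Nat.one_le_two_pow (n := i)
  have hw0 : 0 < w := pos_of_lt_two_pow hw (by omega)
  have m1 := one_mod hw0
  have k1 : S.length % 2 ^ w = S.length := Nat.mod_eq_of_lt (by omega)
  have k2 : n % 2 ^ w = n := Nat.mod_eq_of_lt (by omega)
  have k3 : S.length * n % 2 ^ w = S.length * n := Nat.mod_eq_of_lt (by omega)
  have k4 : (2 ^ i + 1) % 2 ^ w = 2 ^ i + 1 := Nat.mod_eq_of_lt (by omega)
  have hc : levelCost g S.length i = S.length * treeCost g i + (6 * L + 1) * ((i + 1) *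
    ((L + 1) * (16 * (S.length * n * (2 ^ i * 2 ^ i) + n)))) := by rw [levelCost, hn', hL]
  have hc1 : 16 * (S.length * n * (2 ^ i * 2 ^ i) + n) ≤ (6 * L + 1) * ((i + 1) *
      ((L + 1) * (16 * (S.length * n * (2 ^ i * 2 ^ i) + n)))) := by
    have h1 : 0 < (6 * L + 1) * ((i + 1) * (L + 1)) := by positivity
    exact (Nat.le_mul_of_pos_left _ h1).trans_eq (by ring)
  have hc2 : S.length * n ≤ S.length * n * (2 ^ i * 2 ^ i) :=
    Nat.le_mul_of_pos_right _ (by positivity)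
  have hd : levelDepth n i = (2 ^ i + 1) * (L + 1) +
    (6 * L + 1) * ((i + 1) * ((L + 1) * (2 * L + 1))) := by rw [levelDepth, hL]
  have hd1 : 1 ≤ (2 ^ i + 1) * (L + 1) := Nat.mul_pos (by omega) (by omega)
  refine Runs.letIn (Q := fun R : List (List (ℕ × ℝ) × List (ℕ × List ℕ)) =>
    R.length = S.length ∧ ∀ a < S.length, IsTree g (S.getD a 0) i (R.getD a ([], []))) ?_ ?_
  · refine (Runs.tab (a := .prod (.arr dTy) (.arr (.prod .word (.arr .word)))) (ℓ := S.length)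
      (Q := fun a v => IsTree g (S.getD a 0) i v) (u := fun _ => treeCost g i) ?_ ?_
      ?_).imp fun _ h => ⟨h.1, h.2⟩
    · exact Runs.of_flat rfl (by omega) (by omega) (by simp [k1])
    · intro a ha
      have haS : S.getD a 0 < n := by
        rw [List.getD_eq_getElem _ _ ha]; exact hn' ▸ hS.lt _ (List.getElem_mem ha)
      have hT := treeP_runs (w := w) (x := S.getD a 0) (i := i) hg hdeg (hn' ▸ haS) (by omega)
      rw [hn', hL] at hT
      replace hT := hT.mono (D' := levelDepth n i) (fun _ h => h) le_rfl (by omega)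
      have hT1 := hT.one_le.1
      refine Runs.call4 (Q₁ := fun v => v = g) (Q₂ := fun v => v = S.getD a 0)
        (Q₃ := fun v => v = i) (Q₄ := fun v => v = 2 ^ i) ?_ ?_ ?_ ?_ ?_
      · exact Runs.of_flat rfl hT1 (by omega) rfl
      · exact Runs.of_flat rfl hT1 (by omega) rfl
      · exact Runs.of_flat rfl hT1 (by omega) rfl
      · exact Runs.of_flat rfl hT1 (by omega) rfl
      · rintro _ _ _ _ rfl rfl rfl rfl
        exact hT
    · simp only [Finset.sum_const, Finset.card_range, smul_eq_mul]
      omega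
  rintro (R : List (List (ℕ × ℝ) × List (ℕ × List ℕ))) ⟨hRl, hR⟩
  refine Runs.letIn (Q := IsFamily g S i) ?_ ?_
  · refine (Runs.tab (a := .prod .word (.arr .word)) (ℓ := S.length * n)
      (Q := fun P (v : ℕ × List ℕ) => v =
        (if ((R.getD (P / n) ([], [])).1.getD (P % n) (0, 0)).1 = 2 ^ i + 1 ∧
          ((R.getD (P / n) ([], [])).1.getD
            ((R.getD (P / n) ([], [])).2.getD (P % n) (0, [])).1 (0, 0)).1 = 1 then 1 else 0,
          ((R.getD (P / n) ([], [])).2.getD (P % n) (0, [])).2)) (u := fun _ => 1)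
      ?_ ?_ ?_).imp ?_
    · exact Runs.of_flat rfl (by omega) (by omega) (by simp [k1, k2, k3, hn'])
    · intro P hP
      have hn0 : 0 < n := by omega
      have e1 : P / n % 2 ^ w = P / n :=
        Nat.mod_eq_of_lt ((Nat.div_le_self _ _).trans_lt (by omega))
      have e2 : P % n % 2 ^ w = P % n := Nat.mod_eq_of_lt ((Nat.mod_lt _ hn0).trans (by omega))
      refine Runs.letIn (Q := fun v => v = R.getD (P / n) ([], [])) ?_ ?_
      · refine Runs.of_flat rfl (by omega) (by omega) ?_
        simp only [val_get, val_div, val_len, val_var, get_zero, get_succ, hn', k2, e1]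
        rfl
      rintro _ rfl
      refine Runs.letIn (Q := fun v => v = P % n) ?_ ?_
      · refine Runs.of_flat rfl (by omega) (by omega) ?_
        simp only [val_mod, val_len, val_var, get_zero, get_succ, hn', k2, e2]
      rintro _ rfl
      refine Runs.letIn (Q := fun v => v = (R.getD (P / n) ([], [])).2.getD (P % n) (0, [])) ?_ ?_
      · exact Runs.of_flat rfl (by omega) (by omega) rfl
      rintro _ rfl
      refine Runs.of_flat rfl le_rfl (by omega) ?_
      simp only [val_pair, val_ite, val_eq, val_fst, val_snd, val_get, val_add, val_lit, val_var,
        get_zero, get_succ, m1, k4, Nat.zero_mod]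
      rw [show (Ty.dflt dTy) = ((0, 0) : ℕ × ℝ) from rfl]
      generalize R.getD (P / n) ([], []) = tr
      by_cases h1 : (tr.1.getD (P % n) (0, 0)).1 = 2 ^ i + 1 <;>
        by_cases h2 : (tr.1.getD (tr.2.getD (P % n) (0, [])).1 (0, 0)).1 = 1 <;>
        simp [h1, h2, m1, -List.getD_eq_getElem?_getD]
    · simp only [Finset.sum_const, Finset.card_range, smul_eq_mul]; omega
    · rintro (F : List (ℕ × List ℕ)) ⟨hF1, hF2⟩
      refine ⟨by rw [hF1, hn'], fun a ha y hy => ?_⟩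
      rw [hn'] at hy
      have hP : a * n + y < S.length * n :=
        calc a * n + y < a * n + n := by omega
          _ = (a + 1) * n := by ring
          _ ≤ _ := Nat.mul_le_mul_right _ ha
      have e1 : (a * n + y) / n = a := by
        rw [mul_comm, Nat.mul_add_div (by omega), Nat.div_eq_of_lt hy, add_zero]
      have e2 : (a * n + y) % n = y := by
        rw [mul_comm, Nat.mul_add_mod, Nat.mod_eq_of_lt hy]
      have hF := hF2 _ hP
      rw [e1, e2] at hF
      obtain ⟨hB, par, hp, hit⟩ := hR a ha
      have hy' : y < par.length := by rw [hp.1, hn']; exact hy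
      rw [hit.2 y hy'] at hF
      refine ⟨_, par, hB.isDistArray, hp, ?_, fun j hj => ?_⟩
      · have : flg F (a * n + y) = _ := congrArg Prod.fst hF
        rw [hn', this]
        dsimp only
        split_ifs with h <;> simp [h, -List.getD_eq_getElem?_getD]
      · have : vtx F (a * n + y) j = (_ : List ℕ).getD j 0 :=
          congrArg (fun v : ℕ × List ℕ => v.2.getD j 0) hF
        rw [hn', this, List.getD_eq_getElem _ _ (by simpa using hj)]
        simp
  rintro (F : List (ℕ × List ℕ)) hF
  have hlen : F.length = S.length * n := hn' ▸ hF.1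
  have hsz : Sizes w n (2 ^ i) (2 * L) F := by
    refine ⟨by omega, hi0, hi, by omega, hw, ?_, by omega, hn' ▸ hF.vtx_lt hg⟩
    refine Nat.clog_le_of_le_pow ?_
    have h2 : n ≤ 2 ^ L := hL ▸ Nat.le_pow_clog one_lt_two n
    calc F.length ≤ n * n := by omega
      _ ≤ 2 ^ L * 2 ^ L := Nat.mul_le_mul h2 h2
      _ = _ := by rw [← pow_add, two_mul]
  have hpc : passCost F (2 ^ i) n = 16 * (S.length * n * (2 ^ i * 2 ^ i) + n) := by
    rw [passCost, hlen]
  have hH := hitP_runs hsz rfl hn (hF.injective hg)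
  rw [hpc, hL] at hH
  replace hH := hH.mono (U' := levelCost g S.length i) (D' := levelDepth n i)
    (Q' := IsLevel g (i + 1))
    (fun Z hZ => ?_) (by omega) (by omega)
  case refine_1 =>
    refine ⟨hn'.symm ▸ hZ.lt, hn'.symm ▸ hZ.length_le, ?_, hF.meets hg hS.lt hS.meets hZ.hit⟩
    have := hZ.mul_length_le
    rw [hn']
    calc Z.length * 2 ^ (i + 1) = 2 * (2 ^ i * Z.length) := by ring
      _ ≤ 2 * (18 * n * Nat.clog 2 n) := Nat.mul_le_mul_left _ this
      _ = _ := by ring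
  refine Runs.call5 (Q₁ := fun v => v = F) (Q₂ := fun v => v = n) (Q₃ := fun v => v = L)
    (Q₄ := fun v => v = i) (Q₅ := fun v => v = 2 ^ i) ?_ ?_ ?_ ?_ ?_ ?_
  · exact Runs.of_flat rfl (by omega) (by omega) rfl
  · exact Runs.of_flat rfl (by omega) (by omega) (by simp [k2, hn'])
  · exact Runs.of_flat rfl (by omega) (by omega) rfl
  · exact Runs.of_flat rfl (by omega) (by omega) rfl
  · exact Runs.of_flat rfl (by omega) (by omega) rfl
  rintro _ _ _ _ _ rfl rfl rfl rfl rfl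
  exact hH

/-- The sets of all levels up to `K`: the result consists of `2 ^ K` and a set that meets all
shortest walks with `2 ^ K` edges. The last argument is the logarithm of the number of vertices. -/
def levelsP : Prog [gTy, .word, .word] (.prod .word (.arr .word)) :=
  .loop v1 (.pair (.lit 1) (.tab (.len v0) v0))
    (.pair (.fst v1 + .fst v1) (call5 levelP v2 (.snd v1) v0 (.fst v1) v4))

/-- The bound on the size of the set cancels the number `2 ^ i` of rounds in the work for the trees,
and one of the two factors `2 ^ i` in the work for the hitting set. -/
theorem levelCost_le {g : List (List (ℕ × ℝ))} {n L s i h : ℕ} (hn : g.length = n)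
    (hL : Nat.clog 2 n = L) (hL1 : 1 ≤ L) (hn2 : 2 ≤ n) (hi : 2 ^ i ≤ n) (hih : 2 ^ i ≤ h)
    (hs : s * 2 ^ i ≤ 36 * n * L) :
    levelCost g s i ≤ 36 * n * L * (8 * numE g + 6 * n) + 16576 * (L ^ 4 * (n ^ 2 * h)) := by
  have hi' := i.lt_two_pow_self
  have hiL : i ≤ L := by
    have h1 : 2 ^ i ≤ 2 ^ L := hi.trans (hL ▸ Nat.le_pow_clog one_lt_two n)
    exact (Nat.pow_le_pow_iff_right one_lt_two).1 h1
  have h1 : treeCost g i ≤ 2 ^ i * (8 * numE g + 6 * n) := by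
    rw [treeCost, hn]
    have h2 : (2 ^ i + 1) * (4 * numE g + n) ≤ 2 ^ i * (8 * numE g + 2 * n) := by
      calc (2 ^ i + 1) * (4 * numE g + n) ≤ (2 * 2 ^ i) * (4 * numE g + n) :=
            Nat.mul_le_mul_right _ (by omega)
        _ = _ := by ring
    have h3 : 2 ^ i * 2 ≤ 2 ^ i * n := Nat.mul_le_mul_left _ hn2
    have h4 : 2 ^ i * (8 * numE g + 6 * n) =
      2 ^ i * (8 * numE g + 2 * n) + n * (3 * 2 ^ i) + 2 ^ i * n := by ring
    omega
  have h2 : s * treeCost g i ≤ 36 * n * L * (8 * numE g + 6 * n) := by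
    calc s * treeCost g i ≤ s * (2 ^ i * (8 * numE g + 6 * n)) := Nat.mul_le_mul_left _ h1
      _ = s * 2 ^ i * (8 * numE g + 6 * n) := by ring
      _ ≤ _ := Nat.mul_le_mul_right _ hs
  have hh : 1 ≤ h := (Nat.one_le_two_pow).trans hih
  have h3 : s * n * (2 ^ i * 2 ^ i) + n ≤ 37 * (n * n * L * h) := by
    have h4 : s * n * (2 ^ i * 2 ^ i) ≤ 36 * (n * n * L * h) := by
      calc s * n * (2 ^ i * 2 ^ i) = s * 2 ^ i * (n * 2 ^ i) := by ring
        _ ≤ 36 * n * L * (n * h) := Nat.mul_le_mul hs (Nat.mul_le_mul_left _ hih)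
        _ = _ := by ring
    have h5 : n * 1 ≤ n * (n * L * h) := Nat.mul_le_mul_left _ (by
      have : 0 < n * L * h := by positivity
      omega)
    have h6 : n * n * L * h = n * (n * L * h) := by ring
    omega
  have h4 : (6 * L + 1) * ((i + 1) * ((L + 1) * (16 * (s * n * (2 ^ i * 2 ^ i) + n)))) ≤
      7 * L * (2 * L * (2 * L * (16 * (37 * (n * n * L * h))))) := by
    gcongr <;> omega
  rw [levelCost, hn, hL]
  refine Nat.add_le_add h2 (h4.trans_eq (by ring))

theorem levelDepth_le {n L i : ℕ} (hL : Nat.clog 2 n = L) (hL1 : 1 ≤ L) (hi : 2 ^ i ≤ n) :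
    levelDepth n i ≤ 2 ^ i * (2 * L) + 86 * L ^ 4 := by
  have hiL : i ≤ L := by
    have h1 : 2 ^ i ≤ 2 ^ L := hi.trans (hL ▸ Nat.le_pow_clog one_lt_two n)
    exact (Nat.pow_le_pow_iff_right one_lt_two).1 h1
  have h1 : (6 * L + 1) * ((i + 1) * ((L + 1) * (2 * L + 1))) ≤
      7 * L * (2 * L * (2 * L * (3 * L))) := by gcongr <;> omega
  have h2 : 2 ^ i * (L + 1) ≤ 2 ^ i * (2 * L) := Nat.mul_le_mul_left _ (by omega)
  have h3 : L ≤ L ^ 4 := Nat.le_self_pow (by norm_num) L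
  have h4 : 7 * L * (2 * L * (2 * L * (3 * L))) = 84 * L ^ 4 := by ring
  rw [levelDepth, hL, Nat.add_mul]
  omega

theorem isLevel_zero {g : List (List (ℕ × ℝ))} (hn2 : 2 ≤ g.length) :
    IsLevel g 0 (List.range g.length) := by
  refine ⟨fun z hz => List.mem_range.1 hz, by simp, ?_, ?_⟩
  · have : 1 ≤ Nat.clog 2 g.length := Nat.clog_pos one_lt_two hn2
    have h2 := Nat.mul_le_mul_left (36 * g.length) this
    simp only [List.length_range, pow_zero, mul_one] at h2 ⊢
    omega
  · intro u v p hu hp _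
    refine ⟨u, List.mem_range.2 hu, 0, p, ?_, hp, by simp⟩
    exact IsDist.left (z := v) (q := p) (by simpa using hp) Walk.nil hp.walk

theorem levelsP_runs {w n L K h : ℕ} {g : List (List (ℕ × ℝ))} (hg : WF g)
    (hdeg : ∀ v, (g.getD v []).length ≤ g.length) (hn' : g.length = n) (hL : Nat.clog 2 n = L)
    (hn : 2 ≤ n) (hK : ∀ i < K, 2 ^ i ≤ h) (hh : h ≤ n) (hw : 8 * n ^ 5 + 64 < 2 ^ w) :
    Runs w levelsP (g, K, L, ()) (fun x : ℕ × List ℕ => x.1 = 2 ^ K ∧ IsLevel g K x.2)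
      (K * (36 * n * L * (8 * numE g + 6 * n) + 16576 * (L ^ 4 * (n ^ 2 * h))) + n + 1)
      (2 ^ K * (2 * L) + K * (86 * L ^ 4) + 1) := by
  have hL1 : 1 ≤ L := hL ▸ Nat.clog_pos one_lt_two hn
  have hn5 : n ≤ n ^ 5 := Nat.le_self_pow (by norm_num) n
  have hw0 : 0 < w := pos_of_lt_two_pow hw (by omega)
  have m1 := one_mod hw0
  have k1 : n % 2 ^ w = n := Nat.mod_eq_of_lt (by omega)
  refine Runs.loop (a := .prod .word (.arr .word)) (ℓ := K)
    (I := fun i (x : ℕ × List ℕ) => x.1 = 2 ^ i ∧ IsLevel g i x.2)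
    (u := fun _ => 36 * n * L * (8 * numE g + 6 * n) + 16576 * (L ^ 4 * (n ^ 2 * h)))
    (d := fun i => 2 ^ i * (2 * L) + 86 * L ^ 4) ?_ ?_ ?_ ?_ ?_
  · exact Runs.of_flat rfl (by omega) (by omega) rfl
  · refine Runs.pair (Q₁ := fun x => x = 1) (Q₂ := fun S : List ℕ => S = List.range n) ?_ ?_ ?_
    · exact Runs.of_flat rfl (by omega) (by omega) (by simp [m1])
    · refine (Runs.tab (a := .word) (ℓ := n) (Q := fun v x => x = v) (u := fun _ => 1)
        ?_ ?_ (by simp; omega)).imp ?_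
      · exact Runs.of_flat rfl (by omega) (by omega) (by simp [k1, hn'])
      · intro v hv
        exact Runs.of_flat rfl le_rfl (by omega) rfl
      · rintro S ⟨h1, h2⟩
        refine ext_getD (d := 0) (by simp [h1]) fun i hi => ?_
        rw [h1] at hi
        refine (h2 i hi).trans ?_
        rw [List.getD_eq_getElem _ _ (by simpa using hi)]
        simp
    · rintro _ _ rfl rfl
      exact ⟨rfl, hn' ▸ isLevel_zero (hn'.symm ▸ hn)⟩
  · rintro i hi (⟨H, S⟩ : ℕ × List ℕ) ⟨h1, h2⟩
    dsimp only at h1 h2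
    subst h1
    have hih := hK i hi
    have hin : 2 ^ i ≤ n := hih.trans hh
    have k2 : (2 ^ i + 2 ^ i) % 2 ^ w = 2 ^ i + 2 ^ i := Nat.mod_eq_of_lt (by omega)
    have hrun := (levelP_runs hg hdeg hn' hL hn hin hw h2).mono (fun _ h => h)
      (levelCost_le hn' hL hL1 hn hin hih (by
        have := h2.length_mul_le; rwa [hn', hL] at this))
      (levelDepth_le hL hL1 hin)
    have h3 := hrun.one_le
    refine Runs.pair (Q₁ := fun x => x = 2 ^ i + 2 ^ i) (Q₂ := IsLevel g (i + 1)) ?_ ?_ ?_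
    · exact Runs.of_flat rfl h3.1 h3.2 (by simp [k2])
    · refine Runs.call5 (Q₁ := fun x => x = g) (Q₂ := fun x => x = S) (Q₃ := fun x => x = i)
        (Q₄ := fun x => x = 2 ^ i) (Q₅ := fun x => x = L) ?_ ?_ ?_ ?_ ?_ ?_
      · exact Runs.of_flat rfl h3.1 h3.2 rfl
      · exact Runs.of_flat rfl h3.1 h3.2 rfl
      · exact Runs.of_flat rfl h3.1 h3.2 rfl
      · exact Runs.of_flat rfl h3.1 h3.2 rfl
      · exact Runs.of_flat rfl h3.1 h3.2 rfl
      · rintro _ _ _ _ _ rfl rfl rfl rfl rfl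
        exact hrun
    · rintro _ S' rfl h4
      exact ⟨by rw [pow_succ]; ring, h4⟩
  · simp only [Finset.sum_const, Finset.card_range, smul_eq_mul]
    omega
  · rw [Finset.sum_add_distrib, ← Finset.sum_mul]
    simp only [Finset.sum_const, Finset.card_range, smul_eq_mul]
    have h1 : ∑ i ∈ Finset.range K, 2 ^ i ≤ 2 ^ K := by
      rw [Nat.geomSum_eq le_rfl]; simp
    have := Nat.mul_le_mul_right (2 * L) h1
    omega

/-! ### Shortest walks through the vertices of the last level -/

/-- The least sum of an entry of the first array and the corresponding entry in the column of a
matrix. -/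
def combineP : Prog [.arr dTy, .arr (.arr dTy), .word] dTy :=
  call1 minListP (.tab (.len v0) (call2 addP (.get v1 v0) (.get (.get v2 v0) v3)))

theorem combineP_runs {w z b X Y : ℕ} {x : List (ℕ × ℝ)} {M : List (List (ℕ × ℝ))}
    {S₁ C₁ S₂ C₂ : ℕ → Len → Prop} (hx : x.length = z) (hz : z + 2 < 2 ^ w)
    (hw : X + Y + 8 < 2 ^ w) (h₁ : ∀ c < z, (x.getD c (0, 0)).1 ≤ X + 1 ∧
      Between (S₁ c) (C₁ c) (x.getD c (0, 0)))
    (h₂ : ∀ c < z, ((M.getD c []).getD b (0, 0)).1 ≤ Y + 1 ∧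
      Between (S₂ c) (C₂ c) ((M.getD c []).getD b (0, 0))) :
    Runs w combineP (x, M, b, ()) (fun v : ℕ × ℝ => v.1 ≤ X + Y + 1 ∧
      Between (fun p => ∃ c < z, ∃ p₁ p₂, S₁ c p₁ ∧ S₂ c p₂ ∧ p = p₁ + p₂)
        (fun p => ∃ c < z, ∃ p₁ p₂, C₁ c p₁ ∧ C₂ c p₂ ∧ p = p₁ + p₂) v)
      (4 * z + 1) (Nat.clog 2 z + 1) := by
  have k1 : z % 2 ^ w = z := Nat.mod_eq_of_lt (by omega)
  refine Runs.call1 (Q₁ := fun l : List (ℕ × ℝ) => l.length = z ∧ ∀ c < z, l.getD c (0, 0) =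
    addD (x.getD c (0, 0)) ((M.getD c []).getD b (0, 0))) ?_ ?_
  · refine Runs.tab (a := dTy) (ℓ := z) (Q := fun c v => v =
      addD (x.getD c (0, 0)) ((M.getD c []).getD b (0, 0))) (u := fun _ => 1) ?_ ?_
      (by simp; omega)
    · exact Runs.of_flat rfl (by omega) (by omega) (by simp [hx, k1])
    · intro c hc
      refine Runs.call2 (Q₁ := fun v => v = x.getD c (0, 0))
        (Q₂ := fun v => v = (M.getD c []).getD b (0, 0)) ?_ ?_ ?_
      · exact Runs.of_flat rfl le_rfl (by omega) rfl
      · exact Runs.of_flat rfl le_rfl (by omega) rfl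
      · rintro _ _ rfl rfl
        have a1 := (h₁ c hc).1
        have a2 := (h₂ c hc).1
        exact (addP_runs (by omega)).mono (fun _ h => h) le_rfl (by omega)
  · rintro (l : List (ℕ × ℝ)) ⟨hl, hlc⟩
    refine (minListP_runs (by omega)).mono (fun v hv => ?_) (by omega) (by rw [hl])
    have hmem : ∀ a ∈ l, ∃ c < z, a = addD (x.getD c (0, 0)) ((M.getD c []).getD b (0, 0)) := by
      intro a ha
      obtain ⟨c, hc, rfl⟩ := List.getElem_of_mem ha
      have h3 := hlc c (hl ▸ hc)
      rw [List.getD_eq_getElem _ _ hc] at h3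
      exact ⟨c, hl ▸ hc, h3⟩
    constructor
    · rcases hv.1 with rfl | hv'
      · simp
      · obtain ⟨c, hc, rfl⟩ := hmem _ hv'
        have a1 := (h₁ c hc).1
        have a2 := (h₂ c hc).1
        unfold addD
        split_ifs <;> simp only [Nat.zero_le]
        omega
    · refine Between.of_min hv ?_ ?_
      · intro a ha ha0
        obtain ⟨c, hc, rfl⟩ := hmem _ ha
        have ha1 := addD_ne_zero.1 ha0
        exact ⟨c, hc, _, _, (h₁ c hc).2.1 ha1.1, (h₂ c hc).2.1 ha1.2, toLen_addD ha1.1 ha1.2⟩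
      · rintro p ⟨c, hc, p₁, p₂, hp₁, hp₂, rfl⟩
        obtain ⟨b1, b2⟩ := (h₁ c hc).2.2 p₁ hp₁
        obtain ⟨b3, b4⟩ := (h₂ c hc).2.2 p₂ hp₂
        refine ⟨l.getD c (0, 0), ?_, ?_, ?_⟩
        · rw [List.getD_eq_getElem _ _ (hl.symm ▸ hc)]
          exact List.getElem_mem _
        · rw [hlc c hc]; exact addD_ne_zero.2 ⟨b1, b3⟩
        · rw [hlc c hc, toLen_addD b1 b3]; exact add_le_add b2 b4

/-- The edges of the graph on the indices of an array `Z` of vertices: walks with at most `N` edges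
between the vertices. -/
def ZEdge (g : List (List (ℕ × ℝ))) (Z : List ℕ) (N a b : ℕ) (p : Len) : Prop :=
  a < Z.length ∧ b < Z.length ∧ ∃ k ≤ N, Walk (GEdge g) (Z.getD a 0) k (Z.getD b 0) p

theorem Walk.lt_of_zEdge {g : List (List (ℕ × ℝ))} {Z : List ℕ} {N a b r : ℕ} {p : Len}
    (h : Walk (ZEdge g Z N) a r b p) (ha : a < Z.length) : b < Z.length := by
  cases h with
  | nil => exact ha
  | snoc _ e => exact e.2.1

/-- Shortest walks decompose into walks between vertices of `Z` with at most `2 * H` edges, if `Z`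
meets all shortest walks with `H` edges: the next vertex is found among the second `H` edges. -/
theorem exists_zEdge_walk {g : List (List (ℕ × ℝ))} {Z : List ℕ} {H : ℕ} (hH : 1 ≤ H)
    (hZ : ∀ z ∈ Z, z < g.length) (hm : Meets g H Z) :
    ∀ (k a t : ℕ) (p : Len), a < Z.length → IsDist (GEdge g) (Z.getD a 0) t p → (ofLex p).2 ≤ k →
      ∃ b r p₁ p₂, b < Z.length ∧ r ≤ k ∧ Walk (ZEdge g Z (2 * H)) a r b p₁ ∧
        (∃ j ≤ 2 * H, Walk (GEdge g) (Z.getD b 0) j t p₂) ∧ p = p₁ + p₂ := by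
  intro k
  induction k with
  | zero =>
    intro a t p ha hp hk
    exact ⟨a, 0, 0, p, ha, le_rfl, .nil, ⟨_, by omega, hp.walk⟩, by simp⟩
  | succ k ih =>
    intro a t p ha hp hk
    by_cases hN : (ofLex p).2 ≤ 2 * H
    · exact ⟨a, 0, 0, p, ha, by omega, .nil, ⟨_, hN, hp.walk⟩, by simp⟩
    have haZ : Z.getD a 0 < g.length := by
      rw [List.getD_eq_getElem _ _ ha]; exact hZ _ (List.getElem_mem ha)
    obtain ⟨m, p₁, q, h1, h2, rfl, h3⟩ := hp.split (j := H) (by omega)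
    rw [ofLex_add, Prod.snd_add] at hk hN
    obtain ⟨m', p₂, p₃, h4, h5, rfl, h6⟩ := h2.split (j := H) (by omega)
    rw [ofLex_add, Prod.snd_add] at hk hN
    obtain ⟨z, hz, q₁, q₂, k1, k2, rfl⟩ := hm m m' p₂ (h1.walk.lt_length haZ) h4 h6
    rw [ofLex_add, Prod.snd_add] at hk hN h6
    obtain ⟨b, hb, rfl⟩ := List.getElem_of_mem hz
    have w1 := h1.walk.append k1.walk
    have w2 := k2.walk.append h5.walk
    have he : p₁ + (q₁ + q₂ + p₃) = (p₁ + q₁) + (q₂ + p₃) := by abel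
    rw [he] at hp ⊢
    have hd := hp.right w1 w2
    rw [← List.getD_eq_getElem _ 0 hb] at hd w1
    obtain ⟨c, r, s₁, s₂, i1, i2, i3, i4, i5⟩ := ih b t _ hb hd (by
      rw [ofLex_add, Prod.snd_add]; omega)
    refine ⟨c, 1 + r, (p₁ + q₁) + s₁, s₂, i1, by omega, ?_, i4, by rw [i5, ← add_assoc]⟩
    exact (Walk.single ⟨ha, hb, _, by omega, w1⟩).append i3

/-- The lengths of shortest walks from `Z[0]`, for an array `Z` of vertices as in
`exists_zEdge_walk`; the arguments after it are the number `2 * H` and the number of squarings. -/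
def finalP : Prog [gTy, .arr .word, .word, .word] (.arr dTy) :=
  .letIn (.tab (.len v1) (call3 bellmanFordP v1 (.get v2 v0) v3))
    (.letIn (.loop v4 (.tab (.len v2) (.tab (.len v3) (.get (.get v2 v1) (.get v4 v0))))
        (.tab (.len v1) (.tab (.len v2) (call3 combineP (.get v3 v1) v3 v0))))
      (.tab (.len v2) (call3 combineP (.get v1 (.lit 0)) v2 v0)))

/-- The work of `finalP`. -/
def finalCost (g : List (List (ℕ × ℝ))) (z N L : ℕ) : ℕ :=
  z * ((N + 1) * (4 * numE g + g.length)) + (L + 1) * (z * (z * (4 * z + 1))) +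
    g.length * (4 * z + 1)

/-- The depth of `finalP`. -/
def finalDepth (n N L : ℕ) : ℕ :=
  (N + 1) * (Nat.clog 2 n + 1) + (L + 1) * (Nat.clog 2 n + 2)

theorem finalP_runs {w n L H : ℕ} {g : List (List (ℕ × ℝ))} {Z : List ℕ} (hg : WF g)
    (hdeg : ∀ v, (g.getD v []).length ≤ g.length) (hn' : g.length = n) (hn : 2 ≤ n)
    (hH : 1 ≤ H) (hZ : ∀ z ∈ Z, z < g.length) (hm : Meets g H Z) (hZ1 : 1 ≤ Z.length)
    (hZn : Z.length ≤ n + 1) (hw : n + 2 * H * 2 ^ (L + 1) + 16 < 2 ^ w) :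
    Runs w finalP (g, Z, 2 * H, L, ()) (fun D => D.length = n ∧
      (∀ t < n, (D.getD t (0, 0)).1 ≤ 2 * H * 2 ^ L + 2 * H + 1) ∧
      IsDistArray g (Z.getD 0 0) (2 ^ L) D)
      (finalCost g Z.length (2 * H) L) (finalDepth n (2 * H) L) := by
  set z := Z.length with hz
  set N := 2 * H with hN
  have hL0 := Nat.one_le_two_pow (n := L)
  have hpow : N * 2 ^ (L + 1) = N * 2 ^ L + N * 2 ^ L := by rw [pow_succ]; ring
  have hNL : N ≤ N * 2 ^ L := Nat.le_mul_of_pos_right _ hL0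
  have hw0 : 0 < w := pos_of_lt_two_pow hw (by omega)
  have k1 : z % 2 ^ w = z := Nat.mod_eq_of_lt (by omega)
  have k2 : n % 2 ^ w = n := Nat.mod_eq_of_lt (by omega)
  have hlz : Nat.clog 2 z + 1 ≤ Nat.clog 2 n + 2 := by
    have h1 := Nat.le_pow_clog one_lt_two n
    have h2 : Nat.clog 2 z ≤ Nat.clog 2 n + 1 :=
      Nat.clog_le_of_le_pow (by rw [pow_succ]; omega)
    omega
  have hU : finalCost g z N L = z * ((N + 1) * (4 * numE g + n)) +
      (L + 1) * (z * (z * (4 * z + 1))) + n * (4 * z + 1) := by rw [finalCost, hn']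
  have hU1 : z * (z * (4 * z + 1)) ≤ (L + 1) * (z * (z * (4 * z + 1))) :=
    Nat.le_mul_of_pos_left _ (by omega)
  have hU2 : z * (4 * z + 1) ≤ z * (z * (4 * z + 1)) := Nat.le_mul_of_pos_left _ hZ1
  have hU3 : 4 * z + 1 ≤ z * (4 * z + 1) := Nat.le_mul_of_pos_left _ hZ1
  have hD : finalDepth n N L = (N + 1) * (Nat.clog 2 n + 1) + (L + 1) * (Nat.clog 2 n + 2) := rfl
  have hD1 : Nat.clog 2 n + 2 ≤ (L + 1) * (Nat.clog 2 n + 2) := Nat.le_mul_of_pos_left _ (by omega)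
  have hZlt : ∀ a < z, Z.getD a 0 < n := by
    intro a ha
    rw [List.getD_eq_getElem _ _ ha]; exact hn' ▸ hZ _ (List.getElem_mem _)
  refine Runs.letIn (Q := fun DZ : List (List (ℕ × ℝ)) => DZ.length = z ∧
    ∀ a < z, BFArray g (Z.getD a 0) N (DZ.getD a [])) ?_ ?_
  · refine (Runs.tab (a := .arr dTy) (ℓ := z) (Q := fun a v => BFArray g (Z.getD a 0) N v)
      (u := fun _ => (N + 1) * (4 * numE g + n)) ?_ ?_ ?_).imp fun _ h => ⟨h.1, h.2⟩
    · exact Runs.of_flat rfl (by omega) (by omega) (by simp [← hz, k1])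
    · intro a ha
      have hB := bellmanFordP_runs (w := w) (k := N) hg hdeg (hn'.symm ▸ hZlt a ha) (by omega)
      rw [hn'] at hB
      replace hB := hB.mono (D' := finalDepth n N L) (fun _ h => h) le_rfl (by omega)
      have hB1 := hB.one_le
      refine Runs.call3 (Q₁ := fun v => v = g) (Q₂ := fun v => v = Z.getD a 0)
        (Q₃ := fun v => v = N) ?_ ?_ ?_ ?_
      · exact Runs.of_flat rfl hB1.1 hB1.2 rfl
      · exact Runs.of_flat rfl hB1.1 hB1.2 rfl
      · exact Runs.of_flat rfl hB1.1 hB1.2 rfl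
      · rintro _ _ _ rfl rfl rfl
        exact hB
    · simp only [Finset.sum_const, Finset.card_range, smul_eq_mul]
      omega
  rintro (DZ : List (List (ℕ × ℝ))) ⟨hDZl, hDZ⟩
  -- after `j` squarings, the matrix accounts for walks of up to `2 ^ j` pieces
  refine Runs.letIn (Q := fun M : List (List (ℕ × ℝ)) => M.length = z ∧ ∀ a < z,
    (M.getD a []).length = z ∧ ∀ b < z, ((M.getD a []).getD b (0, 0)).1 ≤ N * 2 ^ L + 1 ∧
      Between (fun p => ∃ k, Walk (GEdge g) (Z.getD a 0) k (Z.getD b 0) p)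
        (fun p => ∃ r ≤ 2 ^ L, Walk (ZEdge g Z N) a r b p) ((M.getD a []).getD b (0, 0))) ?_ ?_
  · refine Runs.loop (a := .arr (.arr dTy)) (ℓ := L) (I := fun j (M : List (List (ℕ × ℝ))) =>
      M.length = z ∧ ∀ a < z,
      (M.getD a []).length = z ∧ ∀ b < z, ((M.getD a []).getD b (0, 0)).1 ≤ N * 2 ^ j + 1 ∧
      Between (fun p => ∃ k, Walk (GEdge g) (Z.getD a 0) k (Z.getD b 0) p)
        (fun p => ∃ r ≤ 2 ^ j, Walk (ZEdge g Z N) a r b p) ((M.getD a []).getD b (0, 0)))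
      (u := fun _ => z * (z * (4 * z + 1))) (d := fun _ => Nat.clog 2 n + 2) ?_ ?_ ?_ ?_ ?_
    · exact Runs.of_flat rfl (by omega) (by omega) rfl
    · refine (Runs.tab (a := .arr dTy) (ℓ := z) (Q := fun a (row : List (ℕ × ℝ)) =>
        row.length = z ∧ ∀ b < z, row.getD b (0, 0) = (DZ.getD a []).getD (Z.getD b 0) (0, 0))
        (u := fun _ => z) ?_ ?_ ?_).imp ?_
      · exact Runs.of_flat rfl (by omega) (by omega) (by simp [← hz, k1])
      · intro a ha
        refine (Runs.tab (a := dTy) (ℓ := z) (Q := fun b v =>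
          v = (DZ.getD a []).getD (Z.getD b 0) (0, 0)) (u := fun _ => 1) ?_ ?_ (by simp)).imp
          fun _ h => ⟨h.1, h.2⟩
        · exact Runs.of_flat rfl (by omega) (by omega) (by simp [← hz, k1])
        · intro b hb
          exact Runs.of_flat rfl le_rfl (by omega) rfl
      · simp only [Finset.sum_const, Finset.card_range, smul_eq_mul]
        have : z * z ≤ z * (z * (4 * z + 1)) :=
          Nat.mul_le_mul_left _ (Nat.le_mul_of_pos_right _ (by omega))
        omega
      · rintro M ⟨h1, h2⟩
        refine ⟨h1, fun a ha => ⟨(h2 a ha).1, fun b hb => ?_⟩⟩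
        have h3 : (M.getD a []).getD b (0, 0) = _ := (h2 a ha).2 b hb
        have h4 := (hDZ a ha).2 _ (hn'.symm ▸ hZlt b hb)
        rw [h3, pow_zero, mul_one]
        refine ⟨h4.1, h4.2.imp (fun _ h => h) ?_⟩
        rintro p ⟨r, hr, hp⟩
        cases hp with
        | nil => exact ⟨0, Nat.zero_le _, .nil⟩
        | snoc hp e =>
          obtain rfl := Nat.le_zero.1 (Nat.le_of_succ_le_succ hr)
          cases hp with
          | nil =>
            obtain ⟨-, -, k, hk, hw⟩ := e
            exact ⟨k, hk, by simpa using hw⟩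
    · rintro j hj (M : List (List (ℕ × ℝ))) ⟨h1, h2⟩
      have hj' : N * 2 ^ j + N * 2 ^ j ≤ N * 2 ^ L := by
        rw [← mul_add, ← two_mul, ← pow_succ']
        exact Nat.mul_le_mul_left _ (Nat.pow_le_pow_right two_pos hj)
      refine (Runs.tab (a := .arr dTy) (ℓ := z) (Q := fun a (row : List (ℕ × ℝ)) =>
        row.length = z ∧ ∀ b < z, (row.getD b (0, 0)).1 ≤ N * 2 ^ (j + 1) + 1 ∧
        Between (fun p => ∃ k, Walk (GEdge g) (Z.getD a 0) k (Z.getD b 0) p)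
        (fun p => ∃ r ≤ 2 ^ (j + 1), Walk (ZEdge g Z N) a r b p) (row.getD b (0, 0)))
        (u := fun _ => z * (4 * z + 1)) ?_ ?_ ?_).imp fun _ h => ⟨h.1, h.2⟩
      · exact Runs.of_flat rfl (by omega) (by omega) (by simp [h1, k1])
      · intro a ha
        refine (Runs.tab (a := dTy) (ℓ := z) (Q := fun b (v : ℕ × ℝ) =>
          v.1 ≤ N * 2 ^ (j + 1) + 1 ∧
          Between (fun p => ∃ k, Walk (GEdge g) (Z.getD a 0) k (Z.getD b 0) p)
          (fun p => ∃ r ≤ 2 ^ (j + 1), Walk (ZEdge g Z N) a r b p) v)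
          (u := fun _ => 4 * z + 1) ?_ ?_ ?_).imp fun _ h => ⟨h.1, h.2⟩
        · exact Runs.of_flat rfl (by omega) (by omega) (by simp [h1, k1])
        · intro b hb
          refine Runs.call3 (Q₁ := fun v => v = M.getD a []) (Q₂ := fun v => v = M)
            (Q₃ := fun v => v = b) ?_ ?_ ?_ ?_
          · exact Runs.of_flat rfl (by omega) (by omega) rfl
          · exact Runs.of_flat rfl (by omega) (by omega) rfl
          · exact Runs.of_flat rfl (by omega) (by omega) rfl
          rintro _ _ _ rfl rfl rfl
          refine (combineP_runs (h2 a ha).1 (by omega)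
            (show N * 2 ^ j + N * 2 ^ j + 8 < 2 ^ w by omega) (h2 a ha).2
            (fun c hc => (h2 c hc).2 _ hb)).mono ?_ le_rfl (by omega)
          rintro (v : ℕ × ℝ) ⟨v1, v2⟩
          refine ⟨by rw [pow_succ, mul_two, mul_add]; exact v1, v2.imp ?_ ?_⟩
          · rintro p ⟨c, hc, p₁, p₂, ⟨r₁, w₁⟩, ⟨r₂, w₂⟩, rfl⟩
            exact ⟨_, w₁.append w₂⟩
          · rintro p ⟨r, hr, hp⟩
            rw [pow_succ] at hr
            obtain ⟨r₁, r₂, rfl, hr₁, hr₂⟩ : ∃ r₁ r₂, r = r₁ + r₂ ∧ r₁ ≤ 2 ^ j ∧ r₂ ≤ 2 ^ j :=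
              ⟨min r (2 ^ j), r - 2 ^ j, by omega, by omega, by omega⟩
            obtain ⟨c, p₁, p₂, w₁, w₂, rfl⟩ := hp.split
            exact ⟨c, w₁.lt_of_zEdge ha, p₁, p₂, ⟨_, hr₁, w₁⟩, ⟨_, hr₂, w₂⟩, rfl⟩
        · simp
      · simp
    · simp only [Finset.sum_const, Finset.card_range, smul_eq_mul]
      have := Nat.mul_le_mul_right (z * (z * (4 * z + 1))) (show L ≤ L + 1 by omega)
      omega
    · simp only [Finset.sum_const, Finset.card_range, smul_eq_mul]
      have := Nat.mul_le_mul_right (Nat.clog 2 n + 2) (show L ≤ L + 1 by omega)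
      omega
  rintro (M : List (List (ℕ × ℝ))) ⟨hMl, hM⟩
  refine (Runs.tab (a := dTy) (ℓ := n) (Q := fun t (v : ℕ × ℝ) => v.1 ≤ N * 2 ^ L + N + 1 ∧
    Between (fun p => ∃ j, Walk (GEdge g) (Z.getD 0 0) j t p)
      (fun p => IsDist (GEdge g) (Z.getD 0 0) t p ∧ (ofLex p).2 ≤ 2 ^ L) v)
    (u := fun _ => 4 * z + 1) ?_ ?_ ?_).imp ?_
  · exact Runs.of_flat rfl (by omega) (by omega) (by simp [hn', k2])
  · intro t ht
    refine Runs.call3 (Q₁ := fun v => v = M.getD 0 []) (Q₂ := fun v => v = DZ)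
      (Q₃ := fun v => v = t) ?_ ?_ ?_ ?_
    · exact Runs.of_flat rfl (by omega) (by omega) (by simp [-List.getD_eq_getElem?_getD]; rfl)
    · exact Runs.of_flat rfl (by omega) (by omega) rfl
    · exact Runs.of_flat rfl (by omega) (by omega) rfl
    rintro _ _ _ rfl rfl rfl
    refine (combineP_runs (hM 0 hZ1).1 (by omega)
      (show N * 2 ^ L + N + 8 < 2 ^ w by omega) (hM 0 hZ1).2
      (fun c hc => (hDZ c hc).2 _ (hn'.symm ▸ ht))).mono ?_ le_rfl (by omega)
    rintro (v : ℕ × ℝ) ⟨v1, v2⟩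
    refine ⟨v1, v2.imp ?_ ?_⟩
    · rintro p ⟨c, hc, p₁, p₂, ⟨r₁, w₁⟩, ⟨r₂, w₂⟩, rfl⟩
      exact ⟨_, w₁.append w₂⟩
    · rintro p ⟨hp, hk⟩
      obtain ⟨b, r, p₁, p₂, b1, b2, b3, b4, rfl⟩ :=
        exists_zEdge_walk hH hZ hm _ 0 _ p hZ1 hp hk
      exact ⟨b, b1, p₁, p₂, ⟨r, b2, b3⟩, b4, rfl⟩
  · simp only [Finset.sum_const, Finset.card_range, smul_eq_mul]
    omega
  · rintro (D : List (ℕ × ℝ)) ⟨h1, h2⟩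
    exact ⟨h1, fun t ht => (h2 t ht).1, fun t ht => (h2 t (hn' ▸ ht)).2⟩

/-! ### Walks and paths in a digraph -/

section Digraph

variable {n : ℕ} {G : Digraph (Fin n)} {w : Fin n → Fin n → ℝ} {s t : Fin n}
  {g : List (List (ℕ × ℝ))}

theorem weight_append {V : Type} (w : V → V → ℝ) (u : V) (b : List V) :
    ∀ a : List V, weight w (a ++ u :: b) = weight w (a ++ [u]) + weight w (u :: b)
  | [] => by simp [weight]
  | [x] => by simp [weight]
  | x :: y :: a => by
    have := weight_append w u b (y :: a)
    simp only [List.cons_append, weight] at this ⊢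
    rw [this, add_assoc]

/-- A walk from `u` to `t` can be made a path, since cycles that are removed do not have negative
weight. The rest of the walk is made a path first, so that only one cycle can occur. -/
theorem exists_path_of_chain (hG : NoNegativeCycle G w) : ∀ (l : List (Fin n)) (u : Fin n),
    (u :: l).IsChain G.Adj → (u :: l).getLast? = some t → ∃ q, IsPath G u t q ∧
      weight w q ≤ weight w (u :: l) ∧ q.length ≤ (u :: l).length
  | [], u, _, ht => ⟨[u], ⟨.singleton _, rfl, ht, by simp⟩, le_rfl, le_rfl⟩
  | v :: l, u, hc, ht => by
    obtain ⟨huv, hc'⟩ := List.isChain_cons_cons.1 hc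
    obtain ⟨q, ⟨q1, q2, q3, q4⟩, q5, q6⟩ := exists_path_of_chain hG l v hc' (by
      rwa [List.getLast?_cons_cons] at ht)
    obtain ⟨q', rfl⟩ : ∃ q', q = v :: q' := by
      cases q with
      | nil => simp at q2
      | cons x q' => simp only [List.head?_cons, Option.some.injEq] at q2; exact ⟨q', by rw [q2]⟩
    have h1 : (u :: v :: q').IsChain G.Adj := List.isChain_cons_cons.2 ⟨huv, q1⟩
    have h2 : weight w (u :: v :: q') ≤ weight w (u :: v :: l) := by
      simp only [weight]; linarith
    by_cases hu : u ∈ v :: q'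
    · -- the part of the walk up to the next visit of `u` is a cycle
      obtain ⟨a, b, hab⟩ := List.append_of_mem hu
      rw [hab] at q3 q4 h1 h2 q6
      have h3 : u :: (a ++ u :: b) = (u :: a) ++ u :: b := rfl
      rw [h3] at h1 h2
      obtain ⟨h4, h5⟩ := List.isChain_split.1 h1
      rw [weight_append] at h2
      have h6 : 0 ≤ weight w (u :: a ++ [u]) := by
        refine hG _ ⟨h4, by simp, (List.getLast?_concat ..).symm, ?_⟩
        have := q4.sublist (l₁ := a ++ [u]) (by simp)
        simpa using this
      refine ⟨u :: b, ⟨h5, rfl, ?_, q4.sublist (List.sublist_append_right _ _)⟩, by linarith, ?_⟩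
      · rw [← q3, List.getLast?_append_of_ne_nil _ (by simp)]
      · simp only [List.length_append, List.length_cons] at q6 ⊢; omega
    · exact ⟨u :: v :: q', ⟨h1, rfl, by rw [List.getLast?_cons_cons]; exact q3,
        List.nodup_cons.2 ⟨hu, q4⟩⟩, h2, by simp only [List.length_cons] at q6 ⊢; omega⟩

/-- `g` lists the incoming edges of each vertex of the graph, each with its tail and its weight. -/
structure IsInLists (G : Digraph (Fin n)) (w : Fin n → Fin n → ℝ) (g : List (List (ℕ × ℝ))) :
    Prop where
  length_eq : g.length = n
  mem_iff : ∀ u v c, (u, c) ∈ g.getD v [] ↔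
    ∃ a b : Fin n, (a : ℕ) = u ∧ (b : ℕ) = v ∧ G.Adj a b ∧ c = w a b

theorem IsInLists.wf (h : IsInLists G w g) : WF g := by
  rintro v ⟨u, c⟩ he
  obtain ⟨a, b, rfl, -⟩ := (h.mem_iff u v c).1 he
  rw [h.length_eq]
  exact a.2

theorem IsInLists.edge (h : IsInLists G w g) {a b : Fin n} (hab : G.Adj a b) :
    GEdge g a b (toLex (w a b, 1)) :=
  ⟨w a b, (h.mem_iff _ _ _).2 ⟨a, b, rfl, rfl, hab, rfl⟩, rfl⟩

theorem IsInLists.walk_of_chain (h : IsInLists G w g) : ∀ (l : List (Fin n)) (u : Fin n),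
    (u :: l).IsChain G.Adj → (u :: l).getLast? = some t →
      Walk (GEdge g) u l.length t (toLex (weight w (u :: l), l.length))
  | [], u, _, ht => by
    simp only [List.getLast?_singleton, Option.some.injEq] at ht
    subst ht
    exact .nil
  | v :: l, u, hc, ht => by
    obtain ⟨huv, hc'⟩ := List.isChain_cons_cons.1 hc
    have h1 := h.walk_of_chain l v hc' (by rwa [List.getLast?_cons_cons] at ht)
    have h2 := (Walk.single (h.edge huv)).append h1
    rw [← toLex_add, Prod.mk_add_mk] at h2
    rw [List.length_cons, add_comm]
    exact h2

theorem IsInLists.walk_of_path (h : IsInLists G w g) {q : List (Fin n)} (hq : IsPath G s t q) :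
    Walk (GEdge g) s (q.length - 1) t (toLex (weight w q, q.length - 1)) := by
  obtain ⟨q1, q2, q3, -⟩ := hq
  cases q with
  | nil => simp at q2
  | cons x q =>
    simp only [List.head?_cons, Option.some.injEq] at q2
    subst q2
    exact h.walk_of_chain q x q1 q3

theorem IsInLists.exists_chain (h : IsInLists G w g) {k v : ℕ} {p : Len}
    (hw : Walk (GEdge g) s k v p) : ∃ t : Fin n, (t : ℕ) = v ∧ ∃ l : List (Fin n),
      (s :: l).IsChain G.Adj ∧ (s :: l).getLast? = some t ∧ l.length = k ∧
        weight w (s :: l) = (ofLex p).1 := by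
  induction hw with
  | nil => exact ⟨s, rfl, [], .singleton _, rfl, rfl, rfl⟩
  | snoc hw e ih =>
    obtain ⟨t, rfl, l, h1, h2, h3, h4⟩ := ih
    obtain ⟨c, hc, rfl⟩ := e
    obtain ⟨a, b, h5, rfl, h6, rfl⟩ := (h.mem_iff _ _ _).1 hc
    obtain rfl : a = t := Fin.ext h5
    obtain ⟨l', hl'⟩ := List.getLast?_eq_some_iff.1 h2
    refine ⟨b, rfl, l ++ [b], ?_, ?_, by simp [h3], ?_⟩
    · rw [← List.cons_append, hl', List.append_assoc]
      refine List.isChain_split.2 ⟨hl' ▸ h1, by simpa using h6⟩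
    · rw [← List.cons_append]; exact List.getLast?_concat ..
    · have h7 : s :: (l ++ [b]) = l' ++ a :: [b] := by
        rw [← List.cons_append, hl', List.append_assoc]; rfl
      rw [h7, weight_append, ← hl', h4, ofLex_add]
      simp [weight]

theorem IsInLists.exists_path (h : IsInLists G w g) (hG : NoNegativeCycle G w) {k : ℕ} {p : Len}
    (hw : Walk (GEdge g) s k t p) : ∃ q, IsPath G s t q ∧
      toLex (weight w q, q.length - 1) ≤ p := by
  obtain ⟨t', ht, l, h1, h2, h3, h4⟩ := h.exists_chain hw
  obtain rfl : t' = t := Fin.ext ht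
  obtain ⟨q, q1, q2, q3⟩ := exists_path_of_chain hG l s h1 h2
  refine ⟨q, q1, ?_⟩
  have hk := hw.hops
  rw [h4] at q2
  rw [List.length_cons] at q3
  change toLex _ ≤ toLex ((ofLex p).1, (ofLex p).2)
  rw [Prod.Lex.toLex_le_toLex]
  rcases q2.lt_or_eq with h5 | h5
  · exact .inl h5
  · exact .inr ⟨h5, by dsimp only; omega⟩

/-- There is a shortest walk to every vertex that can be reached, and it is a path. -/
theorem IsInLists.exists_isDist (h : IsInLists G w g) (hG : NoNegativeCycle G w)
    (hp : ∃ q, IsPath G s t q) : ∃ p, IsDist (GEdge g) s t p ∧ (ofLex p).2 < n := by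
  have hlen : ∀ q, IsPath G s t q → q.length ≤ n := fun q hq => by
    simpa using hq.2.2.2.length_le_card
  have hfin : {q | IsPath G s t q}.Finite :=
    (List.finite_length_le (Fin n) n).subset fun q hq => hlen q hq
  obtain ⟨q, hq, hmin⟩ := Set.exists_min_image _
    (fun q : List (Fin n) => (toLex (weight w q, q.length - 1) : Len)) hfin hp
  refine ⟨_, ⟨⟨_, h.walk_of_path hq⟩, fun k p hw => ?_⟩, ?_⟩
  · obtain ⟨q', h1, h2⟩ := h.exists_path hG hw
    exact (hmin q' h1).trans h2
  · have := hlen q hq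
    have hn := s.2
    change q.length - 1 < n
    omega

/-- The predecessors of `t`, in reverse order, form a shortest path. -/
theorem IsInLists.isShortestPath (h : IsInLists G w g) {k : ℕ}
    {D : List (ℕ × ℝ)} {par : List ℕ} (hD : IsDistArray g s k D) (hpar : IsPar g D par) {p : Len}
    (hp : IsDist (GEdge g) s t p) (hk : (ofLex p).2 ≤ k) : ∃ q, IsShortestPath G w s t q ∧
      (D.getD t (0, 0)).2 = weight w q ∧
      (List.range (D.getD t (0, 0)).1).map
        (fun j => (fun u => par.getD u 0)^[(D.getD t (0, 0)).1 - 1 - j] t) =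
          q.map fun v : Fin n => (v : ℕ) := by
  have hs : (s : ℕ) < g.length := by rw [h.length_eq]; exact s.2
  have back := hD.walk_back hpar h.wf hs hp hk
  generalize hN : (ofLex p).2 = N at *
  have hD0 : (D.getD t (0, 0)).1 = N + 1 ∧ (D.getD t (0, 0)).2 = (ofLex p).1 := by
    obtain ⟨p', q', -, -, -, b4, b5, b6, -⟩ := back 0 (Nat.zero_le _)
    have e := (hD _ (hp.walk.lt_length hs)).eq (p := p) (fun _ ⟨_, hq⟩ => hp.2 _ _ hq)
      ⟨hp, by omega⟩
    have e1 : (D.getD t (0, 0)).1 - 1 = N := by rw [← hN, ← e.2]; rfl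
    have e2 := e.1
    exact ⟨by omega, by rw [← e.2]; rfl⟩
  rw [hD0.1, hD0.2]
  -- the first vertices of the path, from `s` on
  have key : ∀ j ≤ N, ∃ (l : List (Fin n)) (v : Fin n), (s :: l).IsChain G.Adj ∧
      (∃ l', s :: l = l' ++ [v]) ∧ (v : ℕ) = (fun u => par.getD u 0)^[N - j] t ∧
      weight w (s :: l) = (D.getD v (0, 0)).2 ∧
      (List.range (j + 1)).map (fun i => (fun u => par.getD u 0)^[N - i] t) =
        (s :: l).map fun v : Fin n => (v : ℕ) := by
    intro j
    induction j with
    | zero =>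
      intro _
      obtain ⟨p', q', b1, -, -, b4, b5, b6, -⟩ := back N le_rfl
      have hw := b1.walk
      rw [b4, Nat.sub_self] at hw
      rw [Nat.sub_zero]
      generalize hz : (fun u => par.getD u 0)^[N] (t : ℕ) = z at *
      cases hw
      refine ⟨[], s, .singleton _, ⟨[], rfl⟩, rfl, ?_, by
        simp only [Nat.sub_zero, hz, zero_add, List.range_one, List.map_cons, List.map_nil]⟩
      have : (ofLex (toLen (D.getD s (0, 0)))).1 = (ofLex (0 : Len)).1 := by rw [b6]
      exact this.symm
    | succ j ih =>
      intro hj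
      obtain ⟨l, v, i1, ⟨l', i2⟩, i3, i4, i5⟩ := ih (by omega)
      obtain ⟨-, -, -, -, -, -, -, -, b⟩ := back (N - j) (by omega)
      have ht := b (by omega)
      rw [← i3, show N - j - 1 = N - (j + 1) by omega] at ht
      obtain ⟨c, hc, hne, ht2⟩ := ht
      obtain ⟨a, b, h5, h6, h7, rfl⟩ := (h.mem_iff _ _ _).1 hc
      obtain rfl : a = v := Fin.ext h5
      rw [← h6] at ht2
      have ha : s :: (l ++ [b]) = l' ++ a :: [b] := by
        rw [← List.cons_append, i2, List.append_assoc]; rfl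
      refine ⟨l ++ [b], b, ?_, ⟨l' ++ [a], by rw [ha]; simp⟩, h6, ?_, ?_⟩
      · rw [ha]
        exact List.isChain_split.2 ⟨i2 ▸ i1, by simpa using h7⟩
      · rw [ha, weight_append, ← i2, i4, ht2, addD]
        split_ifs with h0
        · exact absurd h0 hne
        · rename_i h1; simp at h1
        · simp [weight]
      · rw [List.range_succ, List.map_append, i5, ← List.cons_append, List.map_append]
        simp [h6]
  obtain ⟨l, v, i1, ⟨l', i2⟩, i3, i4, i5⟩ := key N le_rfl
  rw [Nat.sub_self] at i3
  obtain rfl : v = t := Fin.ext i3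
  have hlast : (s :: l).getLast? = some v := by rw [i2]; simp
  have hwt : (ofLex p).1 = weight w (s :: l) := by rw [i4, hD0.2]
  refine ⟨s :: l, ⟨⟨i1, rfl, hlast, ?_⟩, fun q hq => ?_⟩, hwt, ?_⟩
  · refine List.Nodup.of_map (fun v : Fin n => (v : ℕ)) ?_
    rw [← i5]
    refine List.Nodup.map_on (fun i hi j hj hij => ?_) List.nodup_range
    rw [List.mem_range] at hi hj
    obtain ⟨p₁, -, b1, -, -, b4, -⟩ := back (N - i) (by omega)
    obtain ⟨p₂, -, c1, -, -, c4, -⟩ := back (N - j) (by omega)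
    rw [hij] at b1
    rw [b1.unique c1] at b4
    omega
  · rw [← hwt]
    have h1 := hp.2 _ _ (h.walk_of_path hq)
    exact Prod.Lex.monotone_fst _ _ h1
  · rw [← i5]; rfl

end Digraph

/-! ### Input and output -/

/-- The incoming edges of each vertex, from the array of all edges. -/
def buildP : Prog [.word, .word, .arr (.prod .word (.prod .word .real))] gTy :=
  .tab v0 (.letIn (call1 filterP (.tab v2 (.eq (.fst (.snd (.get v4 v0))) v1)))
    (.tab (.len v0) (.letIn (.get v5 (.get v1 v0)) (.pair (.fst v0) (.snd (.snd v0))))))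

theorem buildP_runs {w n m : ℕ} {E : List (ℕ × ℕ × ℝ)} (hE : E.length = m)
    (hw : n + m + 8 < 2 ^ w) :
    Runs w buildP (n, m, E, ()) (fun g : List (List (ℕ × ℝ)) => g.length = n ∧ ∀ v < n,
      g.getD v [] = (E.filter fun e => e.2.1 = v).map fun e => (e.1, e.2.2))
      (n * ((Nat.clog 2 m + 1) * (3 * m + 2)) + 1) (Nat.clog 2 m + 1) := by
  have hw0 : 0 < w := pos_of_lt_two_pow hw (by omega)
  have m1 := one_mod hw0
  have hU : 3 * m + 2 ≤ (Nat.clog 2 m + 1) * (3 * m + 2) := Nat.le_mul_of_pos_left _ (by omega)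
  unfold buildP
  refine (Runs.tab (a := .arr (.prod .word .real)) (ℓ := n) (Q := fun v (x : List (ℕ × ℝ)) =>
    x = (E.filter fun e => e.2.1 = v).map fun e => (e.1, e.2.2))
    (u := fun _ => (Nat.clog 2 m + 1) * (3 * m + 2)) ?_ ?_ (by simp)).imp
    fun _ h => ⟨h.1, h.2⟩
  · exact Runs.of_flat rfl (by omega) (by omega) rfl
  intro v hv
  set F : List ℕ := (List.range m).filter fun i => (E.getD i (0, 0, 0)).2.1 = v with hF
  have hFl : F.length ≤ m := (List.length_filter_le _ _).trans (by simp)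
  refine Runs.letIn (Q := fun x => x = F) ?_ ?_
  · refine Runs.call1 (Q₁ := fun l : List ℕ => l.length = m ∧ ∀ i < m, l.getD i 0 =
      if (E.getD i (0, 0, 0)).2.1 = v then 1 else 0) ?_ ?_
    · refine (Runs.tab (a := .word) (ℓ := m) (Q := fun i x => x =
        if (E.getD i (0, 0, 0)).2.1 = v then 1 else 0) (u := fun _ => 1) ?_ ?_
        (by simp; omega)).imp fun _ h => ⟨h.1, h.2⟩
      · exact Runs.of_flat rfl (by omega) (by omega) rfl
      · intro i hi
        refine Runs.of_flat rfl le_rfl (by omega) ?_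
        simp only [val_eq, val_fst, val_snd, val_get, val_var, get_zero, get_succ]
        change (if (E.getD i (0, 0, 0)).2.1 = v then 1 else 0) % 2 ^ w = _
        by_cases h : (E.getD i (0, 0, 0)).2.1 = v <;> simp [h, m1, -List.getD_eq_getElem?_getD]
    · rintro (l : List ℕ) ⟨h1, h2⟩
      refine (filterP_runs (by omega)).mono ?_ (by rw [h1]) (by rw [h1])
      rintro _ rfl
      rw [hF, h1]
      refine List.filter_congr fun i hi => ?_
      rw [h2 i (List.mem_range.1 hi)]
      by_cases h : (E.getD i (0, 0, 0)).2.1 = v <;> simp [h, -List.getD_eq_getElem?_getD]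
  rintro _ rfl
  have k1 : F.length % 2 ^ w = F.length := Nat.mod_eq_of_lt (by omega)
  refine (Runs.tab (a := .prod .word .real) (ℓ := F.length) (Q := fun j (x : ℕ × ℝ) =>
    x = ((E.getD (F.getD j 0) (0, 0, 0)).1, (E.getD (F.getD j 0) (0, 0, 0)).2.2))
    (u := fun _ => 1) ?_ ?_ (by simp; omega)).imp ?_
  · exact Runs.of_flat rfl (by omega) (by omega) (by simp [k1])
  · intro j hj
    exact Runs.of_flat rfl le_rfl (by omega) rfl
  · rintro (l : List (ℕ × ℝ)) ⟨h1, h2⟩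
    have e1 : l = F.map fun i => ((E.getD i (0, 0, 0)).1, (E.getD i (0, 0, 0)).2.2) := by
      refine ext_getD (d := (0, 0)) (by simp [h1]) fun j hj => ?_
      rw [h1] at hj
      refine (h2 j hj).trans ?_
      conv_rhs => rw [List.getD_eq_getElem _ _ (by simpa using hj), List.getElem_map]
      rw [List.getD_eq_getElem F _ hj]
    have e2 : E = (List.range m).map fun i => E.getD i (0, 0, 0) := by
      refine List.ext_getElem (by simp [hE]) fun i h3 h4 => ?_
      rw [List.getElem_map, List.getElem_range, List.getD_eq_getElem _ _ h3]
    rw [e1]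
    conv_rhs => rw [e2]
    rw [List.filter_map, List.map_map]
    rfl

/-- The output, from the graph and the lengths of shortest walks; the last argument is the logarithm
of a bound on their numbers of edges. -/
def outP : Prog [gTy, .arr dTy, .word] outputTy :=
  .letIn (call2 iteratesP (call2 parentsP v0 v1) v2)
    (.tab (.len v1) (.letIn (.get v3 v0)
      (.ite (.fst v0)
        (.pair (.lit 1) (.pair (.snd v0)
          (.tab (.fst v0) (.get (.snd (.get v3 v2)) (.fst v1 - .lit 1 - v0)))))
        (.pair (.lit 0) (.pair .rzero (.tab (.lit 0) (.lit 0)))))))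

theorem outP_runs {w n L B : ℕ} {g : List (List (ℕ × ℝ))} {D : List (ℕ × ℝ)} (hg : WF g)
    (hdeg : ∀ v, (g.getD v []).length ≤ g.length) (hn : g.length = n) (hn1 : 1 ≤ n)
    (hDB : ∀ t < n, (D.getD t (0, 0)).1 ≤ B) (hDn : ∀ t < n, (D.getD t (0, 0)).1 ≤ n)
    (hL : n ≤ 2 ^ L) (hw : n + B + 2 ^ L + 8 < 2 ^ w) :
    Runs w outP (g, D, L, ()) (fun out : List (ℕ × ℝ × List ℕ) => out.length = n ∧
      ∃ par, IsPar g D par ∧ ∀ t < n, out.getD t (0, 0, []) =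
        if (D.getD t (0, 0)).1 = 0 then (0, 0, []) else (1, (D.getD t (0, 0)).2,
          (List.range (D.getD t (0, 0)).1).map
            fun j => (fun u => par.getD u 0)^[(D.getD t (0, 0)).1 - 1 - j] t))
      (4 * numE g + n * (3 * 2 ^ L) + L + n * (n + 1) + 1) (Nat.clog 2 n + L + 1) := by
  have hw0 : 0 < w := pos_of_lt_two_pow hw (by omega)
  have m1 := one_mod hw0
  have k1 : n % 2 ^ w = n := Nat.mod_eq_of_lt (by omega)
  have hnn : n ≤ n * (n + 1) := Nat.le_mul_of_pos_right _ (by omega)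
  refine Runs.letIn (Q := fun it => ∃ par, IsPar g D par ∧ IsIter par L it) ?_ ?_
  · refine Runs.call2 (Q₁ := IsPar g D) (Q₂ := fun v => v = L) ?_ ?_ ?_
    · refine Runs.call2 (Q₁ := fun v => v = g) (Q₂ := fun v => v = D) ?_ ?_ ?_
      · exact Runs.of_flat rfl (by omega) (by omega) rfl
      · exact Runs.of_flat rfl (by omega) (by omega) rfl
      · rintro _ _ rfl rfl
        exact (parentsP_runs (B := B) hg hdeg (hn ▸ hDB) (by omega)).mono
          (fun _ h => h) (by omega) (by rw [hn]; omega)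
    · exact Runs.of_flat rfl (by omega) (by omega) rfl
    · rintro (par : List ℕ) _ hp rfl
      have hl := hp.1.trans hn
      refine (iteratesP_runs (fun v hv => ?_) (by omega)).mono (fun v h => ⟨par, hp, h⟩)
        (by rw [hl]; omega) (by omega)
      rw [hp.1] at hv ⊢
      exact hp.lt hg hv
  rintro (it : List (ℕ × List ℕ)) ⟨par, hpar, hit⟩
  refine (Runs.tab (a := .prod .word (.prod .real (.arr .word))) (ℓ := n)
    (Q := fun t (x : ℕ × ℝ × List ℕ) => x =
      if (D.getD t (0, 0)).1 = 0 then (0, 0, []) else (1, (D.getD t (0, 0)).2,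
          (List.range (D.getD t (0, 0)).1).map
            fun j => (fun u => par.getD u 0)^[(D.getD t (0, 0)).1 - 1 - j] t))
    (u := fun _ => n + 1) ?_ ?_ ?_).imp fun _ h => ⟨h.1, par, hpar, h.2⟩
  · exact Runs.of_flat rfl (by omega) (by omega) (by simp [hn, k1])
  · intro t ht
    have hitt := hit.2 t (by rw [hpar.1, hn]; exact ht)
    have hdn := hDn t ht
    refine Runs.letIn (Q := fun x => x = D.getD t (0, 0)) ?_ ?_
    · exact Runs.of_flat rfl (by omega) (by omega) rfl
    rintro _ rfl
    generalize D.getD t (0, 0) = d at *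
    refine Runs.ite (C := fun x => x = d.1) ?_ ?_ ?_
    · exact Runs.of_flat rfl (by omega) (by omega) rfl
    · rintro _ rfl hd
      rw [if_neg hd]
      refine Runs.pair (Q₁ := fun x => x = 1) (Q₂ := fun x : ℝ × List ℕ => x = (d.2,
        (List.range d.1).map fun j => (fun u => par.getD u 0)^[d.1 - 1 - j] t)) ?_ ?_ ?_
      · exact Runs.of_flat rfl (by omega) (by omega) (by simp [m1])
      · refine Runs.pair (Q₁ := fun x : ℝ => x = d.2) (Q₂ := fun x : List ℕ => x =
          (List.range d.1).map fun j => (fun u => par.getD u 0)^[d.1 - 1 - j] t) ?_ ?_ ?_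
        · exact Runs.of_flat rfl (by omega) (by omega) rfl
        · refine (Runs.tab (a := .word) (ℓ := d.1) (Q := fun j x => x =
            (fun u => par.getD u 0)^[d.1 - 1 - j] t) (u := fun _ => 1) ?_ ?_
            (by simp; omega)).imp ?_
          · exact Runs.of_flat rfl (by omega) (by omega) rfl
          · intro j hj
            refine Runs.of_flat rfl le_rfl (by omega) ?_
            have k2 : (d.1 - 1) % 2 ^ w = d.1 - 1 := Nat.mod_eq_of_lt (by omega)
            have k3 : (d.1 - 1 - j) % 2 ^ w = d.1 - 1 - j := Nat.mod_eq_of_lt (by omega)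
            simp only [val_get, val_snd, val_fst, val_sub, val_lit, val_var, get_zero, get_succ,
              m1, k2, k3]
            rw [show it.getD t (Ty.dflt (.prod .word (.arr .word))) = it.getD t (0, []) from rfl,
              hitt, List.getD_eq_getElem _ _ (by simp; omega)]
            simp
          · rintro (l : List ℕ) ⟨h1, h2⟩
            refine ext_getD (d := 0) (by simp [h1]) fun j hj => ?_
            rw [h1] at hj
            refine (h2 j hj).trans ?_
            rw [List.getD_eq_getElem _ _ (by simpa using hj)]
            simp
        · rintro _ _ rfl rfl; rfl
      · rintro _ _ rfl rfl; rfl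
    · intro hd
      rw [if_pos hd.symm]
      refine Runs.pair (Q₁ := fun x => x = 0) (Q₂ := fun x : ℝ × List ℕ => x = (0, [])) ?_ ?_ ?_
      · exact Runs.of_flat rfl (by omega) (by omega) (by simp)
      · refine Runs.pair (Q₁ := fun x : ℝ => x = 0) (Q₂ := fun x : List ℕ => x = []) ?_ ?_ ?_
        · exact Runs.of_flat rfl (by omega) (by omega) rfl
        · refine (Runs.tab (a := .word) (ℓ := 0) (Q := fun _ _ => True) (u := fun _ => 1) ?_ ?_
            (by simp)).imp fun l h => List.length_eq_zero_iff.1 h.1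
          · exact Runs.of_flat rfl (by omega) (by omega) (by simp)
          · exact fun j hj => absurd hj (Nat.not_lt_zero _)
        · rintro _ _ rfl rfl; rfl
      · rintro _ _ rfl rfl; rfl
  · simp only [Finset.sum_const, Finset.card_range, smul_eq_mul]
    omega

/-! ### Work and depth -/

/-- A bound on the work, up to a constant. The number of vertices in the argument of `finalP` is at
most `73 * n * L ^ 2 / h`. -/
def totalWork (n m h L : ℕ) : ℕ :=
  10 ^ 6 * (m * n * L ^ 2 + n ^ 2 * h * L ^ 11) + 10 * L * (73 * n * L ^ 2 / h) ^ 3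

/-- A bound on the depth, up to a constant. -/
def totalDepth (h L : ℕ) : ℕ := 300 * (h + L ^ 11)

section Bounds

variable {n m h L K E : ℕ}

theorem two_pow_clog_le (hn : 2 ≤ n) (hL : Nat.clog 2 n = L) : 2 ^ L ≤ 2 * n := by
  have h1 := Nat.pow_pred_clog_lt_self one_lt_two (x := n) (by omega)
  have h2 : 1 ≤ L := hL ▸ Nat.clog_pos one_lt_two hn
  obtain ⟨k, rfl⟩ : ∃ k, L = k + 1 := ⟨L - 1, by omega⟩
  rw [hL, Nat.pred_eq_sub_one, Nat.add_sub_cancel] at h1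
  rw [pow_succ]
  omega

/-- The words are long enough for all numbers that occur. -/
theorem le_two_pow_word (hn : 2 ≤ n) (hL : Nat.clog 2 n = L) :
    8 * n ^ 5 + 64 < 2 ^ (10 * L) ∧ 100 * n ^ 2 + 64 < 2 ^ (10 * L) := by
  have h1 : n ^ 10 ≤ 2 ^ (10 * L) := by
    rw [mul_comm, pow_mul]
    exact Nat.pow_le_pow_left (hL ▸ Nat.le_pow_clog one_lt_two n) 10
  have h2 : 2 ^ 5 ≤ n ^ 5 := Nat.pow_le_pow_left hn 5
  have h3 : 2 ^ 8 ≤ n ^ 8 := Nat.pow_le_pow_left hn 8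
  have h4 : 2 ^ 2 ≤ n ^ 2 := Nat.pow_le_pow_left hn 2
  constructor
  · refine lt_of_lt_of_le ?_ h1
    calc 8 * n ^ 5 + 64 < 2 ^ 5 * n ^ 5 := by omega
      _ ≤ n ^ 5 * n ^ 5 := Nat.mul_le_mul_right _ h2
      _ = n ^ 10 := by ring
  · refine lt_of_lt_of_le ?_ h1
    calc 100 * n ^ 2 + 64 < 2 ^ 8 * n ^ 2 := by omega
      _ ≤ n ^ 8 * n ^ 2 := Nat.mul_le_mul_right _ h3
      _ = n ^ 10 := by ring

/-- The power of two that is used for `h / L`, which is rounded down before it is rounded up to a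
power of two and may be zero. -/
theorem pow_clog_div_bounds (hL : 1 ≤ L) (hK : Nat.clog 2 (h / L) = K) :
    2 ^ K * L ≤ 2 * h + L ∧ h ≤ 2 * (2 ^ K * L) ∧ ∀ i < K, 2 ^ i ≤ h := by
  have h1 := Nat.div_mul_le_self h L
  have h2 : h < (h / L + 1) * L := by
    have := Nat.lt_div_mul_add (a := h) (b := L) (by omega)
    rw [add_mul, one_mul]; exact this
  refine ⟨?_, ?_, fun i hi => ?_⟩
  · have h3 : 2 ^ K ≤ 2 * (h / L) + 1 := by
      rcases Nat.lt_or_ge 1 (h / L) with h4 | h4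
      · have h5 := Nat.pow_pred_clog_lt_self one_lt_two h4
        have h6 : 1 ≤ K := hK ▸ Nat.clog_pos one_lt_two h4
        obtain ⟨k, rfl⟩ : ∃ k, K = k + 1 := ⟨K - 1, by omega⟩
        rw [hK, Nat.pred_eq_sub_one, Nat.add_sub_cancel] at h5
        rw [pow_succ]
        omega
      · rw [← hK, Nat.clog_of_right_le_one h4]
        simp
    calc 2 ^ K * L ≤ (2 * (h / L) + 1) * L := Nat.mul_le_mul_right _ h3
      _ = 2 * (h / L * L) + L := by ring
      _ ≤ _ := by omega
  · have h3 : h / L + 1 ≤ 2 * 2 ^ K := by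
      have := Nat.le_pow_clog one_lt_two (h / L)
      rw [hK] at this
      have := Nat.one_le_two_pow (n := K)
      omega
    have := Nat.mul_le_mul_right L h3
    rw [mul_assoc] at this
    omega
  · rw [← hK] at hi
    exact (Nat.pow_lt_of_lt_clog hi).le.trans (Nat.div_le_self _ _)

/-- Bounds for the terms that occur in the work of the parts of the algorithm. -/
theorem mul_pow_le_terms (hL : 1 ≤ L) (hh : 1 ≤ h) {j : ℕ} (hj : j ≤ 11) :
    n ^ 2 * h * L ^ j ≤ n ^ 2 * h * L ^ 11 ∧ n ^ 2 * L ^ j ≤ n ^ 2 * h * L ^ 11 := by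
  have h1 : L ^ j ≤ L ^ 11 := Nat.pow_le_pow_right hL hj
  refine ⟨Nat.mul_le_mul_left _ h1, Nat.mul_le_mul (Nat.le_mul_of_pos_right _ hh) h1⟩

/-- The terms of lower order. -/
theorem basic_le_totalWork (hL : 1 ≤ L) (hh : 1 ≤ h) (hn : 1 ≤ n) :
    10 ^ 4 * (n * L + n ^ 2 + m + 1) ≤ totalWork n m h L := by
  have e1 := (mul_pow_le_terms (n := n) hL hh (j := 1) (by norm_num)).2
  have e2 := (mul_pow_le_terms (n := n) hL hh (j := 0) (by norm_num)).2
  have e3 : n * L ≤ n ^ 2 * L ^ 1 := by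
    rw [pow_one]; exact Nat.mul_le_mul_right _ (Nat.le_self_pow (by norm_num) _)
  have e4 : m * 1 * 1 ≤ m * n * L ^ 2 := Nat.mul_le_mul (Nat.mul_le_mul_left _ hn)
    (Nat.one_le_pow _ _ hL)
  have e5 : 1 ≤ n ^ 2 := Nat.one_le_pow _ _ hn
  rw [pow_zero, mul_one] at e2
  rw [mul_one, mul_one] at e4
  unfold totalWork
  omega

theorem build_le_totalWork (hL : 1 ≤ L) (hh : 1 ≤ h) (hn : 1 ≤ n) (hm : Nat.clog 2 m ≤ 2 * L) :
    n * ((Nat.clog 2 m + 1) * (3 * m + 2)) + 1 ≤ totalWork n m h L := by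
  have e0 := basic_le_totalWork (m := m) hL hh hn
  have e1 : n * ((Nat.clog 2 m + 1) * (3 * m + 2)) ≤ n * (3 * L * (3 * m + 2)) := by
    gcongr; omega
  have e2 : n * (3 * L * (3 * m + 2)) = 9 * (m * n * L) + 6 * (n * L) := by ring
  have e3 : m * n * L ≤ m * n * L ^ 2 :=
    Nat.mul_le_mul_left _ (Nat.le_self_pow (by norm_num) _)
  unfold totalWork at *
  omega

theorem levels_le_totalWork (hL : 1 ≤ L) (hh : 1 ≤ h) (hn : 1 ≤ n) (hK : K ≤ L) (hE : E ≤ m) :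
    K * (36 * n * L * (8 * E + 6 * n) + 16576 * (L ^ 4 * (n ^ 2 * h))) + n + 1 ≤
      totalWork n m h L := by
  have e0 := basic_le_totalWork (m := m) hL hh hn
  have e1 : K * (36 * n * L * (8 * E + 6 * n) + 16576 * (L ^ 4 * (n ^ 2 * h))) ≤
      L * (36 * n * L * (8 * m + 6 * n) + 16576 * (L ^ 4 * (n ^ 2 * h))) := by gcongr
  have e2 : L * (36 * n * L * (8 * m + 6 * n) + 16576 * (L ^ 4 * (n ^ 2 * h))) =
      288 * (m * n * L ^ 2) + 216 * (n ^ 2 * L ^ 2) + 16576 * (n ^ 2 * h * L ^ 5) := by ring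
  have e3 := (mul_pow_le_terms (n := n) hL hh (j := 2) (by norm_num)).2
  have e4 := (mul_pow_le_terms (n := n) hL hh (j := 5) (by norm_num)).1
  have e5 : n ≤ n ^ 2 := Nat.le_self_pow (by norm_num) _
  have e6 : 0 ≤ n * L := Nat.zero_le _
  unfold totalWork at *
  omega

theorem final_le_totalWork {g : List (List (ℕ × ℝ))} {z : ℕ} (hL : 1 ≤ L) (hh : 1 ≤ h)
    (hn : 1 ≤ n) (hg : g.length = n) (hE : numE g ≤ m) (hz1 : 1 ≤ z) (hzn : z ≤ n + 1)
    (hzh : z * h ≤ 73 * n * L ^ 2) (hzK : z * 2 ^ K ≤ 39 * n * L) :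
    finalCost g z (2 * 2 ^ K) L ≤ totalWork n m h L := by
  have e0 := basic_le_totalWork (m := m) hL hh hn
  have e1 : z ≤ 73 * n * L ^ 2 / h := (Nat.le_div_iff_mul_le hh).2 hzh
  have e2 : z * ((2 * 2 ^ K + 1) * (4 * numE g + n)) ≤ 468 * (m * n * L) + 117 * (n ^ 2 * L ^ 1) :=
    calc z * ((2 * 2 ^ K + 1) * (4 * numE g + n))
        ≤ z * ((3 * 2 ^ K) * (4 * m + n)) := by
          have := Nat.one_le_two_pow (n := K)
          gcongr; omega
      _ = 3 * (z * 2 ^ K) * (4 * m + n) := by ring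
      _ ≤ 3 * (39 * n * L) * (4 * m + n) := by gcongr
      _ = _ := by ring
  have e3 : (L + 1) * (z * (z * (4 * z + 1))) ≤ 10 * L * (73 * n * L ^ 2 / h) ^ 3 :=
    calc (L + 1) * (z * (z * (4 * z + 1))) ≤ (2 * L) * (z * (z * (5 * z))) := by
          gcongr <;> omega
      _ = 10 * L * z ^ 3 := by ring
      _ ≤ _ := by gcongr
  have e4 : n * (4 * z + 1) ≤ 4 * n ^ 2 + 5 * n :=
    calc n * (4 * z + 1) ≤ n * (4 * (n + 1) + 1) := by gcongr
      _ = _ := by ring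
  have e5 : n ≤ n ^ 2 := Nat.le_self_pow (by norm_num) _
  have e6 : m * n * L ≤ m * n * L ^ 2 :=
    Nat.mul_le_mul_left _ (Nat.le_self_pow (by norm_num) _)
  have e7 := (mul_pow_le_terms (n := n) hL hh (j := 1) (by norm_num)).2
  have e8 := (mul_pow_le_terms (n := n) hL hh (j := 0) (by norm_num)).2
  rw [pow_zero, mul_one] at e8
  rw [finalCost, hg]
  unfold totalWork at *
  omega

theorem out_le_totalWork (hL : 1 ≤ L) (hh : 1 ≤ h) (hn : 1 ≤ n) (hL2 : 2 ^ L ≤ 2 * n)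
    (hE : E ≤ m) :
    4 * E + n * (3 * 2 ^ L) + L + n * (n + 1) + 1 ≤ totalWork n m h L := by
  have e0 := basic_le_totalWork (m := m) hL hh hn
  have e1 : n * (3 * 2 ^ L) ≤ n * (3 * (2 * n)) := by gcongr
  have e2 : n * (3 * (2 * n)) = 6 * n ^ 2 := by ring
  have e3 : n * (n + 1) = n ^ 2 + n := by ring
  have e4 : n ≤ n ^ 2 := Nat.le_self_pow (by norm_num) _
  have e5 : L ≤ n * L := Nat.le_mul_of_pos_left _ hn
  omega

theorem final_le_totalDepth (hL : 1 ≤ L) (hn : Nat.clog 2 n = L)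
    (hK : 2 ^ K * L ≤ 2 * h + L) : finalDepth n (2 * 2 ^ K) L ≤ totalDepth h L := by
  have e1 : (2 * 2 ^ K + 1) * (L + 1) ≤ 3 * 2 ^ K * (2 * L) := by
    have := Nat.one_le_two_pow (n := K)
    gcongr <;> omega
  have e2 : 3 * 2 ^ K * (2 * L) = 6 * (2 ^ K * L) := by ring
  have e3 : (L + 1) * (L + 2) ≤ (2 * L) * (3 * L) := by gcongr <;> omega
  have e4 : (2 * L) * (3 * L) = 6 * L ^ 2 := by ring
  have e5 : L ^ 2 ≤ L ^ 11 := Nat.pow_le_pow_right hL (by norm_num)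
  have e6 : L ≤ L ^ 11 := Nat.le_self_pow (by norm_num) _
  rw [finalDepth, totalDepth, hn]
  omega

theorem levels_le_totalDepth (hL : 1 ≤ L) (hKL : K ≤ L) (hK : 2 ^ K * L ≤ 2 * h + L) :
    2 ^ K * (2 * L) + K * (86 * L ^ 4) + 1 ≤ totalDepth h L := by
  have e2 : 2 ^ K * (2 * L) = 2 * (2 ^ K * L) := by ring
  have e3 : K * (86 * L ^ 4) ≤ L * (86 * L ^ 4) := by gcongr
  have e4 : L * (86 * L ^ 4) = 86 * L ^ 5 := by ring
  have e5 : L ^ 5 ≤ L ^ 11 := Nat.pow_le_pow_right hL (by norm_num)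
  have e6 : L ≤ L ^ 11 := Nat.le_self_pow (by norm_num) _
  rw [totalDepth]
  omega

theorem linear_le_totalDepth (hL : 1 ≤ L) : 3 * L + 3 ≤ totalDepth h L := by
  have e6 : L ≤ L ^ 11 := Nat.le_self_pow (by norm_num) _
  rw [totalDepth]
  omega

end Bounds

/-! ### Correctness -/

section Correctness

variable {n m : ℕ} {G : Digraph (Fin n)} {w : Fin n → Fin n → ℝ} {s : Fin n}
  {g : List (List (ℕ × ℝ))}

/-- The lists of the elements with `f a = v`, for different `v`, are disjoint. -/
theorem sum_length_filter_le {α : Type} (f : α → ℕ) (n : ℕ) : ∀ E : List α,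
    ∑ v ∈ Finset.range n, (E.filter fun a => f a = v).length ≤ E.length
  | [] => by simp
  | a :: E => by
    have h : ∀ v, ((a :: E).filter fun a => f a = v).length =
        (if f a = v then 1 else 0) + (E.filter fun a => f a = v).length := by
      intro v
      by_cases h : f a = v <;> simp [h, add_comm]
    simp only [h, Finset.sum_add_distrib, Finset.sum_ite_eq, List.length_cons]
    have := sum_length_filter_le f n E
    split_ifs <;> omega

/-- The lists of incoming edges, from an array of all edges. -/
theorem isInLists_of_filter (e : Fin m ≃ {a : Fin n × Fin n // G.Adj a.1 a.2})
    {E : List (ℕ × ℕ × ℝ)}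
    (hE : E = List.ofFn fun i => (((e i).1.1 : ℕ), ((e i).1.2 : ℕ), w (e i).1.1 (e i).1.2))
    (hg : g.length = n)
    (hgE : ∀ v < n, g.getD v [] = (E.filter fun e => e.2.1 = v).map fun e => (e.1, e.2.2)) :
    IsInLists G w g ∧ (∀ v, (g.getD v []).length ≤ g.length) ∧ numE g ≤ m := by
  have hin : IsInLists G w g := by
    refine ⟨hg, fun u v c => ?_⟩
    rcases Nat.lt_or_ge v n with hv | hv
    · rw [hgE v hv]
      simp only [List.mem_map, List.mem_filter, decide_eq_true_eq, hE, List.mem_ofFn]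
      constructor
      · rintro ⟨_, ⟨⟨i, rfl⟩, h1⟩, h2⟩
        rw [Prod.mk.injEq] at h2
        exact ⟨_, _, h2.1, h1, (e i).2, h2.2.symm⟩
      · rintro ⟨a, b, rfl, rfl, hab, rfl⟩
        exact ⟨_, ⟨⟨e.symm ⟨(a, b), hab⟩, rfl⟩, by simp⟩, by simp⟩
    · rw [List.getD_eq_default _ _ (by omega)]
      simp only [List.not_mem_nil, false_iff]
      rintro ⟨a, b, -, rfl, -⟩
      exact absurd b.2 (by omega)
  refine ⟨hin, fun v => ?_, ?_⟩
  · rcases Nat.lt_or_ge v n with hv | hv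
    · -- the tails of the edges into `v` are distinct
      have hnd : ((g.getD v []).map Prod.fst).Nodup := by
        rw [hgE v hv, List.map_map]
        refine List.Nodup.map_on ?_ (List.Nodup.filter _ ?_)
        · simp only [List.mem_filter, decide_eq_true_eq, hE, List.mem_ofFn]
          rintro _ ⟨⟨i, rfl⟩, hi⟩ _ ⟨⟨j, rfl⟩, hj⟩ hij
          have h1 : (e i).1.1 = (e j).1.1 := Fin.ext hij
          have h2 : (e i).1.2 = (e j).1.2 := Fin.ext (hi.trans hj.symm)
          rw [h1, h2]
        · rw [hE, List.nodup_ofFn]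
          intro i j hij
          simp only [Prod.mk.injEq] at hij
          exact e.injective (Subtype.ext (Prod.ext (Fin.ext hij.1) (Fin.ext hij.2.1)))
      have hsub : (g.getD v []).map Prod.fst ⊆ List.range g.length := by
        intro u hu
        obtain ⟨x, hx, rfl⟩ := List.mem_map.1 hu
        exact List.mem_range.2 (hin.wf v x hx)
      simpa using (hnd.subperm hsub).length_le
    · rw [List.getD_eq_default _ _ (by omega)]
      simp
  · refine le_trans (le_of_eq ?_) ((sum_length_filter_le (fun e : ℕ × ℕ × ℝ => e.2.1) n E).trans
      (le_of_eq (by simp [hE])))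
    rw [numE, hg]
    refine Finset.sum_congr rfl fun v hv => ?_
    rw [hgE v (Finset.mem_range.1 hv), List.length_map]

/-- Only vertices that can be reached have finite entries, and these are exact. -/
theorem IsInLists.isDist_of_ne_zero (h : IsInLists G w g) (hG : NoNegativeCycle G w) {k : ℕ}
    {D : List (ℕ × ℝ)} (hD : IsDistArray g s k D) (hk : n ≤ k) {t : Fin n}
    (h0 : (D.getD t (0, 0)).1 ≠ 0) : (∃ q, IsPath G s t q) ∧ (D.getD t (0, 0)).1 ≤ n := by
  have hDt := hD t (h.length_eq ▸ t.2)
  obtain ⟨j, hw⟩ := hDt.1 h0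
  obtain ⟨q, hq, -⟩ := h.exists_path hG hw
  obtain ⟨p, hp, hpn⟩ := h.exists_isDist hG ⟨q, hq⟩
  refine ⟨⟨q, hq⟩, ?_⟩
  have e := hDt.eq (p := p) (fun _ ⟨_, hq⟩ => hp.2 _ _ hq) ⟨hp, by omega⟩
  have e1 : (D.getD t (0, 0)).1 - 1 = (ofLex p).2 := by rw [← e.2]; rfl
  omega

/-- The lengths of shortest walks and the sequences of predecessors solve the problem. -/
theorem IsInLists.isSolution (h : IsInLists G w g) (hG : NoNegativeCycle G w) {k : ℕ}
    {D : List (ℕ × ℝ)} (hD : IsDistArray g s k D) (hk : n ≤ k) {par : List ℕ}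
    (hpar : IsPar g D par) {out : List (ℕ × ℝ × List ℕ)} (hl : out.length = n)
    (hout : ∀ t < n, out.getD t (0, 0, []) =
        if (D.getD t (0, 0)).1 = 0 then (0, 0, []) else (1, (D.getD t (0, 0)).2,
          (List.range (D.getD t (0, 0)).1).map
            fun j => (fun u => par.getD u 0)^[(D.getD t (0, 0)).1 - 1 - j] t)) :
    IsSolution G w s out := by
  refine ⟨hl, fun t => ?_⟩
  have ht : (t : ℕ) < out.length := hl ▸ t.2
  have h1 := hout t t.2
  rw [List.getD_eq_getElem _ _ ht] at h1
  obtain ⟨r, d, l, hx⟩ : ∃ r d l, out[(t : ℕ)] = (r, d, l) := ⟨_, _, _, rfl⟩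
  rw [hx] at h1
  refine ⟨r, d, l, by rw [List.getElem?_eq_getElem ht, hx], ?_, ?_⟩
  · intro hp
    obtain ⟨p, hpd, hpn⟩ := h.exists_isDist hG hp
    obtain ⟨q, hq1, hq2, hq3⟩ := h.isShortestPath hD hpar hpd (by omega)
    rw [if_neg ((hD t (h.length_eq ▸ t.2)).2 p ⟨hpd, by omega⟩).1, hq3] at h1
    obtain ⟨rfl, rfl, rfl⟩ := by simpa only [Prod.mk.injEq] using h1
    exact ⟨rfl, q, hq1, hq2, by simp [List.map_eq_flatMap]⟩
  · intro hp
    rw [if_pos (not_not.1 fun h0 => hp (h.isDist_of_ne_zero hG hD hk h0).1)] at h1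
    exact (Prod.mk.inj h1).1

end Correctness

/-! ### The algorithm -/

/-- The algorithm: with `L` the logarithm of the number of vertices and `K` that of `h / L`, a
set of vertices that meets the shortest walks with `2 ^ K` edges, the lengths of shortest walks
by way of these vertices, and the paths. Here `h / L` takes the place of `h` because each round
of the Bellman–Ford algorithm has depth `L`. -/
def shortestPathsP : Prog inputTy outputTy :=
  .letIn (call1 clogP v0) (.letIn (call3 buildP v1 v2 v5) (.letIn (call1 clogP (v5 / v1))
    (.letIn (call3 levelsP v1 v0 v2) (.letIn (call2 appendP (.tab (.lit 1) v7) (.snd v0))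
      (.letIn (call4 finalP v3 v0 (.lit 2 * .fst v1) v4) (call3 outP v4 v0 v5))))))

theorem shortestPathsP_runs {n m h L : ℕ} {G : Digraph (Fin n)} {w : Fin n → Fin n → ℝ}
    (e : Fin m ≃ {a : Fin n × Fin n // G.Adj a.1 a.2}) (s : Fin n) (hL : Nat.clog 2 n = L)
    (hn : 2 ≤ n) (h1 : 1 ≤ h) (hh : h ≤ n) (hG : NoNegativeCycle G w) :
    Runs (10 * L) shortestPathsP (encode G w e s h) (IsSolution G w s) (totalWork n m h L)
      (totalDepth h L) := by
  have hL1 : 1 ≤ L := hL ▸ Nat.clog_pos one_lt_two hn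
  have hL2 := two_pow_clog_le hn hL
  have hnL : n ≤ 2 ^ L := hL ▸ Nat.le_pow_clog one_lt_two n
  obtain ⟨hw5, hw2⟩ := le_two_pow_word hn hL
  generalize 10 * L = ω at hw5 hw2 ⊢
  have hm : m ≤ n ^ 2 := by
    have := Fintype.card_le_of_injective (fun i => (e i).1)
      (Subtype.val_injective.comp e.injective)
    simpa [sq] using this
  have hnn : n ≤ n ^ 2 := Nat.le_self_pow (by norm_num) _
  have hmL : Nat.clog 2 m ≤ 2 * L := by
    refine Nat.clog_le_of_le_pow (hm.trans ?_)
    rw [mul_comm, pow_mul]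
    exact Nat.pow_le_pow_left hnL 2
  have hLn : L < 2 ^ L := Nat.lt_two_pow_self
  have hω0 : 0 < ω := by
    rcases Nat.eq_zero_or_pos ω with rfl | h
    · simp at hw5
    · exact h
  have m1 := one_mod hω0
  have c0 := basic_le_totalWork (m := m) hL1 h1 (n := n) (by omega)
  have c1 := linear_le_totalDepth (h := h) hL1
  have hLnL : L ≤ n * L := Nat.le_mul_of_pos_left _ (by omega)
  unfold shortestPathsP encode
  generalize hE : (List.ofFn fun i => (((e i).1.1 : ℕ), ((e i).1.2 : ℕ), w (e i).1.1 (e i).1.2)) = E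
  have hEl : E.length = m := by rw [← hE, List.length_ofFn]
  refine Runs.letIn (Q := fun x => L = x) ?_ ?_
  · refine Runs.call1 (Q₁ := fun x => x = n) ?_ ?_
    · exact Runs.of_flat rfl (by omega) (by omega) rfl
    · rintro _ rfl
      exact (clogP_runs (by omega)).mono (fun _ h => (h.trans hL).symm) (by omega) (by omega)
  rintro _ rfl
  refine Runs.letIn (Q := fun g : List (List (ℕ × ℝ)) => g.length = n ∧ ∀ v < n,
      g.getD v [] = (E.filter fun e => e.2.1 = v).map fun e => (e.1, e.2.2)) ?_ ?_
  · have hrun := (buildP_runs (w := ω) (n := n) hEl (by omega)).mono (fun _ h => h)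
      (build_le_totalWork hL1 h1 (by omega) hmL) ((show _ ≤ 3 * L + 3 by omega).trans c1)
    refine Runs.call3 (Q₁ := fun x => x = n) (Q₂ := fun x => x = m) (Q₃ := fun x => x = E)
      ?_ ?_ ?_ ?_
    · exact Runs.of_flat rfl (by omega) (by omega) rfl
    · exact Runs.of_flat rfl (by omega) (by omega) rfl
    · exact Runs.of_flat rfl (by omega) (by omega) rfl
    · rintro _ _ _ rfl rfl rfl
      exact hrun
  rintro (g : List (List (ℕ × ℝ))) ⟨hg, hgE⟩
  obtain ⟨hin, hdeg, hnum⟩ := isInLists_of_filter e hE.symm hg hgE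
  have hwf := hin.wf
  obtain ⟨K, hK⟩ : ∃ K, Nat.clog 2 (h / L) = K := ⟨_, rfl⟩
  obtain ⟨k1, k2, k3⟩ := pow_clog_div_bounds hL1 hK
  have hhL : h / L ≤ h := Nat.div_le_self _ _
  have hKL : K ≤ L := by
    have := Nat.clog_mono_right 2 (hhL.trans hh)
    omega
  have hK3 : 2 ^ K ≤ 3 * n := by
    have : 2 ^ K * 1 ≤ 2 ^ K * L := Nat.mul_le_mul_left _ hL1
    have h4 : 2 ^ K ≤ 2 ^ L := Nat.pow_le_pow_right (by norm_num) hKL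
    omega
  refine Runs.letIn (Q := fun x => K = x) ?_ ?_
  · refine Runs.call1 (Q₁ := fun x => x = h / L) ?_ ?_
    · exact Runs.of_flat rfl (by omega) (by omega)
        (show h / L % 2 ^ ω = h / L from Nat.mod_eq_of_lt (by omega))
    · rintro _ rfl
      exact (clogP_runs (by omega)).mono (fun _ h => (h.trans hK).symm)
        (by omega) (by omega)
  rintro _ rfl
  refine Runs.letIn (Q := fun x : ℕ × List ℕ => x.1 = 2 ^ K ∧ IsLevel g K x.2) ?_ ?_
  · have hrun := (levelsP_runs hwf hdeg hg hL hn k3 hh hw5).mono (fun _ h => h)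
      (levels_le_totalWork hL1 h1 (by omega) hKL hnum) (levels_le_totalDepth hL1 hKL k1)
    refine Runs.call3 (Q₁ := fun x => x = g) (Q₂ := fun x => x = K) (Q₃ := fun x => x = L)
      ?_ ?_ ?_ ?_
    · exact Runs.of_flat rfl (by omega) (by omega) rfl
    · exact Runs.of_flat rfl (by omega) (by omega) rfl
    · exact Runs.of_flat rfl (by omega) (by omega) rfl
    · rintro _ _ _ rfl rfl rfl
      exact hrun
  rintro (⟨H, S⟩ : ℕ × List ℕ) ⟨hH, hS⟩
  dsimp only at hH hS
  subst hH
  have hSl : S.length ≤ n := hg ▸ hS.length_le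
  refine Runs.letIn (Q := fun x => x = (s : ℕ) :: S) ?_ ?_
  · have hrun := (appendP_runs (w := ω) (a := .word) (l := [(s : ℕ)]) (l' := S)
      (by rw [List.length_singleton]; omega)).mono (fun _ h => h)
      (show _ ≤ totalWork n m h L by rw [List.length_singleton]; omega)
      (show 1 ≤ totalDepth h L by omega)
    refine Runs.call2 (Q₁ := fun x : List ℕ => x = [(s : ℕ)]) (Q₂ := fun x => x = S) ?_ ?_ ?_
    · refine (Runs.tab (a := .word) (ℓ := 1) (Q := fun _ x => x = (s : ℕ)) (u := fun _ => 1) ?_ ?_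
        (by simp; omega)).imp ?_
      · exact Runs.of_flat rfl (by omega) (by omega) (by simp [m1])
      · exact fun i hi => Runs.of_flat rfl le_rfl (by omega) rfl
      · rintro (l : List ℕ) ⟨l1, l2⟩
        obtain ⟨a, rfl⟩ := List.length_eq_one_iff.1 l1
        exact congrArg (fun x => [x]) (l2 0 one_pos)
    · exact Runs.of_flat rfl (by omega) (by omega) rfl
    · rintro _ _ rfl rfl
      exact hrun
  rintro _ rfl
  have hzH : (S.length + 1) * 2 ^ K ≤ 39 * n * L := by
    have e1 := hS.length_mul_le
    rw [hg, hL] at e1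
    have e2 : n ≤ n * L := Nat.le_mul_of_pos_right _ hL1
    calc (S.length + 1) * 2 ^ K = S.length * 2 ^ K + 2 ^ K := by ring
      _ ≤ 36 * n * L + 3 * (n * L) := by omega
      _ = 39 * n * L := by ring
  have hzh : (S.length + 1) * h ≤ 73 * n * L ^ 2 := by
    have e1 := hS.length_mul_le
    rw [hg, hL] at e1
    have e2 : n * 1 ≤ n * L ^ 2 := Nat.mul_le_mul_left _ (Nat.one_le_pow _ _ hL1)
    calc (S.length + 1) * h = S.length * h + h := by ring
      _ ≤ S.length * (2 * (2 ^ K * L)) + h := by gcongr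
      _ = 2 * (S.length * 2 ^ K) * L + h := by ring
      _ ≤ 2 * (36 * n * L) * L + n * L ^ 2 := by gcongr; omega
      _ = 73 * n * L ^ 2 := by ring
  have hK0 := Nat.one_le_two_pow (n := K)
  have hKL2 : 2 * 2 ^ K * 2 ^ (L + 1) ≤ 24 * n ^ 2 :=
    calc 2 * 2 ^ K * 2 ^ (L + 1) = 4 * (2 ^ K * 2 ^ L) := by rw [pow_succ]; ring
      _ ≤ 4 * (3 * n * (2 * n)) := by gcongr
      _ = 24 * n ^ 2 := by ring
  have hKL3 : 2 * 2 ^ K * 2 ^ L ≤ 24 * n ^ 2 :=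
    (Nat.mul_le_mul_left _ (Nat.pow_le_pow_right (by norm_num) (Nat.le_succ L))).trans hKL2
  refine Runs.letIn (Q := fun D : List (ℕ × ℝ) => D.length = n ∧
    (∀ t < n, (D.getD t (0, 0)).1 ≤ 2 * 2 ^ K * 2 ^ L + 2 * 2 ^ K + 1) ∧
      IsDistArray g s (2 ^ L) D) ?_ ?_
  · have hmeets : Meets g (2 ^ K) ((s : ℕ) :: S) := fun u v p hu hp hk => by
      obtain ⟨z, hz, hz'⟩ := hS.meets u v p hu hp hk
      exact ⟨z, List.mem_cons_of_mem _ hz, hz'⟩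
    have hlt : ∀ z ∈ (s : ℕ) :: S, z < g.length := by
      intro z hz
      rcases List.mem_cons.1 hz with rfl | hz
      · rw [hg]; exact s.2
      · exact hS.lt z hz
    have hrun := (finalP_runs (L := L) (w := ω) hwf hdeg hg hn hK0 hlt hmeets
      (by rw [List.length_cons]; omega) (by rw [List.length_cons]; omega) (by omega)).mono
      (fun _ h => h) (final_le_totalWork (m := m) hL1 h1 (by omega) hg hnum
        (by rw [List.length_cons]; omega) (by rw [List.length_cons]; omega) hzh hzH)
      (final_le_totalDepth hL1 hL k1)
    refine Runs.call4 (Q₁ := fun x => x = g) (Q₂ := fun x => x = (s : ℕ) :: S)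
      (Q₃ := fun x => x = 2 * 2 ^ K) (Q₄ := fun x => x = L) ?_ ?_ ?_ ?_ ?_
    · exact Runs.of_flat rfl (by omega) (by omega) rfl
    · exact Runs.of_flat rfl (by omega) (by omega) rfl
    · refine Runs.of_flat rfl (by omega) (by omega) ?_
      have e1 : 2 % 2 ^ ω = 2 := Nat.mod_eq_of_lt (by omega)
      have e2 : (2 * 2 ^ K) % 2 ^ ω = 2 * 2 ^ K := Nat.mod_eq_of_lt (by omega)
      simp [e1, e2]
    · exact Runs.of_flat rfl (by omega) (by omega) rfl
    · rintro _ _ _ _ rfl rfl rfl rfl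
      exact hrun
  rintro (D : List (ℕ × ℝ)) ⟨hDl, hDB, hD⟩
  have hDn : ∀ t < n, (D.getD t (0, 0)).1 ≤ n := fun t ht => by
    rcases Nat.eq_zero_or_pos (D.getD t (0, 0)).1 with h0 | h0
    · omega
    · exact (hin.isDist_of_ne_zero hG hD hnL (t := ⟨t, ht⟩) h0.ne').2
  have hrun := (outP_runs (w := ω) hwf hdeg hg (by omega) hDB hDn hnL (by omega)).mono
    (fun out ⟨o1, par, o2, o3⟩ => hin.isSolution hG hD hnL o2 o1 o3)
    (out_le_totalWork (m := m) hL1 h1 (by omega) hL2 hnum)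
    ((show _ ≤ 3 * L + 3 by omega).trans c1)
  refine Runs.call3 (Q₁ := fun x => x = g) (Q₂ := fun x => x = D) (Q₃ := fun x => x = L)
    ?_ ?_ ?_ ?_
  · exact Runs.of_flat rfl (by omega) (by omega) rfl
  · exact Runs.of_flat rfl (by omega) (by omega) rfl
  · exact Runs.of_flat rfl (by omega) (by omega) rfl
  · rintro _ _ _ rfl rfl rfl
    exact hrun

/-- Since `n ≥ 2`, rounding up the logarithm costs only a constant factor. -/
theorem clog_le_mul_log {n : ℕ} (hn : 2 ≤ n) : (Nat.clog 2 n : ℝ) ≤ 3 * Real.log n := by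
  have h1 : (2 : ℝ) ^ (Nat.clog 2 n) ≤ 2 * n := by exact_mod_cast two_pow_clog_le hn rfl
  have h2 : (2 : ℝ) ^ (Nat.clog 2 n) ≤ n ^ 2 := by
    have : (2 : ℝ) ≤ n := by exact_mod_cast hn
    nlinarith
  have h3 := Real.log_le_log (by positivity) h2
  rw [Real.log_pow, Real.log_pow, Nat.cast_ofNat] at h3
  have h4 := Real.log_two_gt_d9
  have h5 : (0 : ℝ) ≤ Nat.clog 2 n := Nat.cast_nonneg _
  nlinarith

theorem totalWork_le {n m h : ℕ} (hn : 2 ≤ n) (h1 : 1 ≤ h) :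
    (totalWork n m h (Nat.clog 2 n) : ℝ) ≤ 10 ^ 12 * ((m : ℝ) * n * Real.log n ^ 2 +
      (n : ℝ) ^ 3 / (h : ℝ) ^ 3 * Real.log n ^ 7 + (n : ℝ) ^ 2 * h * Real.log n ^ 11) := by
  have hL := clog_le_mul_log hn
  generalize Nat.clog 2 n = L at hL ⊢
  have hl : 0 ≤ Real.log n := Real.log_natCast_nonneg n
  have hh : (0 : ℝ) < h := by exact_mod_cast h1
  have e1 : ((73 * n * L ^ 2 / h : ℕ) : ℝ) ≤ 73 * n * L ^ 2 / h := by
    refine Nat.cast_div_le.trans (le_of_eq ?_)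
    push_cast
    rfl
  have e2 : (L : ℝ) * (73 * n * L ^ 2 / h) ^ 3 ≤
      73 ^ 3 * 3 ^ 7 * ((n : ℝ) ^ 3 / (h : ℝ) ^ 3 * Real.log n ^ 7) :=
    calc (L : ℝ) * (73 * n * L ^ 2 / h) ^ 3 = 73 ^ 3 * ((n : ℝ) ^ 3 / (h : ℝ) ^ 3 * L ^ 7) := by
          rw [div_pow]; ring
      _ ≤ 73 ^ 3 * ((n : ℝ) ^ 3 / (h : ℝ) ^ 3 * (3 * Real.log n) ^ 7) := by gcongr
      _ = _ := by ring
  have e3 : (m : ℝ) * n * L ^ 2 ≤ 9 * ((m : ℝ) * n * Real.log n ^ 2) :=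
    calc (m : ℝ) * n * L ^ 2 ≤ m * n * (3 * Real.log n) ^ 2 := by gcongr
      _ = _ := by ring
  have e4 : (n : ℝ) ^ 2 * h * L ^ 11 ≤ 3 ^ 11 * ((n : ℝ) ^ 2 * h * Real.log n ^ 11) :=
    calc (n : ℝ) ^ 2 * h * L ^ 11 ≤ n ^ 2 * h * (3 * Real.log n) ^ 11 := by gcongr
      _ = _ := by ring
  have e5 : (L : ℝ) * ((73 * n * L ^ 2 / h : ℕ) : ℝ) ^ 3 ≤ L * (73 * n * L ^ 2 / h) ^ 3 := by
    gcongr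
  have p1 : 0 ≤ (m : ℝ) * n * Real.log n ^ 2 := by positivity
  have p2 : 0 ≤ (n : ℝ) ^ 3 / (h : ℝ) ^ 3 * Real.log n ^ 7 := by positivity
  have p3 : 0 ≤ (n : ℝ) ^ 2 * h * Real.log n ^ 11 := by positivity
  rw [totalWork, Nat.cast_add, Nat.cast_mul, Nat.cast_mul, Nat.cast_pow _ 3]
  push_cast at e5 ⊢
  linarith

theorem totalDepth_le {n h : ℕ} (hn : 2 ≤ n) :
    (totalDepth h (Nat.clog 2 n) : ℝ) ≤ 10 ^ 12 * ((h : ℝ) + Real.log n ^ 11) := by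
  have hL := clog_le_mul_log hn
  generalize Nat.clog 2 n = L at hL ⊢
  have hl : 0 ≤ Real.log n := Real.log_natCast_nonneg n
  have e1 : (L : ℝ) ^ 11 ≤ 3 ^ 11 * Real.log n ^ 11 :=
    calc (L : ℝ) ^ 11 ≤ (3 * Real.log n) ^ 11 := by gcongr
      _ = _ := by ring
  have p1 : 0 ≤ Real.log n ^ 11 := by positivity
  have p2 : (0 : ℝ) ≤ h := Nat.cast_nonneg _
  rw [totalDepth]
  push_cast
  linarith

end SSSP

theorem mainTheorem4 :
    ∃ (P : Par.Prog SSSP.inputTy SSSP.outputTy) (κ : ℕ) (C : ℝ),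
      ∀ (n m : ℕ) (G : Digraph (Fin n)) (w : Fin n → Fin n → ℝ)
        (e : Fin m ≃ {a : Fin n × Fin n // G.Adj a.1 a.2}) (s : Fin n) (h : ℕ),
        2 ≤ n → 1 ≤ h → h ≤ n → SSSP.NoNegativeCycle G w →
        SSSP.IsSolution G w s (P.run (κ * Nat.clog 2 n) (SSSP.encode G w e s h)).val ∧
        ((P.run (κ * Nat.clog 2 n) (SSSP.encode G w e s h)).work : ℝ) ≤
          C * ((m : ℝ) * n * Real.log n ^ 2 + (n : ℝ) ^ 3 / (h : ℝ) ^ 3 * Real.log n ^ 7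
            + (n : ℝ) ^ 2 * h * Real.log n ^ 11) ∧
        ((P.run (κ * Nat.clog 2 n) (SSSP.encode G w e s h)).depth : ℝ) ≤
          C * ((h : ℝ) + Real.log n ^ 11) := by
  refine ⟨SSSP.shortestPathsP, 10, SSSP.shortestPathsP.size * 10 ^ 12, ?_⟩
  intro n m G w e s h hn h1 hh hG
  have hr := SSSP.shortestPathsP_runs e s rfl hn h1 hh hG
  refine ⟨hr.val, ?_, ?_⟩
  · rw [mul_assoc]
    refine le_trans (by exact_mod_cast hr.work) (mul_le_mul_of_nonneg_left
      (SSSP.totalWork_le hn h1) (Nat.cast_nonneg _))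
  · rw [mul_assoc]
    refine le_trans (by exact_mod_cast hr.depth) (mul_le_mul_of_nonneg_left
      (SSSP.totalDepth_le hn) (Nat.cast_nonneg _))
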